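/- All matroids and graphs are finite; graphs may have loops and parallel edges. A matroid is \emph{frame} if it has an extension (a matroid of which it is a restriction) with a basis $B$ such that every element of the extension is spanned by at most two elements of $B$. A \emph{biased graph} $\Omega=(G,\mathcal B)$ is a graph $G$ with a collection $\mathcal B$ of its cycles, called \emph{balanced} (the other cycles are \emph{unbalanced}), such that no theta subgraph (two distinct vertices joined by three internally disjoint paths) contains exactly two balanced cycles. Its frame matroid $F(\Omega)$ is the matroid on $E(G)$ whose circuits are the edge sets of: balanced cycles; pairs of edge-disjoint unbalanced cycles meeting in exactly one vertex; pairs of vertex-disjoint unbalanced cycles together with a path connecting them (meeting each cycle only in an end of the path); and theta subgraphs all three of whose cycles are unbalanced. For a matroid $N$ and $L\subseteq E(N)$, the \emph{matroidal} $(N,L)$ is \emph{frame} if there is a biased graph $\Omega$ with $N=F(\Omega)$ in which every element of $L$ is an unbalanced loop. The \emph{2-sum} of matroids $M_1,M_2$ with disjoint ground sets on $e_1\in E(M_1)$ and $e_2\in E(M_2)$ is the matroid on $(E(M_1)\cup E(M_2))\setminus\{e_1,e_2\}$ whose circuits are the circuits of $M_i$ avoiding $e_i$ ($i=1,2$) together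 with the sets $(C_1\cup C_2)\setminus\{e_1,e_2\}$ where $C_i$ is a circuit of $M_i$ containing $e_i$ ($i=1,2$). For $L\subseteq E(N)$, let $N\oplus_2 U_{2,4}^{L}$ denote the matroid obtained from $N$ by taking, for the elements $e$ of $L$ one after another, the 2-sum on $e$ with a new copy of the uniform matroid $U_{2,4}$ (these 2-sums exist exactly when no element of $L$ is a loop of $N$). **Theorem.** Let $N$ be a matroid and let $L\subseteq E(N)$ be such that $N\oplus_2 U_{2,4}^{L}$ exists. Then $N\oplus_2 U_{2,4}^{L}$ is frame if and only if the matroidal $(N,L)$ is frame. -/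

import Mathlib

/-! ### Paths, cycles and theta graphs in multigraphs -/

/-- `G.PathOn x y W P`: there is a path of `G` (no repeated vertices) from `x` to `y`
with vertex set `W` and edge set `P`. -/
inductive Graph.PathOn {V E : Type*} (G : Graph V E) : V → V → Set V → Set E → Prop
  | nil {x : V} (hx : x ∈ G.vertexSet) : G.PathOn x x {x} ∅
  | cons {x y z : V} {e : E} {W : Set V} {P : Set E} (he : G.IsLink e x y)
      (hP : G.PathOn y z W P) (hx : x ∉ W) : G.PathOn x z (insert x W) (insert e P)

/-- `G.CycleOn W C`: there is a cycle of `G` with vertex set `W` and edge set `C`, that is, a path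
closed up by a further edge joining its ends. A loop is a cycle with one edge, and two parallel
links form a cycle with two edges. -/
def Graph.CycleOn {V E : Type*} (G : Graph V E) (W : Set V) (C : Set E) : Prop :=
  ∃ (x y : V) (e : E) (P : Set E), G.PathOn x y W P ∧ G.IsLink e x y ∧ e ∉ P ∧ C = insert e P

/-- `P₁`, `P₂`, `P₃` are the edge sets of three internally disjoint paths between
the same two distinct vertices of `G`; so `P₁ ∪ P₂ ∪ P₃` is the edge set of a theta subgraph,
whose three cycles are `P₁ ∪ P₂`, `P₁ ∪ P₃` and `P₂ ∪ P₃`. -/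
def Graph.IsTheta {V E : Type*} (G : Graph V E) (P₁ P₂ P₃ : Set E) : Prop :=
  ∃ (x y : V) (W₁ W₂ W₃ : Set V), x ≠ y ∧
    G.PathOn x y W₁ P₁ ∧ G.PathOn x y W₂ P₂ ∧ G.PathOn x y W₃ P₃ ∧
    W₁ ∩ W₂ = {x, y} ∧ W₁ ∩ W₃ = {x, y} ∧ W₂ ∩ W₃ = {x, y} ∧
    Disjoint P₁ P₂ ∧ Disjoint P₁ P₃ ∧ Disjoint P₂ P₃

/-! ### Biased graphs and their frame matroids -/

/-- A finite biased graph: a finite multigraph with a collection of cycles (given by their edge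
sets), called balanced, such that no theta subgraph contains exactly two balanced cycles. -/
structure BiasedGraph (V E : Type*) where
  graph : Graph V E
  finite_vertexSet : graph.vertexSet.Finite
  finite_edgeSet : graph.edgeSet.Finite
  balanced : Set (Set E)
  cycle_of_balanced : ∀ C ∈ balanced, ∃ W, graph.CycleOn W C
  theta_property : ∀ P₁ P₂ P₃ : Set E, graph.IsTheta P₁ P₂ P₃ →
    P₁ ∪ P₂ ∈ balanced → P₂ ∪ P₃ ∈ balanced → P₁ ∪ P₃ ∈ balanced

namespace BiasedGraph

/-- There is an unbalanced cycle with vertex set `W` and edge set `C`. -/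
def UnbalancedCycleOn {V E : Type*} (Ω : BiasedGraph V E) (W : Set V) (C : Set E) : Prop :=
  Ω.graph.CycleOn W C ∧ C ∉ Ω.balanced

/-- `e` is an unbalanced loop. -/
def IsUnbalancedLoop {V E : Type*} (Ω : BiasedGraph V E) (e : E) : Prop :=
  (∃ x, Ω.graph.IsLoopAt e x) ∧ {e} ∉ Ω.balanced

/-- Tight handcuffs: two edge-disjoint unbalanced cycles meeting in exactly one vertex. -/
def IsTightHandcuff {V E : Type*} (Ω : BiasedGraph V E) (D : Set E) : Prop :=
  ∃ (W₁ W₂ : Set V) (C₁ C₂ : Set E) (v : V),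
    Ω.UnbalancedCycleOn W₁ C₁ ∧ Ω.UnbalancedCycleOn W₂ C₂ ∧
    Disjoint C₁ C₂ ∧ W₁ ∩ W₂ = {v} ∧ D = C₁ ∪ C₂

/-- Loose handcuffs: two vertex-disjoint unbalanced cycles with a path connecting them, which
meets each of the cycles only in an end of the path. -/
def IsLooseHandcuff {V E : Type*} (Ω : BiasedGraph V E) (D : Set E) : Prop :=
  ∃ (W₁ W₂ W : Set V) (C₁ C₂ P : Set E) (x y : V),
    Ω.UnbalancedCycleOn W₁ C₁ ∧ Ω.UnbalancedCycleOn W₂ C₂ ∧ Disjoint W₁ W₂ ∧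
    Ω.graph.PathOn x y W P ∧ W ∩ W₁ = {x} ∧ W ∩ W₂ = {y} ∧ D = C₁ ∪ C₂ ∪ P

/-- A theta subgraph all of whose three cycles are unbalanced. -/
def IsContrabalancedTheta {V E : Type*} (Ω : BiasedGraph V E) (D : Set E) : Prop :=
  ∃ P₁ P₂ P₃ : Set E, Ω.graph.IsTheta P₁ P₂ P₃ ∧
    P₁ ∪ P₂ ∉ Ω.balanced ∧ P₁ ∪ P₃ ∉ Ω.balanced ∧ P₂ ∪ P₃ ∉ Ω.balanced ∧ D = P₁ ∪ P₂ ∪ P₃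

/-- The circuits of the frame matroid `F(Ω)` of a biased graph `Ω`. -/
def IsFrameCircuit {V E : Type*} (Ω : BiasedGraph V E) (D : Set E) : Prop :=
  D ∈ Ω.balanced ∨ Ω.IsTightHandcuff D ∨ Ω.IsLooseHandcuff D ∨ Ω.IsContrabalancedTheta D

/-- `M = F(Ω)`: the ground set of `M` is the edge set of `Ω`, and `M` has the circuits
of the frame matroid of `Ω`. -/
def Represents {V E : Type*} (Ω : BiasedGraph V E) (M : Matroid E) : Prop :=
  M.E = Ω.graph.edgeSet ∧ ∀ D, M.IsCircuit D ↔ Ω.IsFrameCircuit D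

end BiasedGraph

namespace Matroid

/-! ### Frame matroids and frame matroidals -/

/-- A (finite) matroid is frame if it has an extension with a basis `B` such that every element
is spanned by at most two elements of `B`. The extension `N` lives on `α ⊕ V`, with `M` copied
to the left summand. (An element of a frame matroid of rank at most one can only
be spanned by fewer than two elements of `B`, whence `at most`.) -/
def IsFrame {α : Type*} (M : Matroid α) : Prop :=
  ∃ (V : Type) (N : Matroid (α ⊕ V)) (B : Set (α ⊕ V)), N.Finite ∧
    M.map Sum.inl Sum.inl_injective.injOn ≤r N ∧ N.IsBase B ∧
    ∀ e ∈ N.E, ∃ S ⊆ B, S.encard ≤ 2 ∧ e ∈ N.closure S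

/-- The matroidal `(M, L)` is frame: `M` is represented by a biased graph in which every element
of `L` is an unbalanced loop. -/
def IsFrameMatroidal {α : Type*} (M : Matroid α) (L : Set α) : Prop :=
  ∃ (V : Type) (Ω : BiasedGraph V α), Ω.Represents M ∧ ∀ e ∈ L, Ω.IsUnbalancedLoop e

/-! ### 2-sums -/

/-- `M` is the 2-sum of `M₁` and `M₂` (with disjoint ground sets) on `e₁` and `e₂`. -/
structure IsTwoSum {α : Type*} (M₁ : Matroid α) (e₁ : α) (M₂ : Matroid α) (e₂ : α)
    (M : Matroid α) : Prop where
  disjoint : Disjoint M₁.E M₂.E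
  left_mem : e₁ ∈ M₁.E
  right_mem : e₂ ∈ M₂.E
  ground_eq : M.E = (M₁.E ∪ M₂.E) \ {e₁, e₂}
  isCircuit_iff : ∀ C, M.IsCircuit C ↔
    (M₁.IsCircuit C ∧ e₁ ∉ C) ∨ (M₂.IsCircuit C ∧ e₂ ∉ C) ∨
    ∃ C₁ C₂, M₁.IsCircuit C₁ ∧ e₁ ∈ C₁ ∧ M₂.IsCircuit C₂ ∧ e₂ ∈ C₂ ∧
      C = (C₁ ∪ C₂) \ {e₁, e₂}

/-- `U` is a copy of the uniform matroid of rank two on four elements. -/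
def IsU24 {α : Type*} (U : Matroid α) : Prop :=
  U.E.encard = 4 ∧ ∀ I, U.Indep I ↔ I ⊆ U.E ∧ I.encard ≤ 2

/-- `M` is obtained from `N` by taking, for each `e ∈ L`, a 2-sum with a copy of `U_{2,4}`
on the element `e` (one element of `L` at a time; each new copy of `U_{2,4}` uses labels
that are not in use). -/
inductive IsU24Sum {α : Type*} (N : Matroid α) : Set α → Matroid α → Prop
  | empty : IsU24Sum N ∅ N
  | step {L : Set α} {M U M' : Matroid α} {e f : α} (hM : IsU24Sum N L M)
      (he : e ∈ N.E) (heL : e ∉ L) (hU : U.IsU24) (hM' : M.IsTwoSum e U f M') :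
      IsU24Sum N (insert e L) M'

end Matroid

/-! ### 2-sums exist -/

namespace Matroid

/-- The independent sets of the 2-sum of `M₁` and `M₂` on `e₁` and `e₂`. -/
def TwoSumIndep {α : Type*} (M₁ : Matroid α) (e₁ : α) (M₂ : Matroid α) (e₂ : α)
    (I : Set α) : Prop :=
  ∃ I₁ I₂, I = I₁ ∪ I₂ ∧ M₁.Indep I₁ ∧ e₁ ∉ I₁ ∧ M₂.Indep I₂ ∧ e₂ ∉ I₂ ∧
    (M₁.Indep (insert e₁ I₁) ∨ M₂.Indep (insert e₂ I₂))

theorem TwoSumIndep.symm {α : Type*} {M₁ M₂ : Matroid α} {e₁ e₂ : α} {I : Set α}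
    (h : TwoSumIndep M₁ e₁ M₂ e₂ I) : TwoSumIndep M₂ e₂ M₁ e₁ I := by
  obtain ⟨I₁, I₂, rfl, h1, h2, h3, h4, h5⟩ := h
  exact ⟨I₂, I₁, Set.union_comm _ _, h3, h4, h1, h2, h5.symm⟩

theorem exists_insert_indep {α : Type*} {M : Matroid α} [M.Finite] {I J : Set α}
    (hI : M.Indep I) (hJ : M.Indep J) (h : I.ncard < J.ncard) :
    ∃ x ∈ J, x ∉ I ∧ M.Indep (insert x I) := by
  have h' : I.encard < J.encard := by
    rw [← (M.set_finite I hI.subset_ground).cast_ncard_eq,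
      ← (M.set_finite J hJ.subset_ground).cast_ncard_eq]
    exact_mod_cast h
  obtain ⟨x, hx, hx'⟩ := hI.augment hJ h'
  exact ⟨x, hx.1, hx.2, hx'⟩

/-- Augmentation when the left part of the smaller set does not span `e₁`. -/
theorem twoSumIndep_augment_aux {α : Type*} {M₁ M₂ : Matroid α} [M₁.Finite] [M₂.Finite]
    {e₁ e₂ : α} (hdj : Disjoint M₁.E M₂.E) {I₁ I₂ J₁ J₂ : Set α}
    (hI₁ : M₁.Indep I₁) (heI₁ : e₁ ∉ I₁) (hI₂ : M₂.Indep I₂) (heI₂ : e₂ ∉ I₂)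
    (hI : M₁.Indep (insert e₁ I₁))
    (hJ₁ : M₁.Indep J₁) (heJ₁ : e₁ ∉ J₁) (hJ₂ : M₂.Indep J₂) (heJ₂ : e₂ ∉ J₂)
    (hJ : M₁.Indep (insert e₁ J₁) ∨ M₂.Indep (insert e₂ J₂))
    (hlt : I₁.ncard + I₂.ncard < J₁.ncard + J₂.ncard) :
    ∃ x ∈ J₁ ∪ J₂, x ∉ I₁ ∪ I₂ ∧ TwoSumIndep M₁ e₁ M₂ e₂ (insert x (I₁ ∪ I₂)) := by
  have fin₁ : ∀ {X}, M₁.Indep X → X.Finite := fun h ↦ M₁.set_finite _ h.subset_ground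
  have fin₂ : ∀ {X}, M₂.Indep X → X.Finite := fun h ↦ M₂.set_finite _ h.subset_ground
  have key₁ : ∀ x ∈ J₁, x ∉ I₁ → M₁.Indep (insert x I₁) →
      (M₁.Indep (insert e₁ (insert x I₁)) ∨ M₂.Indep (insert e₂ I₂)) →
      ∃ x ∈ J₁ ∪ J₂, x ∉ I₁ ∪ I₂ ∧ TwoSumIndep M₁ e₁ M₂ e₂ (insert x (I₁ ∪ I₂)) := by
    intro x hx hxI h1 h2
    refine ⟨x, .inl hx, ?_, insert x I₁, I₂, by rw [Set.insert_union], h1, ?_, hI₂, heI₂, h2⟩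
    · rintro (h | h)
      · exact hxI h
      · exact hdj.le_bot ⟨hJ₁.subset_ground hx, hI₂.subset_ground h⟩
    · rintro (rfl | h)
      · exact heJ₁ hx
      · exact heI₁ h
  have key₂ : ∀ x ∈ J₂, x ∉ I₂ → M₂.Indep (insert x I₂) →
      ∃ x ∈ J₁ ∪ J₂, x ∉ I₁ ∪ I₂ ∧ TwoSumIndep M₁ e₁ M₂ e₂ (insert x (I₁ ∪ I₂)) := by
    intro x hx hxI h1
    refine ⟨x, .inr hx, ?_, I₁, insert x I₂, by rw [Set.union_insert], hI₁, heI₁, h1, ?_, .inl hI⟩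
    · rintro (h | h)
      · exact hdj.le_bot ⟨hI₁.subset_ground h, hJ₂.subset_ground hx⟩
      · exact hxI h
    · rintro (rfl | h)
      · exact heJ₂ hx
      · exact heI₂ h
  by_cases h2 : I₂.ncard < J₂.ncard
  · obtain ⟨x, hx, hxI, hi⟩ := exists_insert_indep hI₂ hJ₂ h2
    exact key₂ x hx hxI hi
  have cI : (insert e₁ I₁).ncard = I₁.ncard + 1 := Set.ncard_insert_of_notMem heI₁ (fin₁ hI₁)
  by_cases hsp : M₂.Indep (insert e₂ I₂)
  · obtain ⟨x, hx, hxI, hi⟩ := exists_insert_indep hI₁ hJ₁ (by omega)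
    exact key₁ x hx hxI hi (.inr hsp)
  rcases hJ with hJ | hJ
  · have cJ : (insert e₁ J₁).ncard = J₁.ncard + 1 := Set.ncard_insert_of_notMem heJ₁ (fin₁ hJ₁)
    obtain ⟨x, hx, hxI, hi⟩ := exists_insert_indep hI hJ (by omega)
    have hxe : x ≠ e₁ := fun h ↦ hxI (.inl h)
    have hxJ : x ∈ J₁ := hx.resolve_left hxe
    rw [Set.insert_comm] at hi
    exact key₁ x hxJ (fun h ↦ hxI (.inr h)) (hi.subset (Set.subset_insert _ _)) (.inl hi)
  · have cJ : (insert e₂ J₂).ncard = J₂.ncard + 1 := Set.ncard_insert_of_notMem heJ₂ (fin₂ hJ₂)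
    by_cases h3 : I₂.ncard = J₂.ncard
    · obtain ⟨x, hx, hxI, hi⟩ := exists_insert_indep hI₂ hJ (by omega)
      have hxe : x ≠ e₂ := by
        rintro rfl
        exact hsp hi
      exact key₂ x (hx.resolve_left hxe) hxI hi
    · obtain ⟨x, hx, hxI, hi⟩ := exists_insert_indep hI hJ₁ (by omega)
      rw [Set.insert_comm] at hi
      exact key₁ x hx (fun h ↦ hxI (.inr h)) (hi.subset (Set.subset_insert _ _)) (.inl hi)

/-- Two finite matroids on disjoint ground sets have a 2-sum on any two non-loops. -/
theorem exists_isTwoSum {α : Type*} {M₁ M₂ : Matroid α} [M₁.Finite] [M₂.Finite] {e₁ e₂ : α}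
    (hdj : Disjoint M₁.E M₂.E) (he₁ : M₁.Indep {e₁}) (he₂ : M₂.Indep {e₂}) :
    ∃ M : Matroid α, M.Finite ∧ M₁.IsTwoSum e₁ M₂ e₂ M := by
  have he₁E : e₁ ∈ M₁.E := he₁.subset_ground rfl
  have he₂E : e₂ ∈ M₂.E := he₂.subset_ground rfl
  have hd : ∀ {x}, x ∈ M₁.E → x ∈ M₂.E → False := fun h h' ↦ hdj.le_bot ⟨h, h'⟩
  let E : Set α := (M₁.E ∪ M₂.E) \ {e₁, e₂}
  have hE : E.Finite := (M₁.ground_finite.union M₂.ground_finite).subset Set.sdiff_subset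
  have hncard : ∀ {X Y}, M₁.Indep X → M₂.Indep Y → (X ∪ Y).ncard = X.ncard + Y.ncard :=
    fun hX hY ↦ Set.ncard_union_eq (hdj.mono hX.subset_ground hY.subset_ground)
      (M₁.set_finite _ hX.subset_ground) (M₂.set_finite _ hY.subset_ground)
  let T : IndepMatroid α := IndepMatroid.ofFinite hE (TwoSumIndep M₁ e₁ M₂ e₂)
    ⟨∅, ∅, by simp, M₁.empty_indep, by simp, M₂.empty_indep, by simp, by simp [he₁]⟩
    (by
      rintro I _ ⟨J₁, J₂, rfl, h1, h2, h3, h4, h5⟩ hIJ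
      refine ⟨I ∩ J₁, I ∩ J₂, ?_, h1.subset Set.inter_subset_right, fun h ↦ h2 h.2,
        h3.subset Set.inter_subset_right, fun h ↦ h4 h.2,
        h5.imp (fun h ↦ h.subset (Set.insert_subset_insert Set.inter_subset_right))
          (fun h ↦ h.subset (Set.insert_subset_insert Set.inter_subset_right))⟩
      rw [← Set.inter_union_distrib_left, Set.inter_eq_left.2 hIJ])
    (by
      rintro _ _ ⟨I₁, I₂, rfl, a1, a2, a3, a4, a5⟩ ⟨J₁, J₂, rfl, b1, b2, b3, b4, b5⟩ hlt
      rw [hncard a1 a3, hncard b1 b3] at hlt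
      rcases a5 with a5 | a5
      · exact twoSumIndep_augment_aux hdj a1 a2 a3 a4 a5 b1 b2 b3 b4 b5 hlt
      · obtain ⟨x, h1, h2, h3⟩ := twoSumIndep_augment_aux hdj.symm a3 a4 a1 a2 a5 b3 b4 b1 b2
          b5.symm (by omega)
        rw [Set.union_comm] at h1 h2 h3
        exact ⟨x, h1, h2, h3.symm⟩)
    (by
      rintro _ ⟨I₁, I₂, rfl, h1, h2, h3, h4, h5⟩ x (hx | hx)
      · refine ⟨.inl (h1.subset_ground hx), ?_⟩
        rintro (rfl | rfl)
        · exact h2 hx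
        · exact hd (h1.subset_ground hx) he₂E
      · refine ⟨.inr (h3.subset_ground hx), ?_⟩
        rintro (rfl | rfl)
        · exact hd he₁E (h3.subset_ground hx)
        · exact h4 hx)
  have hTI : ∀ I, T.matroid.Indep I ↔ TwoSumIndep M₁ e₁ M₂ e₂ I := fun I ↦ Iff.rfl
  have hTE : T.matroid.E = E := rfl
  refine ⟨T.matroid, ⟨hE⟩, hdj, he₁E, he₂E, rfl, ?_⟩
  generalize T.matroid = M at hTI hTE
  -- the sets on the right-hand side of the description of the circuits
  let R : Set α → Prop := fun C ↦ (M₁.IsCircuit C ∧ e₁ ∉ C) ∨ (M₂.IsCircuit C ∧ e₂ ∉ C) ∨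
    ∃ C₁ C₂, M₁.IsCircuit C₁ ∧ e₁ ∈ C₁ ∧ M₂.IsCircuit C₂ ∧ e₂ ∈ C₂ ∧
      C = (C₁ ∪ C₂) \ {e₁, e₂}
  have split : ∀ {X I₁ I₂ : Set α}, X = I₁ ∪ I₂ → I₁ ⊆ M₁.E → I₂ ⊆ M₂.E →
      X ∩ M₁.E ⊆ I₁ ∧ X ∩ M₂.E ⊆ I₂ := by
    rintro X I₁ I₂ rfl h1 h2
    exact ⟨fun x hx ↦ hx.1.resolve_right fun h ↦ hd hx.2 (h2 h),
      fun x hx ↦ hx.1.resolve_left fun h ↦ hd (h1 h) hx.2⟩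
  have hRE : ∀ C, R C → C ⊆ E := by
    rintro C (⟨h, h'⟩ | ⟨h, h'⟩ | ⟨C₁, C₂, h1, h2, h3, h4, rfl⟩) x hx
    · refine ⟨.inl (h.subset_ground hx), ?_⟩
      rintro (rfl | rfl)
      · exact h' hx
      · exact hd (h.subset_ground hx) he₂E
    · refine ⟨.inr (h.subset_ground hx), ?_⟩
      rintro (rfl | rfl)
      · exact hd he₁E (h.subset_ground hx)
      · exact h' hx
    · exact ⟨hx.1.imp (fun h ↦ h1.subset_ground h) (fun h ↦ h3.subset_ground h), hx.2⟩
  have hRdep : ∀ C, R C → ¬ M.Indep C := by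
    intro C hC hi
    obtain ⟨I₁, I₂, hCI, i1, -, i2, -, i3⟩ := (hTI C).1 hi
    obtain ⟨s1, s2⟩ := split hCI i1.subset_ground i2.subset_ground
    rcases hC with ⟨h, h'⟩ | ⟨h, h'⟩ | ⟨C₁, C₂, h1, h2, h3, h4, rfl⟩
    · exact h.not_indep (i1.subset fun x hx ↦ s1 ⟨hx, h.subset_ground hx⟩)
    · exact h.not_indep (i2.subset fun x hx ↦ s2 ⟨hx, h.subset_ground hx⟩)
    · rcases i3 with i3 | i3
      · refine h1.not_indep (i3.subset fun x hx ↦ ?_)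
        by_cases hxe : x = e₁
        · exact .inl hxe
        · refine .inr (s1 ⟨⟨.inl hx, ?_⟩, h1.subset_ground hx⟩)
          rintro (h | rfl)
          · exact hxe h
          · exact hd (h1.subset_ground hx) he₂E
      · refine h3.not_indep (i3.subset fun x hx ↦ ?_)
        by_cases hxe : x = e₂
        · exact .inl hxe
        · refine .inr (s2 ⟨⟨.inr hx, ?_⟩, h3.subset_ground hx⟩)
          rintro (rfl | h)
          · exact hd he₁E (h3.subset_ground hx)
          · exact hxe h
  have hex : ∀ C, M.IsCircuit C → ∃ D ⊆ C, R D := by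
    intro C hC
    have hCE : C ⊆ E := hTE ▸ hC.subset_ground
    have hn : ¬ TwoSumIndep M₁ e₁ M₂ e₂ C := fun h ↦ hC.not_indep ((hTI C).2 h)
    have heC₁ : e₁ ∉ C := fun h ↦ (hCE h).2 (.inl rfl)
    have heC₂ : e₂ ∉ C := fun h ↦ (hCE h).2 (.inr rfl)
    by_cases c1 : M₁.Indep (C ∩ M₁.E)
    swap
    · obtain ⟨D, hDC, hD⟩ := ((M₁.not_indep_iff Set.inter_subset_right).1 c1).exists_isCircuit_subset
      exact ⟨D, fun x hx ↦ (hDC hx).1, .inl ⟨hD, fun h ↦ heC₁ (hDC h).1⟩⟩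
    by_cases c2 : M₂.Indep (C ∩ M₂.E)
    swap
    · obtain ⟨D, hDC, hD⟩ := ((M₂.not_indep_iff Set.inter_subset_right).1 c2).exists_isCircuit_subset
      exact ⟨D, fun x hx ↦ (hDC hx).1, .inr (.inl ⟨hD, fun h ↦ heC₂ (hDC h).1⟩)⟩
    have c3 : ¬ (M₁.Indep (insert e₁ (C ∩ M₁.E)) ∨ M₂.Indep (insert e₂ (C ∩ M₂.E))) := by
      intro h
      refine hn ⟨C ∩ M₁.E, C ∩ M₂.E, ?_, c1, fun h ↦ heC₁ h.1, c2, fun h ↦ heC₂ h.1, h⟩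
      rw [← Set.inter_union_distrib_left, eq_comm, Set.inter_eq_left]
      exact hCE.trans Set.sdiff_subset
    rw [not_or] at c3
    obtain ⟨C₁, s1, hC₁⟩ := ((M₁.not_indep_iff
      (Set.insert_subset he₁E Set.inter_subset_right)).1 c3.1).exists_isCircuit_subset
    obtain ⟨C₂, s2, hC₂⟩ := ((M₂.not_indep_iff
      (Set.insert_subset he₂E Set.inter_subset_right)).1 c3.2).exists_isCircuit_subset
    have m1 : e₁ ∈ C₁ := by
      by_contra h
      exact hC₁.not_indep (c1.subset ((Set.subset_insert_iff_of_notMem h).1 s1))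
    have m2 : e₂ ∈ C₂ := by
      by_contra h
      exact hC₂.not_indep (c2.subset ((Set.subset_insert_iff_of_notMem h).1 s2))
    refine ⟨_, ?_, .inr (.inr ⟨C₁, C₂, hC₁, m1, hC₂, m2, rfl⟩)⟩
    rintro x ⟨hx | hx, hx'⟩
    · exact ((s1 hx).resolve_left fun h ↦ hx' (.inl h)).1
    · exact ((s2 hx).resolve_left fun h ↦ hx' (.inr h)).1
  -- no two sets on the right-hand side are properly nested
  have other : ∀ {M' : Matroid α} {C e}, M'.Indep {e} → M'.IsCircuit C → e ∈ C →
      ∃ x ∈ C, x ≠ e := by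
    intro M' C e he hC heC
    by_contra! h
    exact hC.not_indep (he.subset h)
  have hanti : ∀ C D, R C → R D → D ⊆ C → D = C := by
    rintro C D hC hD hDC
    have s1 : ∀ {C₁ C₂ X : Set α}, M₂.IsCircuit C₂ → X ⊆ M₁.E →
        X ⊆ (C₁ ∪ C₂) \ {e₁, e₂} → X ⊆ C₁ := fun h2 h3 h4 x hx ↦
      (h4 hx).1.resolve_right fun h ↦ hd (h3 hx) (h2.subset_ground h)
    have s2 : ∀ {C₁ C₂ X : Set α}, M₁.IsCircuit C₁ → X ⊆ M₂.E →
        X ⊆ (C₁ ∪ C₂) \ {e₁, e₂} → X ⊆ C₂ := fun h2 h3 h4 x hx ↦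
      (h4 hx).1.resolve_left fun h ↦ hd (h2.subset_ground h) (h3 hx)
    rcases hC with ⟨hC, hC'⟩ | ⟨hC, hC'⟩ | ⟨C₁, C₂, h1, h2, h3, h4, rfl⟩
    · rcases hD with ⟨hD, hD'⟩ | ⟨hD, hD'⟩ | ⟨D₁, D₂, g1, g2, g3, g4, rfl⟩
      · exact hD.eq_of_subset_isCircuit hC hDC
      · obtain ⟨x, hx⟩ := hD.nonempty
        exact (hd (hC.subset_ground (hDC hx)) (hD.subset_ground hx)).elim
      · obtain ⟨x, hx, hxe⟩ := other he₂ g3 g4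
        have hxE := g3.subset_ground hx
        refine (hd (hC.subset_ground (hDC ⟨.inr hx, ?_⟩)) hxE).elim
        rintro (rfl | h)
        · exact hd he₁E hxE
        · exact hxe h
    · rcases hD with ⟨hD, hD'⟩ | ⟨hD, hD'⟩ | ⟨D₁, D₂, g1, g2, g3, g4, rfl⟩
      · obtain ⟨x, hx⟩ := hD.nonempty
        exact (hd (hD.subset_ground hx) (hC.subset_ground (hDC hx))).elim
      · exact hD.eq_of_subset_isCircuit hC hDC
      · obtain ⟨x, hx, hxe⟩ := other he₁ g1 g2
        have hxE := g1.subset_ground hx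
        refine (hd hxE (hC.subset_ground (hDC ⟨.inl hx, ?_⟩))).elim
        rintro (h | rfl)
        · exact hxe h
        · exact hd hxE he₂E
    · rcases hD with ⟨hD, hD'⟩ | ⟨hD, hD'⟩ | ⟨D₁, D₂, g1, g2, g3, g4, rfl⟩
      · have := hD.eq_of_subset_isCircuit h1 (s1 h3 hD.subset_ground hDC)
        exact (hD' (this.symm ▸ h2)).elim
      · have := hD.eq_of_subset_isCircuit h3 (s2 h1 hD.subset_ground hDC)
        exact (hD' (this.symm ▸ h4)).elim
      · have e1 : D₁ ⊆ C₁ := by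
          intro x hx
          by_cases hxe : x = e₁
          · exact hxe ▸ h2
          · have hxE := g1.subset_ground hx
            refine (hDC ⟨.inl hx, ?_⟩).1.resolve_right fun h ↦ hd hxE (h3.subset_ground h)
            rintro (h | rfl)
            · exact hxe h
            · exact hd hxE he₂E
        have e2 : D₂ ⊆ C₂ := by
          intro x hx
          by_cases hxe : x = e₂
          · exact hxe ▸ h4
          · have hxE := g3.subset_ground hx
            refine (hDC ⟨.inr hx, ?_⟩).1.resolve_left fun h ↦ hd (h1.subset_ground h) hxE
            rintro (rfl | h)
            · exact hd he₁E hxE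
            · exact hxe h
        rw [g1.eq_of_subset_isCircuit h1 e1, g3.eq_of_subset_isCircuit h3 e2]
  intro C
  change M.IsCircuit C ↔ R C
  constructor
  · intro hC
    obtain ⟨D, hDC, hD⟩ := hex C hC
    have hDdep : M.Dep D := (M.not_indep_iff (hTE ▸ hRE D hD)).1 (hRdep D hD)
    rw [← hC.eq_of_dep_subset hDdep hDC]
    exact hD
  · intro hC
    have hCdep : M.Dep C := (M.not_indep_iff (hTE ▸ hRE C hC)).1 (hRdep C hC)
    obtain ⟨C', hC'C, hC'⟩ := hCdep.exists_isCircuit_subset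
    obtain ⟨D, hDC', hD⟩ := hex C' hC'
    have := hanti C D hC hD (hDC'.trans hC'C)
    rwa [← (hC'C.antisymm (this ▸ hDC'))]

theorem exists_isU24 {α : Type*} (F : Set α) (hF : F.encard = 4) :
    ∃ U : Matroid α, U.E = F ∧ U.IsU24 := by
  have hFf : F.Finite := Set.finite_of_encard_eq_coe (k := 4) hF
  let T : IndepMatroid α := IndepMatroid.ofFinite hFf (fun I ↦ I ⊆ F ∧ I.encard ≤ 2)
    (by simp)
    (fun I J hJ hIJ ↦ ⟨hIJ.trans hJ.1, (Set.encard_le_encard hIJ).trans hJ.2⟩)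
    (by
      intro I J hI hJ hlt
      have hIf := hFf.subset hI.1
      have hJf := hFf.subset hJ.1
      obtain ⟨x, hxJ, hxI⟩ := Set.exists_mem_notMem_of_ncard_lt_ncard hlt hIf
      refine ⟨x, hxJ, hxI, Set.insert_subset (hJ.1 hxJ) hI.1, ?_⟩
      have h2 : J.ncard ≤ 2 := by
        have := hJ.2
        rw [← hJf.cast_ncard_eq] at this
        exact_mod_cast this
      rw [← (hIf.insert x).cast_ncard_eq, Set.ncard_insert_of_notMem hxI hIf]
      exact_mod_cast (by omega : I.ncard + 1 ≤ 2))
    (fun I hI ↦ hI.1)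
  exact ⟨T.matroid, rfl, hF, fun I ↦ Iff.rfl⟩

/-- If there are enough labels and `L` contains no loop of `N`, then the 2-sum of `N` with
a copy of `U_{2,4}` on each element of `L` exists. -/
theorem exists_isU24Sum {α : Type*} [Infinite α] (N : Matroid α) [N.Finite] (L : Set α)
    (hL : ∀ e ∈ L, N.Indep {e}) : ∃ M, N.IsU24Sum L M := by
  suffices h : ∃ M : Matroid α, M.Finite ∧ N.IsU24Sum L M ∧
      ∀ e, N.Indep {e} → e ∉ L → M.Indep {e} from ⟨h.choose, h.choose_spec.2.1⟩
  have hLf : L.Finite := N.set_finite L fun e he ↦ (hL e he).subset_ground rfl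
  induction L, hLf using Set.Finite.induction_on with
  | empty => exact ⟨N, inferInstance, .empty, fun e he _ ↦ he⟩
  | @insert e L heL hLf ih =>
    obtain ⟨M, hMf, hM, hMi⟩ := ih fun x hx ↦ hL x (.inr hx)
    obtain ⟨F, hFs, hF⟩ := M.ground_finite.infinite_compl.exists_subset_card_eq 4
    obtain ⟨U, hUE, hU⟩ := exists_isU24 (F : Set α) (by simp [hF])
    have hUf : U.Finite := ⟨hUE ▸ F.finite_toSet⟩
    obtain ⟨f, hf⟩ : F.Nonempty := by
      rw [← Finset.card_pos]
      omega
    have hfi : U.Indep {f} := (hU.2 _).2 ⟨by simpa [hUE] using hf, by simp⟩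
    have hdj : Disjoint M.E U.E := by
      rw [hUE]
      exact Set.disjoint_right.2 fun x hx ↦ hFs hx
    have heN := hL e (.inl rfl)
    obtain ⟨M', hM'f, hM'⟩ := exists_isTwoSum hdj (hMi e heN heL) hfi
    refine ⟨M', hM'f, hM.step (heN.subset_ground rfl) heL hU hM', ?_⟩
    intro x hx hxL
    have hxM := hMi x hx fun h ↦ hxL (.inr h)
    have hxE : x ∈ M.E := hxM.subset_ground rfl
    have hxU : x ∉ U.E := fun h ↦ hdj.le_bot ⟨hxE, h⟩
    have hxE' : {x} ⊆ M'.E := by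
      rw [Set.singleton_subset_iff, hM'.ground_eq]
      refine ⟨.inl hxE, ?_⟩
      rintro (rfl | rfl)
      · exact hxL (.inl rfl)
      · exact hxU hM'.right_mem
    by_contra hcon
    obtain ⟨C, hCx, hC⟩ := ((M'.not_indep_iff hxE').1 hcon).exists_isCircuit_subset
    rcases (hM'.isCircuit_iff C).1 hC with ⟨h, -⟩ | ⟨h, -⟩ | ⟨C₁, C₂, -, -, h3, h4, rfl⟩
    · exact h.not_indep (hxM.subset hCx)
    · obtain ⟨y, hy⟩ := h.nonempty
      have hyx : y = x := hCx hy
      exact hxU (hyx ▸ h.subset_ground hy)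
    · have : ∃ y ∈ C₂, y ≠ f := by
        by_contra! h
        exact h3.not_indep (hfi.subset h)
      obtain ⟨y, hy, hyf⟩ := this
      have hyU := h3.subset_ground hy
      have hyx : y = x := hCx ⟨.inr hy, by
        rintro (rfl | h)
        · exact hdj.le_bot ⟨hM'.left_mem, hyU⟩
        · exact hyf h⟩
      exact hxU (hyx ▸ hyU)

end Matroid

/-! Both properties are compared with a third one, a framework. It gives each element at most two
vertices as ends, so that an independent set with all its ends in `W` has at most `W.ncard`
elements, no vertex is an end of exactly one element of a circuit with at least two elements, and no
circuit is separated by a set of vertices. This is the graph of a biased graph without its balanced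
cycles, which can be recovered as those cycles that are circuits. A framework is easier to modify
than a biased graph, since no list of circuits has to be maintained.

Frame matroids and frameworks: given a basis `B` of the extension, the ends of an element are the
members of `B` needed to span it. Conversely, add a joint at every vertex, and call a set
independent if its part in `M` is independent and no vertex set `W` contains more than `W.ncard` of
its elements and joints. The augmentation axiom (`IsFramework.augment`) follows by looking at the
largest vertex set for which equality holds, the largest tight set.

Biased graphs and frameworks: a connected set of edges without leaves is a cycle or contains a theta
or handcuffs (`Graph.exists_isBicycle`), and the cycles of a theta or of handcuffs are its only
nonempty proper subsets that are connected and without leaves (`Graph.IsBicycle.eq_or_mem`). So the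
three conditions determine the circuits once the balanced cycles are known.

One 2-sum with `U_{2,4}` replaces `e` by a triangle `a`, `b`, `c`, any two elements of which act as
`e`. If `e` is a loop at `v`, then three parallel edges from `v` to a new vertex do this.
Conversely, contracting `a` makes `b` a copy of `e`. If `a` is a loop, or `a` and `b` are parallel
links, this copy is a loop, as required. Up to symmetry there remains the case that `a`, `b`, `c`
are the edges of a triangle of the graph. The two ends of one of its edges cannot both lie in tight
sets of independent sets avoiding `e`, since this edge could not be independent of the rest
(`not_inTight_or`). So some vertex `x` of the triangle lies in no such set. Contract the opposite
edge; then `e` is a link at `x`, and it may be rolled up to a loop at `x` (`isFramework_rollEnds`).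
The theorem follows by induction along the sequence of 2-sums. -/

namespace Matroid

/-! ### Frameworks -/

/-- If every vertex of `U` is an end of at least two edges of `X`, and some edge of `X` has at most
one end in `U`, then `X` has more elements than `U`. -/
theorem ncard_lt_of_two_edges {α V : Type*} [Finite V] {ends : α → Set V} {X : Set α} {U : Set V}
    (hX : X.Finite) (hends : ∀ x ∈ X, (ends x).ncard ≤ 2)
    (hdeg : ∀ u ∈ U, ∃ x ∈ X, ∃ y ∈ X, x ≠ y ∧ u ∈ ends x ∧ u ∈ ends y)
    {x₀ : α} (hx₀ : x₀ ∈ X) (h₀ : (ends x₀ ∩ U).ncard ≤ 1) : U.ncard < X.ncard := by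
  classical
  lift X to Finset α using hX
  have hU : U.Finite := U.toFinite
  lift U to Finset V using hU
  simp only [Set.ncard_coe_finset, Finset.mem_coe] at *
  let r : α → V → Prop := fun x u ↦ u ∈ ends x
  -- Double counting of the incidences between `X` and `U`: at least two at each vertex, at most two
  -- on each edge, and at most one on `x₀`.
  have hsum := Finset.sum_card_bipartiteAbove_eq_sum_card_bipartiteBelow (s := X) (t := U) r
  have h1 : ∑ u ∈ U, 2 ≤ ∑ u ∈ U, (X.bipartiteBelow r u).card := by
    refine Finset.sum_le_sum fun u hu ↦ ?_
    obtain ⟨x, hx, y, hy, hxy, h1, h2⟩ := hdeg u hu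
    have : ({x, y} : Finset α) ⊆ X.bipartiteBelow r u := by
      intro z hz
      simp only [Finset.mem_insert, Finset.mem_singleton] at hz
      rw [Finset.mem_bipartiteBelow]
      rcases hz with rfl | rfl
      · exact ⟨hx, h1⟩
      · exact ⟨hy, h2⟩
    simpa [Finset.card_pair hxy] using Finset.card_le_card this
  have hab : ∀ x, (U.bipartiteAbove r x).card = (ends x ∩ U).ncard := by
    intro x
    rw [← Set.ncard_coe_finset]
    congr 1
    ext u
    simp [r, and_comm]
  have h2 : ∑ x ∈ X, (U.bipartiteAbove r x).card < ∑ x ∈ X, 2 := by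
    refine Finset.sum_lt_sum (fun x hx ↦ ?_) ⟨x₀, hx₀, ?_⟩
    · rw [hab]
      exact (Set.ncard_le_ncard Set.inter_subset_left (Set.toFinite _)).trans (hends x hx)
    · rw [hab]
      omega
  simp only [Finset.sum_const, smul_eq_mul] at h1 h2
  omega

/-- The elements of `M` are the edges of a graph in which `x` has the ends `ends x`, in such a way
that `M` has the properties of the frame matroid of a biased graph on that graph.
Loops of `M` are allowed to have no ends. -/
structure IsFramework {α V : Type*} (M : Matroid α) (ends : α → Set V) : Prop where
  ncard_ends_le : ∀ x ∈ M.E, (ends x).ncard ≤ 2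
  ncard_le : ∀ ⦃A W⦄, M.Indep A → (∀ x ∈ A, ends x ⊆ W) → A.ncard ≤ W.ncard
  exists_ne : ∀ ⦃C⦄, M.IsCircuit C → C.Nontrivial → ∀ x ∈ C, ∀ v ∈ ends x,
    ∃ y ∈ C, y ≠ x ∧ v ∈ ends y
  connected : ∀ ⦃C W⦄, M.IsCircuit C → (∀ x ∈ C, ends x ⊆ W ∨ Disjoint (ends x) W) →
    (∃ x ∈ C, ends x ⊆ W) → ∀ x ∈ C, ends x ⊆ W

/-- `M` has a framework in which the elements of `K` are non-loops with exactly one end. -/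
def HasFramework {α : Type*} (M : Matroid α) (K : Set α) : Prop :=
  ∃ (V : Type) (_ : Finite V) (ends : α → Set V), M.IsFramework ends ∧
    ∀ e ∈ K, M.Indep {e} ∧ ∃ v, ends e = {v}

/-- The number of elements of `A` with both ends in `W`, and elements of `J` in `W`. -/
noncomputable def insideCount {α V : Type*} (ends : α → Set V) (A : Set α) (J W : Set V) : ℕ :=
  {x | x ∈ A ∧ ends x ⊆ W}.ncard + (J ∩ W).ncard

/-- `W` contains as many elements of `A` and `J` as it has vertices. -/
def Tight {α V : Type*} (ends : α → Set V) (A : Set α) (J W : Set V) : Prop :=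
  W.ncard ≤ insideCount ends A J W

theorem IsCircuit.nontrivial_of_indep {α : Type*} {M : Matroid α} {C : Set α} (hC : M.IsCircuit C) {t : α} (ht : t ∈ C)
    (hti : M.Indep {t}) : C.Nontrivial := by
  by_contra h
  rw [Set.not_nontrivial_iff] at h
  exact hC.not_indep (hti.subset fun x hx ↦ h hx ht)

/-! ### Tight vertex sets and the largest one among them. -/

section Tight

variable {α V : Type*} [Finite V] {M : Matroid α} [M.Finite] {ends : α → Set V}
  {A : Set α} {J W W' : Set V}

/-- The count is supermodular: an edge inside one of the two sets is inside their union, an edge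
inside both is inside their intersection, and the contribution of `J` is modular. -/
theorem insideCount_add_le (hA : A.Finite) :
    insideCount ends A J W + insideCount ends A J W' ≤
      insideCount ends A J (W ∪ W') + insideCount ends A J (W ∩ W') := by
  have fin : ∀ P : α → Prop, {x | x ∈ A ∧ P x}.Finite := fun P ↦ hA.subset fun x hx ↦ hx.1
  have h1 := Set.ncard_union_add_ncard_inter {x | x ∈ A ∧ ends x ⊆ W} {x | x ∈ A ∧ ends x ⊆ W'}
    (fin _) (fin _)
  have h2 := Set.ncard_union_add_ncard_inter (J ∩ W) (J ∩ W')
  have h3 : ({x | x ∈ A ∧ ends x ⊆ W} ∪ {x | x ∈ A ∧ ends x ⊆ W'}).ncard ≤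
      {x | x ∈ A ∧ ends x ⊆ W ∪ W'}.ncard := by
    refine Set.ncard_le_ncard ?_ (fin _)
    rintro x (⟨hx, h⟩ | ⟨hx, h⟩)
    · exact ⟨hx, h.trans Set.subset_union_left⟩
    · exact ⟨hx, h.trans Set.subset_union_right⟩
  have h4 : ({x | x ∈ A ∧ ends x ⊆ W} ∩ {x | x ∈ A ∧ ends x ⊆ W'}).ncard ≤
      {x | x ∈ A ∧ ends x ⊆ W ∩ W'}.ncard := by
    refine Set.ncard_le_ncard ?_ (fin _)
    rintro x ⟨⟨hx, h⟩, hx', h'⟩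
    exact ⟨hx, Set.subset_inter h h'⟩
  have h5 : (J ∩ W) ∪ (J ∩ W') = J ∩ (W ∪ W') := by rw [Set.inter_union_distrib_left]
  have h6 : (J ∩ W) ∩ (J ∩ W') = J ∩ (W ∩ W') := (Set.inter_inter_distrib_left ..).symm
  rw [h5, h6] at h2
  unfold insideCount
  omega

/-- If no vertex set is overfull, then there is a largest tight set. -/
theorem exists_largest_tight (hA : A.Finite) (hJ : ∀ W, insideCount ends A J W ≤ W.ncard) :
    ∃ W, Tight ends A J W ∧ ∀ W', Tight ends A J W' → W' ⊆ W := by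
  have hne : {W | Tight ends A J W}.Nonempty := ⟨∅, by simp [Tight]⟩
  obtain ⟨W, hW, hmax⟩ := Set.exists_max_image {W | Tight ends A J W} Set.ncard (Set.toFinite _) hne
  refine ⟨W, hW, fun W' hW' ↦ ?_⟩
  have h1 := insideCount_add_le (ends := ends) (J := J) (W := W) (W' := W') hA
  have h2 := hJ (W ∩ W')
  have h3 := Set.ncard_union_add_ncard_inter W W'
  have hW1 : W.ncard ≤ insideCount ends A J W := hW
  have hW2 : W'.ncard ≤ insideCount ends A J W' := hW'
  -- Since `W ∩ W'` is not overfull, supermodularity leaves no slack in the union. A tight set of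
  -- maximum size therefore absorbs every other one.
  have h4 : Tight ends A J (W ∪ W') := by
    unfold Tight
    omega
  have h5 := hmax _ h4
  exact Set.union_eq_left.1 (Set.eq_of_subset_of_ncard_le Set.subset_union_left h5).symm

/-- The elements of `X` were not counted inside `W`, so they pay for the vertices of `U`. -/
theorem Tight.union {X : Set α} {U : Set V} (hW : Tight ends A J W) (hA : A.Finite) (hX : X ⊆ A)
    (hXW : ∀ x ∈ X, ¬ ends x ⊆ W) (hXU : ∀ x ∈ X, ends x ⊆ W ∪ U) (hcard : U.ncard ≤ X.ncard) :
    Tight ends A J (W ∪ U) := by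
  have h1 : ({x | x ∈ A ∧ ends x ⊆ W} ∪ X).ncard ≤ {x | x ∈ A ∧ ends x ⊆ W ∪ U}.ncard := by
    refine Set.ncard_le_ncard ?_ (hA.subset fun x hx ↦ hx.1)
    rintro x (⟨hx, h⟩ | hx)
    · exact ⟨hx, h.trans Set.subset_union_left⟩
    · exact ⟨hX hx, hXU x hx⟩
  rw [Set.ncard_union_eq (Set.disjoint_left.2 fun x hx hx' ↦ hXW x hx' hx.2)
    (hA.subset fun x hx ↦ hx.1) (hA.subset hX)] at h1
  have h2 : (J ∩ W).ncard ≤ (J ∩ (W ∪ U)).ncard :=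
    Set.ncard_le_ncard (Set.inter_subset_inter_right _ Set.subset_union_left)
  have h3 := Set.ncard_union_le W U
  unfold Tight insideCount at *
  omega

/-- A circuit with an element with exactly one end outside a tight set gives a larger tight set. -/
theorem IsFramework.tight_union (hF : M.IsFramework ends) (hW : Tight ends A J W) (hA : A ⊆ M.E)
    {C : Set α} {t x : α} (hC : M.IsCircuit C) (hCn : C.Nontrivial)
    (hCA : C ⊆ insert t A) (hx : x ∈ C) (hxW : ¬ ends x ⊆ W) (hx1 : (ends x \ W).ncard ≤ 1) :
    Tight ends A J (W ∪ ((⋃ c ∈ C, ends c) \ W)) := by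
  set U := (⋃ c ∈ C, ends c) \ W with hU
  have hAf := M.set_finite A hA
  have hCf := M.set_finite C hC.subset_ground
  set X := {c | c ∈ C ∧ ¬ ends c ⊆ W} with hX
  have hXf : X.Finite := hCf.subset fun c hc ↦ hc.1
  -- An element of the circuit with an end outside `W` belongs to `X`, so each vertex of `U` is on
  -- two elements of `X`. The element `x` has at most one end in `U`, which makes the inequality
  -- strict.
  have key : U.ncard < X.ncard := by
    refine ncard_lt_of_two_edges (ends := ends) (x₀ := x) hXf
      (fun c hc ↦ hF.ncard_ends_le c (hC.subset_ground hc.1)) ?_ ⟨hx, hxW⟩ ?_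
    · rintro u ⟨hu, huW⟩
      simp only [Set.mem_iUnion, exists_prop] at hu
      obtain ⟨c, hc, huc⟩ := hu
      obtain ⟨d, hd, hdc, hud⟩ := hF.exists_ne hC hCn c hc u huc
      exact ⟨c, ⟨hc, fun h ↦ huW (h huc)⟩, d, ⟨hd, fun h ↦ huW (h hud)⟩, hdc.symm, huc, hud⟩
    · exact (Set.ncard_le_ncard (t := ends x \ W) fun v hv ↦ ⟨hv.1, hv.2.2⟩).trans hx1
  refine hW.union (X := X \ {t}) hAf ?_ (fun c hc ↦ hc.1.2) ?_ ?_
  · rintro c ⟨hc, hct⟩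
    exact (hCA hc.1).resolve_left hct
  · rintro c ⟨hc, -⟩ v hv
    by_cases hvW : v ∈ W
    · exact .inl hvW
    · exact .inr ⟨Set.mem_biUnion hc.1 hv, hvW⟩
  -- Only `t` may be missing from `A`; the strict inequality allows for the loss of one element.
  · have := Set.ncard_le_ncard_sdiff_add_ncard X {t}
    simp only [Set.ncard_singleton] at this
    omega

/-- The largest tight set contains the ends of each element that is spanned by `A` and has at most
one end outside. -/
theorem IsFramework.ends_subset (hF : M.IsFramework ends) (hA : M.Indep A)
    (hW : Tight ends A J W) (hmax : ∀ W', Tight ends A J W' → W' ⊆ W)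
    {t : α} (ht : t ∈ M.closure A) (hti : M.Indep {t}) (ht1 : (ends t \ W).ncard ≤ 1) :
    ends t ⊆ W := by
  by_contra h
  have hAf := M.set_finite A hA.subset_ground
  by_cases htA : t ∈ A
  · have := hW.union (X := {t}) (U := ends t \ W) hAf (by simpa using htA) (by simpa using h)
      (by simp) (by simpa using ht1)
    have h2 := hmax _ this
    exact h fun v hv ↦ h2 (by simp [hv])
  · have hC := hA.fundCircuit_isCircuit ht htA
    have htC := M.mem_fundCircuit t A
    have := hF.tight_union hW hA.subset_ground hC (hC.nontrivial_of_indep htC hti)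
      (M.fundCircuit_subset_insert t A) htC h ht1
    have h2 := hmax _ this
    refine h fun v hv ↦ h2 ?_
    by_cases hvW : v ∈ W
    · exact .inl hvW
    · exact .inr ⟨Set.mem_biUnion htC hv, hvW⟩

/-- An element that is spanned by `A` and has an end outside the largest tight set is spanned by the
elements of `A` with no end in that set. -/
theorem IsFramework.mem_closure_of_not_subset (hF : M.IsFramework ends) (hA : M.Indep A)
    (hW : Tight ends A J W) (hmax : ∀ W', Tight ends A J W' → W' ⊆ W)
    {t : α} (ht : t ∈ M.closure A) (hti : M.Indep {t}) (htW : ¬ ends t ⊆ W) :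
    t ∈ M.closure {x | x ∈ A ∧ Disjoint (ends x) W ∧ ¬ ends x ⊆ W} := by
  have hAf := M.set_finite A hA.subset_ground
  have one : ∀ x ∈ M.E, ¬ Disjoint (ends x) W → (ends x \ W).ncard ≤ 1 := by
    intro x hx hd
    have h1 := Set.ncard_inter_add_ncard_sdiff_eq_ncard (ends x) W
    have h2 := hF.ncard_ends_le x hx
    have h3 : 0 < (ends x ∩ W).ncard := by
      rw [Set.ncard_pos]
      exact Set.not_disjoint_iff_nonempty_inter.1 hd
    omega
  -- An element with one end in `W` has at most one end outside, so maximality of `W` puts it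
  -- inside. Hence nothing spanned by `A`, apart from loops of `M`, crosses the boundary of `W`.
  have hdj : ∀ x, x ∈ M.closure A → M.Indep {x} → ends x ⊆ W ∨ Disjoint (ends x) W := by
    intro x hx hxi
    by_contra! h
    exact h.1 (hF.ends_subset hA hW hmax hx hxi
      (one x (hxi.subset_ground rfl) h.2))
  by_cases htA : t ∈ A
  · exact M.mem_closure_of_mem' ⟨htA, (hdj t ht hti).resolve_left htW, htW⟩
  · have hC := hA.fundCircuit_isCircuit ht htA
    have htC := M.mem_fundCircuit t A
    have hCn := hC.nontrivial_of_indep htC hti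
    have hCA := M.fundCircuit_subset_insert t A
    set C := M.fundCircuit t A
    have hind : ∀ x ∈ C, M.Indep {x} := fun x hx ↦ by
      by_cases hxt : x = t
      · exact hxt ▸ hti
      · exact hA.subset (Set.singleton_subset_iff.2 ((hCA hx).resolve_left hxt))
    have hcl : ∀ x ∈ C, x ∈ M.closure A := fun x hx ↦ by
      rcases hCA hx with rfl | h
      · exact ht
      · exact M.mem_closure_of_mem h
    -- The fundamental circuit is not separated by `W`, and `t` is not inside `W`, so none of its
    -- elements is.
    have hnot : ∀ x ∈ C, ¬ ends x ⊆ W := by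
      intro x hx h
      exact htW (hF.connected hC (fun y hy ↦ hdj y (hcl y hy) (hind y hy)) ⟨x, hx, h⟩ t htC)
    refine M.closure_subset_closure ?_ (hC.mem_closure_sdiff_singleton_of_mem htC)
    rintro x ⟨hx, hxt⟩
    exact ⟨(hCA hx).resolve_left hxt, (hdj x (hcl x hx) (hind x hx)).resolve_left (hnot x hx),
      hnot x hx⟩

end Tight

end Matroid

namespace Matroid

/-! ### Frame matroids and frameworks -/

theorem Indep.ncard_le_of_subset_closure {α : Type*} {M : Matroid α} [M.Finite] {I X : Set α}
    (hI : M.Indep I) (hX : X ⊆ M.E) (h : I ⊆ M.closure X) : I.ncard ≤ X.ncard := by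
  have h1 : I.encard ≤ X.encard := by
    rw [← hI.eRk_eq_encard]
    exact (M.eRk_mono h).trans (by rw [M.eRk_closure_eq]; exact M.eRk_le_encard X)
  rw [← (M.set_finite I hI.subset_ground).cast_ncard_eq,
    ← (M.set_finite X hX).cast_ncard_eq] at h1
  exact_mod_cast h1

theorem ncard_setOf_and_add_ncard_setOf_and_not {α : Type*} {A : Set α} (hA : A.Finite)
    (p : α → Prop) : {x | x ∈ A ∧ p x}.ncard + {x | x ∈ A ∧ ¬ p x}.ncard = A.ncard := by
  rw [← Set.ncard_union_eq (Set.disjoint_left.2 fun x hx hx' ↦ hx'.2 hx.2)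
    (hA.subset fun x hx ↦ hx.1) (hA.subset fun x hx ↦ hx.1)]
  congr 1
  ext x
  simp only [Set.mem_union, Set.mem_ofPred_eq]
  tauto

theorem insideCount_insert_left {α V : Type*} {ends : α → Set V} {A : Set α} {J W : Set V} (hA : A.Finite) (x : α) :
    insideCount ends (insert x A) J W ≤ insideCount ends A J W + 1 ∧
    (¬ ends x ⊆ W → insideCount ends (insert x A) J W = insideCount ends A J W) := by
  constructor
  · have : {y | y ∈ insert x A ∧ ends y ⊆ W}.ncard ≤
        (insert x {y | y ∈ A ∧ ends y ⊆ W}).ncard := by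
      refine Set.ncard_le_ncard ?_ ((hA.subset fun x hx ↦ hx.1).insert x)
      rintro y ⟨rfl | hy, h⟩
      · exact .inl rfl
      · exact .inr ⟨hy, h⟩
    have h2 := Set.ncard_insert_le x {y | y ∈ A ∧ ends y ⊆ W}
    unfold insideCount
    omega
  · intro hx
    have : {y | y ∈ insert x A ∧ ends y ⊆ W} = {y | y ∈ A ∧ ends y ⊆ W} := by
      ext y
      constructor
      · rintro ⟨rfl | hy, h⟩
        · exact (hx h).elim
        · exact ⟨hy, h⟩
      · exact fun h ↦ ⟨.inr h.1, h.2⟩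
    unfold insideCount
    rw [this]

/-! ### The extension of a framework by joints, and its matroid axioms. -/

section Joints

variable {α V : Type*} [Finite V] {M : Matroid α} [M.Finite] {ends : α → Set V}

theorem insideCount_insert_right {A : Set α} {J W : Set V} (j : V) :
    insideCount ends A (insert j J) W ≤ insideCount ends A J W + 1 ∧
    (j ∉ W → insideCount ends A (insert j J) W = insideCount ends A J W) := by
  constructor
  · have : (insert j J ∩ W).ncard ≤ (insert j (J ∩ W)).ncard := by
      refine Set.ncard_le_ncard ?_
      rintro y ⟨rfl | hy, h⟩
      · exact .inl rfl
      · exact .inr ⟨hy, h⟩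
    have h2 := Set.ncard_insert_le j (J ∩ W)
    unfold insideCount
    omega
  · intro hj
    unfold insideCount
    rw [Set.insert_inter_of_notMem hj]

/-- This is the augmentation axiom for the matroid with joints. Suppose that nothing can be added,
and let `W` be the largest tight set of `A` and `J`. A joint that cannot be added lies in a tight
set, so `J' ⊆ W`. An element of `A'` that is not inside `W` is not blocked by the count, so it is
spanned by `A`, and then by the elements of `A` that avoid `W`; by rank, `A'` has at most as many
elements not inside `W` as `A`. Inside `W`, the sets `A'` and `J'` count at most `W.ncard`, which
`A` and `J` attain. The two bounds add up to the reverse of `hlt`. -/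
theorem IsFramework.augment (hF : M.IsFramework ends) {A A' : Set α} {J J' : Set V}
    (hA : M.Indep A) (hc : ∀ W, insideCount ends A J W ≤ W.ncard)
    (hA' : M.Indep A') (hc' : ∀ W, insideCount ends A' J' W ≤ W.ncard)
    (hlt : A.ncard + J.ncard < A'.ncard + J'.ncard) :
    (∃ x ∈ A', x ∉ A ∧ M.Indep (insert x A) ∧
      ∀ W, insideCount ends (insert x A) J W ≤ W.ncard) ∨
    (∃ j ∈ J', j ∉ J ∧ ∀ W, insideCount ends A (insert j J) W ≤ W.ncard) := by
  by_contra! hcon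
  obtain ⟨hcon₁, hcon₂⟩ := hcon
  have hAf := M.set_finite A hA.subset_ground
  have hAf' := M.set_finite A' hA'.subset_ground
  obtain ⟨W, hW, hmax⟩ := exists_largest_tight (ends := ends) (J := J) hAf hc
  have hJW : J' ⊆ W := by
    intro j hj
    by_contra hjW
    -- A vertex that already carries a joint of `J` is a tight set by itself.
    have hjJ : j ∉ J := by
      intro h
      refine hjW (hmax {j} ?_ rfl)
      unfold Tight insideCount
      rw [Set.inter_singleton_of_mem h]
      omega
    obtain ⟨W₁, hW₁⟩ := hcon₂ j hj hjJ
    have h1 := insideCount_insert_right (ends := ends) (A := A) (J := J) (W := W₁) j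
    have h2 := hc W₁
    have h3 : j ∈ W₁ := by
      by_contra h
      rw [h1.2 h] at hW₁
      omega
    exact hjW (hmax W₁ (by unfold Tight; omega) h3)
  have hcl : ∀ x ∈ A', ¬ ends x ⊆ W → x ∈ M.closure A := by
    intro x hx hxW
    by_cases hxA : x ∈ A
    · exact M.mem_closure_of_mem hxA
    by_contra hxcl
    obtain ⟨W₁, hW₁⟩ := hcon₁ x hx hxA
      ((hA.insert_indep_iff_of_notMem hxA).2 ⟨hA'.subset_ground hx, hxcl⟩)
    have h1 := insideCount_insert_left (ends := ends) (J := J) (W := W₁) hAf x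
    have h2 := hc W₁
    have h3 : ends x ⊆ W₁ := by
      by_contra h
      rw [h1.2 h] at hW₁
      omega
    exact hxW (h3.trans (hmax W₁ (by unfold Tight; omega)))
  have hout : {x | x ∈ A' ∧ ¬ ends x ⊆ W}.ncard ≤ {x | x ∈ A ∧ ¬ ends x ⊆ W}.ncard := by
    refine (Indep.ncard_le_of_subset_closure (M := M)
      (X := {x | x ∈ A ∧ Disjoint (ends x) W ∧ ¬ ends x ⊆ W}) (hA'.subset fun x hx ↦ hx.1)
      (fun x hx ↦ hA.subset_ground hx.1) ?_).trans
      (Set.ncard_le_ncard (fun x hx ↦ ⟨hx.1, hx.2.2⟩) (hAf.subset fun x hx ↦ hx.1))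
    rintro x ⟨hx, hxW⟩
    exact hF.mem_closure_of_not_subset hA hW hmax (hcl x hx hxW)
      (hA'.subset (Set.singleton_subset_iff.2 hx)) hxW
  have h1 := ncard_setOf_and_add_ncard_setOf_and_not hAf (fun x ↦ ends x ⊆ W)
  have h2 := ncard_setOf_and_add_ncard_setOf_and_not hAf' (fun x ↦ ends x ⊆ W)
  have h3 := hc' W
  have h4 : (J ∩ W).ncard ≤ J.ncard := Set.ncard_le_ncard Set.inter_subset_left
  unfold Tight at hW
  unfold insideCount at hW h3
  rw [Set.inter_eq_left.2 hJW] at h3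
  omega

theorem insideCount_mono {A A' : Set α} {J J' W : Set V} (hA : A'.Finite) (h : A ⊆ A')
    (h' : J ⊆ J') : insideCount ends A J W ≤ insideCount ends A' J' W := by
  unfold insideCount
  gcongr
  · exact hA.subset fun x hx ↦ hx.1
  · exact Set.toFinite _

theorem ncard_eq_ncard_preimage_add {I : Set (α ⊕ V)} (hI : (Sum.inl ⁻¹' I).Finite) :
    I.ncard = (Sum.inl ⁻¹' I : Set α).ncard + (Sum.inr ⁻¹' I : Set V).ncard := by
  rw [← Set.ncard_image_of_injective (Sum.inl ⁻¹' I) (Sum.inl_injective (β := V)),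
    ← Set.ncard_image_of_injective (Sum.inr ⁻¹' I) (Sum.inr_injective (α := α)),
    ← Set.ncard_union_eq _ (hI.image _) (Set.toFinite _),
    Set.image_preimage_inl_union_image_preimage_inr]
  exact Set.disjoint_left.2 (by rintro _ ⟨x, -, rfl⟩ ⟨y, -, h⟩; cases h)

/-- A framework extends by a joint at each vertex. -/
theorem IsFramework.exists_joints (hF : M.IsFramework ends) :
    ∃ N : Matroid (α ⊕ V), N.Finite ∧ N.E = {z | ∀ x, z = .inl x → x ∈ M.E} ∧
      ∀ I, N.Indep I ↔ M.Indep (Sum.inl ⁻¹' I) ∧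
        ∀ W, insideCount ends (Sum.inl ⁻¹' I) (Sum.inr ⁻¹' I) W ≤ W.ncard := by
  have hfin : {z : α ⊕ V | ∀ x, z = .inl x → x ∈ M.E}.Finite := by
    refine ((M.ground_finite.image Sum.inl).union
      ((Set.finite_univ (α := V)).image Sum.inr)).subset ?_
    rintro (x | v) h
    · exact .inl ⟨x, h x rfl, rfl⟩
    · exact .inr ⟨v, trivial, rfl⟩
  let T : IndepMatroid (α ⊕ V) := IndepMatroid.ofFinite hfin
    (fun I ↦ M.Indep (Sum.inl ⁻¹' I) ∧
        ∀ W, insideCount ends (Sum.inl ⁻¹' I) (Sum.inr ⁻¹' I) W ≤ W.ncard)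
    (by simp [insideCount])
    (fun I J hJ hIJ ↦ ⟨hJ.1.subset (Set.preimage_mono hIJ), fun W ↦
      (insideCount_mono (M.set_finite _ hJ.1.subset_ground) (Set.preimage_mono hIJ)
        (Set.preimage_mono hIJ)).trans (hJ.2 W)⟩)
    (by
      intro I J hI hJ hlt
      rw [ncard_eq_ncard_preimage_add (M.set_finite _ hI.1.subset_ground),
        ncard_eq_ncard_preimage_add (M.set_finite _ hJ.1.subset_ground)] at hlt
      have e1 : ∀ (x : α), (Sum.inl ⁻¹' (insert (Sum.inl x) I) : Set α)
          = insert x (Sum.inl ⁻¹' I) := fun x ↦ by ext; simp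
      have e2 : ∀ (x : α), (Sum.inr ⁻¹' (insert (Sum.inl x) I) : Set V)
          = Sum.inr ⁻¹' I := fun x ↦ by ext; simp
      have e3 : ∀ (x : V), (Sum.inr ⁻¹' (insert (Sum.inr x) I) : Set V)
          = insert x (Sum.inr ⁻¹' I) := fun x ↦ by ext; simp
      have e4 : ∀ (x : V), (Sum.inl ⁻¹' (insert (Sum.inr x) I) : Set α)
          = Sum.inl ⁻¹' I := fun x ↦ by ext; simp
      rcases hF.augment hI.1 hI.2 hJ.1 hJ.2 hlt with ⟨x, h1, h2, h3, h4⟩ | ⟨j, h1, h2, h3⟩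
      · exact ⟨.inl x, h1, h2, by rw [e1, e2]; exact ⟨h3, h4⟩⟩
      · exact ⟨.inr j, h1, h2, by rw [e3, e4]; exact ⟨hI.1, h3⟩⟩)
    (by
      rintro I hI _ hz x rfl
      exact hI.1.subset_ground hz)
  exact ⟨T.matroid, ⟨hfin⟩, rfl, fun I ↦ Iff.rfl⟩

end Joints

/-- The joints form the required basis. An element together with the joints at all its ends
overfills its set of ends, so these at most two joints span it; a loop without ends is spanned by
the empty set. On sets without joints the count is the bound `ncard_le` of the framework, so the
restriction is `M`. -/
theorem HasFramework.isFrame {α : Type*} {M : Matroid α} [M.Finite] {K : Set α}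
    (h : M.HasFramework K) : M.IsFrame := by
  obtain ⟨V, hV, ends, hF, -⟩ := h
  obtain ⟨N, hN, hE, hI⟩ := hF.exists_joints
  have hpre : ∀ X : Set V, (Sum.inl ⁻¹' (Sum.inr '' X : Set (α ⊕ V)) : Set α) = ∅ := fun X ↦ by
    ext; simp
  have hpre' : ∀ X : Set V, (Sum.inr ⁻¹' (Sum.inr '' X : Set (α ⊕ V)) : Set V) = X := fun X ↦
    Set.preimage_image_eq _ Sum.inr_injective
  have hjoint : ∀ X : Set V, N.Indep (Sum.inr '' X) := by
    intro X
    rw [hI, hpre, hpre']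
    refine ⟨M.empty_indep, fun W ↦ ?_⟩
    simp only [insideCount, Set.mem_empty_iff_false, false_and, Set.ofPred_false, Set.ncard_empty,
      zero_add]
    exact Set.ncard_le_ncard Set.inter_subset_right
  have hspan : ∀ e ∈ N.E, ∃ S ⊆ (Sum.inr '' Set.univ : Set (α ⊕ V)), S.encard ≤ 2 ∧
      e ∈ N.closure S := by
    rintro (x | v) he
    · have hx : x ∈ M.E := by
        rw [hE] at he
        exact he x rfl
      refine ⟨Sum.inr '' ends x, Set.image_mono (Set.subset_univ _), ?_, ?_⟩
      · rw [Sum.inr_injective.encard_image, ← (Set.toFinite (ends x)).cast_ncard_eq]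
        exact_mod_cast hF.ncard_ends_le x hx
      · rw [(hjoint _).mem_closure_iff_of_notMem (by simp)]
        refine ⟨fun hi ↦ ?_, Set.insert_subset he (hjoint _).subset_ground⟩
        have h1 := ((hI _).1 hi).2 (ends x)
        have e1 : (Sum.inl ⁻¹' (insert (Sum.inl x) (Sum.inr '' ends x : Set (α ⊕ V))) : Set α)
            = {x} := by ext; simp
        have e2 : (Sum.inr ⁻¹' (insert (Sum.inl x) (Sum.inr '' ends x : Set (α ⊕ V))) : Set V)
            = ends x := by ext; simp
        have e3 : {y | y ∈ ({x} : Set α) ∧ ends y ⊆ ends x} = {x} := by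
          ext y
          constructor
          · exact fun h ↦ h.1
          · rintro rfl
            exact ⟨rfl, subset_rfl⟩
        rw [e1, e2, insideCount, e3] at h1
        simp at h1
    · exact ⟨{.inr v}, by simp, by simp, N.mem_closure_of_mem' rfl⟩
  refine ⟨V, N, Sum.inr '' Set.univ, hN, ?_, ?_, hspan⟩
  · rw [isRestriction_iff_exists]
    refine ⟨Sum.inl '' M.E, ?_, ?_⟩
    · rintro _ ⟨x, hx, rfl⟩
      rw [hE]
      rintro y hy
      cases hy
      exact hx
    · refine ext_indep rfl ?_
      intro I hIE
      obtain ⟨J, hJ, rfl⟩ := Set.subset_image_iff.1 hIE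
      have e1 : (Sum.inl ⁻¹' (Sum.inl '' J : Set (α ⊕ V)) : Set α) = J :=
        Set.preimage_image_eq _ Sum.inl_injective
      have e2 : (Sum.inr ⁻¹' (Sum.inl '' J : Set (α ⊕ V)) : Set V) = ∅ := by ext; simp
      rw [map_image_indep_iff hJ, restrict_indep_iff, hI, e1, e2]
      refine ⟨fun h ↦ ⟨⟨h, fun W ↦ ?_⟩, Set.image_mono hJ⟩, fun h ↦ h.1.1⟩
      simp only [insideCount, Set.empty_inter, Set.ncard_empty, add_zero]
      exact hF.ncard_le (h.subset fun x hx ↦ hx.1) fun x hx ↦ hx.2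
  · rw [isBase_iff_indep_closure_eq]
    refine ⟨hjoint _, subset_antisymm (N.closure_subset_ground _) fun e he ↦ ?_⟩
    obtain ⟨S, hS, -, h⟩ := hspan e he
    exact N.closure_subset_closure hS h

end Matroid

/-! ### The framework of a frame matroid. -/

namespace Matroid

/-- A basis of the extension lives in the universe of `α`, while `HasFramework` asks for vertices in
`Type`. Relabelling by `Fin n` bridges the gap. -/
theorem IsFramework.equiv {α V V' : Type*} {M : Matroid α} {ends : α → Set V}
    (hF : M.IsFramework ends) (φ : V ≃ V') : M.IsFramework fun x ↦ φ.symm ⁻¹' ends x := by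
  have e1 : ∀ (S : Set V) (T : Set V'), φ.symm ⁻¹' S ⊆ T ↔ S ⊆ φ ⁻¹' T := by
    intro S T
    rw [← Equiv.image_eq_preimage_symm, Set.image_subset_iff]
  have e2 : ∀ (S : Set V) (T : Set V'), Disjoint (φ.symm ⁻¹' S) T ↔ Disjoint S (φ ⁻¹' T) := by
    intro S T
    rw [← Equiv.image_eq_preimage_symm, Set.disjoint_image_left]
  have e3 : ∀ W : Set V, (φ.symm ⁻¹' W).ncard = W.ncard := fun W ↦ by
    rw [← Equiv.image_eq_preimage_symm, Set.ncard_image_of_injective _ φ.injective]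
  have e4 : ∀ W : Set V', (φ ⁻¹' W).ncard = W.ncard := fun W ↦ by
    rw [← Equiv.image_symm_eq_preimage, Set.ncard_image_of_injective _ φ.symm.injective]
  refine ⟨fun x hx ↦ ?_, fun A W hA h ↦ ?_, fun C hC hn x hx v hv ↦ ?_, fun C W hC h h' ↦ ?_⟩
  · rw [e3]
    exact hF.ncard_ends_le x hx
  · rw [← e4]
    exact hF.ncard_le hA fun x hx ↦ (e1 _ _).1 (h x hx)
  · exact hF.exists_ne hC hn x hx _ hv
  · simp only [e1, e2] at *
    exact hF.connected hC h h'

/-- If `K` is spanned by `J` and `J` is skew to `I`, then `K` is skew to `I`. -/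
theorem Indep.union_of_subset_closure {α : Type*} {N : Matroid α} [N.Finite] {I J K : Set α}
    (hIJ : N.Indep (I ∪ J)) (hd : Disjoint I J) (hK : N.Indep K) (hKJ : K ⊆ N.closure J) :
    N.Indep (I ∪ K) := by
  obtain ⟨K', hK', hKK'⟩ := hK.subset_isBasis_of_subset hKJ (N.closure_subset_ground J)
  have hJ : N.Indep J := hIJ.subset Set.subset_union_right
  have hcard : K'.encard = J.encard := hK'.encard_eq_encard hJ.isBasis_closure
  have hcl : N.closure (I ∪ K') = N.closure (I ∪ J) := by
    rw [← closure_union_closure_right_eq, hK'.closure_eq_closure, closure_closure,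
      closure_union_closure_right_eq]
  -- `I ∪ K'` has the same closure as `I ∪ J`, hence rank `I.encard + J.encard`, and `K'` is as
  -- large as `J`. So its rank is at least its size.
  have hi : N.Indep (I ∪ K') := by
    refine ((isRkFinite_set N _).indep_of_encard_le_eRk ?_)
    rw [← eRk_closure_eq, hcl, eRk_closure_eq, hIJ.eRk_eq_encard, Set.encard_union_eq hd, ← hcard]
    exact Set.encard_union_le _ _
  exact hi.subset (Set.union_subset_union_right _ hKK')

/-- For subsets of a basis, the closure of an intersection is the intersection of the closures. So
if `B \ {v}` spanned `e`, then so would `S \ {v}`, and a smallest `S` excludes this. Having all of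
`B \ {v}` in the conclusion, rather than `S \ {v}`, is what rules out leaves in circuits. -/
theorem exists_minimal_spanning {α : Type*} {N : Matroid α} [N.Finite] {B : Set α}
    (hB : N.IsBase B) {e : α} (he : ∃ S ⊆ B, S.encard ≤ 2 ∧ e ∈ N.closure S) :
    ∃ S ⊆ B, S.ncard ≤ 2 ∧ e ∈ N.closure S ∧ ∀ v ∈ S, e ∉ N.closure (B \ {v}) := by
  obtain ⟨S₀, hS₀, hc, he₀⟩ := he
  have hBf := N.set_finite B hB.subset_ground
  have hfin : {S | S ⊆ B ∧ e ∈ N.closure S}.Finite :=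
    hBf.finite_subsets.subset fun S hS ↦ hS.1
  obtain ⟨S, ⟨hSB, hS⟩, hmin⟩ := Set.exists_min_image _ Set.ncard hfin ⟨S₀, hS₀, he₀⟩
  have hc' : S₀.ncard ≤ 2 := by
    rw [← (hBf.subset hS₀).cast_ncard_eq] at hc
    exact_mod_cast hc
  refine ⟨S, hSB, (hmin _ ⟨hS₀, he₀⟩).trans hc', hS, fun v hv hcon ↦ ?_⟩
  have hmem : e ∈ N.closure (S \ {v}) := by
    have h1 : S \ {v} = S ∩ (B \ {v}) := by
      ext x
      simp only [Set.mem_sdiff, Set.mem_singleton_iff, Set.mem_inter_iff]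
      exact ⟨fun h ↦ ⟨h.1, hSB h.1, h.2⟩, fun h ↦ ⟨h.1, h.2.2⟩⟩
    rw [h1, Indep.closure_inter_eq_inter_closure
      (hB.indep.subset (Set.union_subset hSB Set.sdiff_subset))]
    exact ⟨hS, hcon⟩
  have := hmin _ ⟨Set.sdiff_subset.trans hSB, hmem⟩
  have h2 := Set.ncard_sdiff_singleton_lt_of_mem hv (hBf.subset hSB)
  omega

/-- The vertices are the basis elements, and the ends of `x` are those needed to span it. The bound
`ncard_le` is a comparison of ranks. If `v` were an end of only one element `x` of a circuit, the
other elements would lie in the closure of `B \ {v}`, and so would `x`. If a circuit were separated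
by `W`, its two parts would be independent and lie in the skew flats spanned by `W` and by `B \ W`,
so their union would be independent. -/
theorem IsFrame.hasFramework {α : Type*} {M : Matroid α} (h : M.IsFrame) :
    M.HasFramework ∅ := by
  obtain ⟨V, N, B, hN, hMN, hB, hspan⟩ := h
  have hsub : Sum.inl '' M.E ⊆ N.E := by
    have := hMN.subset
    rwa [map_ground] at this
  have hind : ∀ A ⊆ M.E, M.Indep A ↔ N.Indep (Sum.inl '' A) := by
    intro A hA
    obtain ⟨R, hR, hE⟩ := (isRestriction_iff_exists).1 hMN
    have hRE : R = Sum.inl '' M.E := by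
      have := congrArg Matroid.E hE
      simpa using this.symm
    rw [← map_image_indep_iff (f := Sum.inl) (hf := (Sum.inl_injective (β := V)).injOn) hA, hE,
      restrict_indep_iff, hRE]
    exact and_iff_left (Set.image_mono hA)
  choose! S hSB hSc hScl hSmin using fun x (hx : x ∈ M.E) ↦
    exists_minimal_spanning hB (hspan (Sum.inl x) (hsub ⟨x, hx, rfl⟩))
  have hBf : B.Finite := N.set_finite B hB.subset_ground
  have : Finite B := hBf
  have hsubcl : ∀ {A X}, A ⊆ M.E → (∀ x ∈ A, S x ⊆ X) → Sum.inl '' A ⊆ N.closure X := by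
    rintro A X hA h _ ⟨x, hx, rfl⟩
    exact N.closure_subset_closure (h x hx) (hScl x (hA hx))
  have hmemcl : ∀ {C x}, M.IsCircuit C → x ∈ C →
      (Sum.inl x : α ⊕ V) ∈ N.closure (Sum.inl '' (C \ {x})) := by
    intro C x hC hx
    have h1 : N.Indep (Sum.inl '' (C \ {x})) :=
      (hind _ (Set.sdiff_subset.trans hC.subset_ground)).1 (hC.sdiff_singleton_indep hx)
    rw [h1.mem_closure_iff, ← Set.image_insert_eq, Set.insert_sdiff_singleton,
      Set.insert_eq_of_mem hx]
    left
    rw [← not_indep_iff ((Set.image_mono hC.subset_ground).trans hsub),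
      ← hind _ hC.subset_ground]
    exact hC.not_indep
  have hF : M.IsFramework (V := B) fun x ↦ {v | (v : α ⊕ V) ∈ S x} := by
    have hcoe : ∀ x ∈ M.E, (Subtype.val '' {v : B | (v : α ⊕ V) ∈ S x}) = S x := by
      intro x hx
      ext v
      constructor
      · rintro ⟨w, hw, rfl⟩
        exact hw
      · exact fun hv ↦ ⟨⟨v, hSB x hx hv⟩, hv, rfl⟩
    refine ⟨fun x hx ↦ ?_, fun A W hA h ↦ ?_, fun C hC hn x hx v hv ↦ ?_,
      fun C W hC h h' ↦ ?_⟩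
    · rw [← Set.ncard_image_of_injective _ Subtype.val_injective, hcoe x hx]
      exact hSc x hx
    · have h1 : (Sum.inl '' A : Set (α ⊕ V)).ncard ≤ (Subtype.val '' W).ncard := by
        refine Indep.ncard_le_of_subset_closure ((hind A hA.subset_ground).1 hA) ?_
          (hsubcl hA.subset_ground fun x hx ↦ ?_)
        · rintro _ ⟨w, -, rfl⟩
          exact hB.subset_ground w.2
        · rw [← hcoe x (hA.subset_ground hx)]
          exact Set.image_mono (h x hx)
      rwa [Set.ncard_image_of_injective _ Sum.inl_injective,
        Set.ncard_image_of_injective _ Subtype.val_injective] at h1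
    · by_contra! hcon
      refine hSmin x (hC.subset_ground hx) v hv ?_
      refine N.closure_subset_closure_of_subset_closure (hsubcl ?_ ?_) (hmemcl hC hx)
      · exact Set.sdiff_subset.trans hC.subset_ground
      · rintro y ⟨hy, hyx⟩ w hw
        refine ⟨hSB y (hC.subset_ground hy) hw, ?_⟩
        rintro rfl
        exact hcon y hy hyx hw
    · by_contra! hcon
      obtain ⟨x, hx, hxW⟩ := h'
      obtain ⟨y, hy, hyW⟩ := hcon
      set P : α → Prop := fun x ↦ {v : B | (v : α ⊕ V) ∈ S x} ⊆ W
      set X := {z | z ∈ C ∧ P z}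
      set Y := {z | z ∈ C ∧ ¬ P z}
      have hXY : C = X ∪ Y := by
        ext z
        simp only [X, Y, Set.mem_union, Set.mem_ofPred_eq]
        tauto
      have hXi : M.Indep X := hC.ssubset_indep ⟨fun z hz ↦ hz.1, fun h ↦ hyW (h hy).2⟩
      have hYi : M.Indep Y := hC.ssubset_indep ⟨fun z hz ↦ hz.1, fun h ↦ (h hx).2 hxW⟩
      rw [hind _ hXi.subset_ground] at hXi
      rw [hind _ hYi.subset_ground] at hYi
      set BW : Set (α ⊕ V) := Subtype.val '' W
      have hBW : BW ⊆ B := by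
        rintro _ ⟨w, -, rfl⟩
        exact w.2
      have hXW : Sum.inl '' X ⊆ N.closure BW := by
        refine hsubcl (fun z hz ↦ hC.subset_ground hz.1) fun z hz ↦ ?_
        rw [← hcoe z (hC.subset_ground hz.1)]
        exact Set.image_mono hz.2
      have hYW : Sum.inl '' Y ⊆ N.closure (B \ BW) := by
        refine hsubcl (fun z hz ↦ hC.subset_ground hz.1) fun z hz v hv ↦ ?_
        refine ⟨hSB z (hC.subset_ground hz.1) hv, ?_⟩
        rintro ⟨w, hw, rfl⟩
        exact Set.disjoint_left.1 ((h z hz.1).resolve_left hz.2) hv hw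
      -- In the basis, exchange first the part in `W` for `X`, then the complementary part for `Y`.
      have s1 : N.Indep ((B \ BW) ∪ Sum.inl '' X) := by
        refine Indep.union_of_subset_closure (J := BW) ?_ Set.disjoint_sdiff_left hXi hXW
        rw [Set.sdiff_union_of_subset hBW]
        exact hB.indep
      have hdj : Disjoint (Sum.inl '' X) (B \ BW) := by
        rw [Set.disjoint_left]
        intro z hz hzB
        refine hB.indep.notMem_closure_sdiff_of_mem hzB.1 (N.closure_subset_closure ?_ (hXW hz))
        exact fun w hw ↦ ⟨hBW hw, fun h ↦ hzB.2 (h ▸ hw)⟩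
      have s2 : N.Indep (Sum.inl '' X ∪ Sum.inl '' Y) := by
        refine Indep.union_of_subset_closure (J := B \ BW) ?_ hdj hYi hYW
        rwa [Set.union_comm]
      rw [← Set.image_union, ← hXY, ← hind _ hC.subset_ground] at s2
      exact hC.not_indep s2
  obtain ⟨n, ⟨φ⟩⟩ := Finite.exists_equiv_fin B
  exact ⟨Fin n, inferInstance, _, hF.equiv φ, by simp⟩

end Matroid

namespace Matroid

/-! ### Replacing an element by a triangle -/

/-- `M'` is the 2-sum on `e` of `M` with a copy of `U_{2,4}` whose other elements are
`a`, `b`, `c`. -/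
structure IsTriangleSum {α : Type*} (M : Matroid α) (e a b c : α) (M' : Matroid α) : Prop where
  mem : e ∈ M.E
  indep_singleton : M.Indep {e}
  notMem_a : a ∉ M.E
  notMem_b : b ∉ M.E
  notMem_c : c ∉ M.E
  ab : a ≠ b
  ac : a ≠ c
  bc : b ≠ c
  ground_eq : M'.E = insert a (insert b (insert c (M.E \ {e})))
  isCircuit_iff : ∀ C, M'.IsCircuit C ↔ (M.IsCircuit C ∧ e ∉ C) ∨ C = {a, b, c} ∨
    ∃ C₁, M.IsCircuit C₁ ∧ e ∈ C₁ ∧ (C = insert a (insert b (C₁ \ {e})) ∨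
      C = insert a (insert c (C₁ \ {e})) ∨ C = insert b (insert c (C₁ \ {e})))

/-- The circuits of `U_{2,4}` are its triples: one of them avoids `f`, and the other three consist
of `f` and a pair from `a`, `b`, `c`. -/
theorem isTriangleSum_of_isTwoSum {α : Type*} {M U M' : Matroid α} {e f : α}
    (hU : U.IsU24) (h : M.IsTwoSum e U f M') :
    ∃ a b c, U.E = {f, a, b, c} ∧ M.IsTriangleSum e a b c M' := by
  have hfU := h.right_mem
  have hUf : U.E.Finite := Set.finite_of_encard_eq_coe (k := 4) hU.1
  have h3 : (U.E \ {f}).ncard = 3 := by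
    rw [Set.ncard_sdiff_singleton_of_mem hfU]
    have : U.E.ncard = 4 := by
      have := hU.1
      rw [← hUf.cast_ncard_eq] at this
      exact_mod_cast this
    omega
  obtain ⟨a, b, c, hab, hac, hbc, habc⟩ := Set.ncard_eq_three.1 h3
  have hUE : U.E = {f, a, b, c} := by
    rw [← habc, Set.insert_sdiff_singleton, Set.insert_eq_of_mem hfU]
  have ha : a ∈ U.E \ {f} := by simp [habc]
  have hb : b ∈ U.E \ {f} := by simp [habc]
  have hc : c ∈ U.E \ {f} := by simp [habc]
  have nM : ∀ x ∈ U.E, x ∉ M.E := fun x hx hx' ↦ h.disjoint.le_bot ⟨hx', hx⟩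
  have hcirc : ∀ C, U.IsCircuit C ↔ C ⊆ U.E ∧ C.ncard = 3 := by
    intro C
    rw [isCircuit_iff_forall_ssubset]
    constructor
    · rintro ⟨hd, hi⟩
      have hCf := hUf.subset hd.subset_ground
      refine ⟨hd.subset_ground, ?_⟩
      have h1 : ¬ C.encard ≤ 2 := fun h' ↦ hd.not_indep ((hU.2 C).2 ⟨hd.subset_ground, h'⟩)
      rw [← hCf.cast_ncard_eq] at h1
      have h1' : ¬ C.ncard ≤ 2 := fun h' ↦ h1 (by exact_mod_cast h')
      obtain ⟨x, hx⟩ : C.Nonempty := by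
        rw [← Set.ncard_pos hCf]
        omega
      have h2 := ((hU.2 _).1 (hi (Set.sdiff_singleton_ssubset.2 hx))).2
      rw [← (hCf.subset Set.sdiff_subset).cast_ncard_eq, Set.ncard_sdiff_singleton_of_mem hx] at h2
      have : C.ncard - 1 ≤ 2 := by exact_mod_cast h2
      omega
    · rintro ⟨hs, hc3⟩
      have hCf := hUf.subset hs
      constructor
      · rw [← not_indep_iff hs, hU.2]
        rintro ⟨-, h'⟩
        rw [← hCf.cast_ncard_eq, hc3] at h'
        exact absurd h' (by decide)
      · intro I hI
        refine (hU.2 I).2 ⟨hI.subset.trans hs, ?_⟩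
        have := Set.ncard_lt_ncard hI hCf
        rw [← (hCf.subset hI.subset).cast_ncard_eq]
        exact_mod_cast (by omega : I.ncard ≤ 2)
  have hfa : f ≠ a := fun h' ↦ ha.2 h'.symm
  have hfb : f ≠ b := fun h' ↦ hb.2 h'.symm
  have hfc : f ≠ c := fun h' ↦ hc.2 h'.symm
  have htri : ∀ {x y z : α}, x ∈ U.E → y ∈ U.E → z ∈ U.E → x ≠ y → x ≠ z → y ≠ z →
      U.IsCircuit {x, y, z} := by
    intro x y z hx hy hz h1 h2 h3
    refine (hcirc _).2 ⟨?_, Set.ncard_eq_three.2 ⟨x, y, z, h1, h2, h3, rfl⟩⟩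
    rintro w (rfl | rfl | rfl) <;> assumption
  have hef : e ≠ f := fun h' ↦ nM f hfU (h' ▸ h.left_mem)
  have hdiff : ∀ {C₁ : Set α} {x y : α}, C₁ ⊆ M.E → x ∈ U.E \ {f} → y ∈ U.E \ {f} →
      (C₁ ∪ {f, x, y}) \ {e, f} = insert x (insert y (C₁ \ {e})) := by
    intro C₁ x y hC hx hy
    have hfC : ∀ z ∈ C₁, z ≠ f := fun z hz h' ↦ nM f hfU (h' ▸ hC hz)
    have hxe : x ≠ e := fun h' ↦ nM x hx.1 (h' ▸ h.left_mem)
    have hye : y ≠ e := fun h' ↦ nM y hy.1 (h' ▸ h.left_mem)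
    have hxf : x ≠ f := hx.2
    have hyf : y ≠ f := hy.2
    ext z
    simp only [Set.mem_sdiff, Set.mem_union, Set.mem_insert_iff, Set.mem_singleton_iff, not_or]
    constructor
    · rintro ⟨h1 | h1 | h1 | h1, h2, h3⟩
      · exact .inr (.inr ⟨h1, h2⟩)
      · exact absurd h1 h3
      · exact .inl h1
      · exact .inr (.inl h1)
    · rintro (rfl | rfl | ⟨h1, h2⟩)
      · exact ⟨by simp, hxe, hxf⟩
      · exact ⟨by simp, hye, hyf⟩
      · exact ⟨.inl h1, h2, hfC z h1⟩
  refine ⟨a, b, c, hUE, h.left_mem, ?_, nM a ha.1, nM b hb.1, nM c hc.1, hab, hac, hbc, ?_, ?_⟩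
  -- If `e` were a loop, both `{a, b}` and `{a, b, c}` would be circuits.
  · by_contra hcon
    obtain ⟨D, hDe, hD⟩ := ((not_indep_iff (Set.singleton_subset_iff.2 h.left_mem)).1
      hcon).exists_isCircuit_subset
    have heD : D = {e} := (Set.subset_singleton_iff_eq.1 hDe).resolve_left hD.nonempty.ne_empty
    have h1 : M'.IsCircuit (insert a (insert b (D \ {e}))) := (h.isCircuit_iff _).2 (.inr (.inr
      ⟨D, {f, a, b}, hD, by simp [heD], htri hfU ha.1 hb.1 hfa hfb hab, by simp,
        (hdiff hD.subset_ground ha hb).symm⟩))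
    have h2 : M'.IsCircuit {a, b, c} := (h.isCircuit_iff _).2 (.inr (.inl
      ⟨htri ha.1 hb.1 hc.1 hab hac hbc, by simp [hfa, hfb, hfc]⟩))
    have h3 := h1.eq_of_subset_isCircuit h2 (by rw [heD]; intro x; simp; tauto)
    have h4 : c ∈ insert a (insert b (D \ {e})) := h3 ▸ (by simp)
    simp [heD, hac.symm, hbc.symm] at h4
  · have hMf : ∀ x ∈ M.E, x ≠ f := fun x hx h' ↦ nM f hfU (h' ▸ hx)
    have hxe : ∀ x ∈ U.E, x ≠ e := fun x hx h' ↦ nM x hx (h' ▸ h.left_mem)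
    have := hxe a ha.1
    have := hxe b hb.1
    have := hxe c hc.1
    rw [h.ground_eq, hUE]
    ext x
    simp only [Set.mem_sdiff, Set.mem_union, Set.mem_insert_iff, Set.mem_singleton_iff]
    grind
  · intro C
    rw [h.isCircuit_iff]
    constructor
    · rintro (h1 | ⟨h1, h2⟩ | ⟨C₁, C₂, h1, h2, h3, h4, rfl⟩)
      · exact .inl h1
      · refine .inr (.inl ?_)
        rw [← habc]
        obtain ⟨h5, h6⟩ := (hcirc C).1 h1
        refine Set.eq_of_subset_of_ncard_le (fun x hx ↦ ⟨h5 hx, fun h' ↦ h2 (h' ▸ hx)⟩) (by omega)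
          (hUf.subset Set.sdiff_subset)
      · obtain ⟨h5, h6⟩ := (hcirc C₂).1 h3
        refine .inr (.inr ⟨C₁, h1, h2, ?_⟩)
        have h7 : (C₂ \ {f}).ncard = 2 := by
          rw [Set.ncard_sdiff_singleton_of_mem h4]
          omega
        obtain ⟨x, y, hxy, hC₂⟩ := Set.ncard_eq_two.1 h7
        have hC₂' : C₂ = {f, x, y} := by
          rw [← hC₂, Set.insert_sdiff_singleton, Set.insert_eq_of_mem h4]
        have hx : x ∈ U.E \ {f} := Set.sdiff_subset_sdiff_left h5 (hC₂ ▸ (by simp))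
        have hy : y ∈ U.E \ {f} := Set.sdiff_subset_sdiff_left h5 (hC₂ ▸ (by simp))
        rw [hC₂', hdiff h1.subset_ground hx hy]
        rw [habc] at hx hy
        rcases hx with rfl | rfl | rfl <;> rcases hy with rfl | rfl | rfl <;>
          simp_all [Set.insert_comm]
    · rintro (h1 | rfl | ⟨C₁, h1, h2, h3⟩)
      · exact .inl h1
      · exact .inr (.inl ⟨htri ha.1 hb.1 hc.1 hab hac hbc, by simp [hfa, hfb, hfc]⟩)
      · refine .inr (.inr ?_)
        rcases h3 with rfl | rfl | rfl
        · exact ⟨C₁, {f, a, b}, h1, h2, htri hfU ha.1 hb.1 hfa hfb hab, by simp,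
            (hdiff h1.subset_ground ha hb).symm⟩
        · exact ⟨C₁, {f, a, c}, h1, h2, htri hfU ha.1 hc.1 hfa hfc hac, by simp,
            (hdiff h1.subset_ground ha hc).symm⟩
        · exact ⟨C₁, {f, b, c}, h1, h2, htri hfU hb.1 hc.1 hfb hfc hbc, by simp,
            (hdiff h1.subset_ground hb hc).symm⟩

namespace IsTriangleSum

variable {α : Type*} {M M' : Matroid α} {e a b c : α}

theorem swap (h : M.IsTriangleSum e a b c M') : M.IsTriangleSum e b a c M' where
  mem := h.mem
  indep_singleton := h.indep_singleton
  notMem_a := h.notMem_b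
  notMem_b := h.notMem_a
  notMem_c := h.notMem_c
  ab := h.ab.symm
  ac := h.bc
  bc := h.ac
  ground_eq := by rw [h.ground_eq, Set.insert_comm]
  isCircuit_iff C := by
    rw [h.isCircuit_iff, Set.insert_comm a b]
    simp only [Set.insert_comm a b]
    refine or_congr_right (or_congr_right (exists_congr fun C₁ ↦ ?_))
    tauto

theorem rotate (h : M.IsTriangleSum e a b c M') : M.IsTriangleSum e b c a M' where
  mem := h.mem
  indep_singleton := h.indep_singleton
  notMem_a := h.notMem_b
  notMem_b := h.notMem_c
  notMem_c := h.notMem_a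
  ab := h.bc
  ac := h.ab.symm
  bc := h.ac.symm
  ground_eq := by rw [h.ground_eq, Set.insert_comm a b, Set.insert_comm a c]
  isCircuit_iff C := by
    have : ({b, c, a} : Set α) = {a, b, c} := by
      ext
      simp
      tauto
    rw [h.isCircuit_iff, this]
    simp only [Set.insert_comm b a, Set.insert_comm c a]
    refine or_congr_right (or_congr_right (exists_congr fun C₁ ↦ ?_))
    tauto

theorem ne_of_mem (h : M.IsTriangleSum e a b c M') {x : α} (hx : x ∈ M.E) :
    x ≠ a ∧ x ≠ b ∧ x ≠ c :=
  ⟨fun h' ↦ h.notMem_a (h' ▸ hx), fun h' ↦ h.notMem_b (h' ▸ hx), fun h' ↦ h.notMem_c (h' ▸ hx)⟩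

theorem isCircuit_of_notMem (h : M.IsTriangleSum e a b c M') {C : Set α} (hC : M.IsCircuit C)
    (he : e ∉ C) : M'.IsCircuit C :=
  (h.isCircuit_iff C).2 (.inl ⟨hC, he⟩)

theorem isCircuit_pair (h : M.IsTriangleSum e a b c M') {C : Set α} (hC : M.IsCircuit C)
    (he : e ∈ C) : M'.IsCircuit (insert a (insert b (C \ {e}))) :=
  (h.isCircuit_iff _).2 (.inr (.inr ⟨C, hC, he, .inl rfl⟩))

theorem isCircuit_triangle (h : M.IsTriangleSum e a b c M') : M'.IsCircuit {a, b, c} :=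
  (h.isCircuit_iff _).2 (.inr (.inl rfl))

theorem finite [M.Finite] (h : M.IsTriangleSum e a b c M') : M'.Finite := by
  refine ⟨?_⟩
  rw [h.ground_eq]
  exact (((M.ground_finite.subset Set.sdiff_subset).insert c).insert b).insert a

theorem indep_pair (h : M.IsTriangleSum e a b c M') {A : Set α} (hA : M.Indep A) (he : e ∈ A) :
    M'.Indep (insert a (insert b (A \ {e}))) := by
  have hAE := hA.subset_ground
  have hE : insert a (insert b (A \ {e})) ⊆ M'.E := by
    rw [h.ground_eq]
    rintro x (rfl | rfl | hx)
    · simp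
    · simp
    · exact .inr (.inr (.inr ⟨hAE hx.1, hx.2⟩))
  rw [indep_iff_forall_subset_not_isCircuit hE]
  intro C hCA hC
  have hcC : c ∉ C := by
    intro hc
    rcases hCA hc with h1 | h1 | h1
    · exact h.ac h1.symm
    · exact h.bc h1.symm
    · exact h.notMem_c (hAE h1.1)
  have hsub : ∀ x ∈ C, x ∈ M.E → x ∈ A := by
    intro x hx hxE
    obtain ⟨n1, n2, -⟩ := h.ne_of_mem hxE
    exact (((hCA hx).resolve_left n1).resolve_left n2).1
  rcases (h.isCircuit_iff C).1 hC with ⟨h1, -⟩ | rfl | ⟨C₁, h1, h2, rfl | rfl | rfl⟩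
  · exact h1.not_indep (hA.subset fun x hx ↦ hsub x hx (h1.subset_ground hx))
  · simp at hcC
  · refine h1.not_indep (hA.subset fun x hx ↦ ?_)
    by_cases hxe : x = e
    · exact hxe ▸ he
    · exact hsub x (.inr (.inr ⟨hx, hxe⟩)) (h1.subset_ground hx)
  · simp at hcC
  · simp at hcC

theorem indep_iff (h : M.IsTriangleSum e a b c M') {A : Set α} (hA : A ⊆ M.E) (he : e ∉ A) :
    M'.Indep A ↔ M.Indep A := by
  have hE : A ⊆ M'.E := by
    rw [h.ground_eq]
    exact fun x hx ↦ .inr (.inr (.inr ⟨hA hx, fun h' ↦ he (h' ▸ hx)⟩))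
  rw [indep_iff_forall_subset_not_isCircuit hA, indep_iff_forall_subset_not_isCircuit hE]
  refine forall_congr' fun C ↦ forall_congr' fun hC ↦ not_congr ⟨fun hC' ↦ ?_, fun hC' ↦
    h.isCircuit_of_notMem hC' fun h' ↦ he (hC h')⟩
  have na : a ∉ C := fun h' ↦ h.notMem_a (hA (hC h'))
  have nb : b ∉ C := fun h' ↦ h.notMem_b (hA (hC h'))
  rcases (h.isCircuit_iff C).1 hC' with ⟨h1, -⟩ | rfl | ⟨C₁, h1, h2, rfl | rfl | rfl⟩
  · exact h1
  all_goals simp at na nb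

theorem indep_insert (h : M.IsTriangleSum e a b c M') {A : Set α} (hA : M.Indep A)
    (he : e ∉ A) : M'.Indep (insert a A) := by
  have hAE := hA.subset_ground
  have hE : insert a A ⊆ M'.E := by
    rw [h.ground_eq]
    rintro x (rfl | hx)
    · simp
    · exact .inr (.inr (.inr ⟨hAE hx, fun h' ↦ he (h' ▸ hx)⟩))
  rw [indep_iff_forall_subset_not_isCircuit hE]
  intro C hCA hC
  have nb : b ∉ C := fun h' ↦ (hCA h').elim (fun h1 ↦ h.ab h1.symm) fun h1 ↦ h.notMem_b (hAE h1)
  have nc : c ∉ C := fun h' ↦ (hCA h').elim (fun h1 ↦ h.ac h1.symm) fun h1 ↦ h.notMem_c (hAE h1)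
  rcases (h.isCircuit_iff C).1 hC with ⟨h1, -⟩ | rfl | ⟨C₁, h1, h2, rfl | rfl | rfl⟩
  · exact h1.not_indep (hA.subset fun x hx ↦
      (hCA hx).resolve_left (h.ne_of_mem (h1.subset_ground hx)).1)
  all_goals simp at nb nc

end IsTriangleSum

end Matroid

namespace Matroid

theorem IsFramework.ends_nonempty {α V : Type*} [Finite V] {M : Matroid α} {ends : α → Set V}
    (hF : M.IsFramework ends) {x : α} (hx : M.Indep {x}) : (ends x).Nonempty := by
  by_contra h
  rw [Set.not_nonempty_iff_eq_empty] at h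
  simpa using hF.ncard_le (W := ∅) hx (by simp [h])

theorem IsCircuit.indep_singleton_of_nontrivial {α : Type*} {M : Matroid α} {C : Set α}
    (hC : M.IsCircuit C) (hn : C.Nontrivial) {x : α} (hx : x ∈ C) : M.Indep {x} :=
  hC.ssubset_indep ⟨Set.singleton_subset_iff.2 hx, fun h ↦
    (hn.not_subset_singleton) h⟩

namespace IsTriangleSum

/-- The ends of the edges after replacing the loop `e` at `v` by three parallel edges to a
new vertex. -/
def extendEnds {α V : Type*} (ends : α → Set V) (T : Set α) (v : V) (x : α) : Set (Option V) :=
  open Classical in if x ∈ T then {some v, none} else some '' ends x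

theorem extendEnds_of_mem {α V : Type*} {ends : α → Set V} {T : Set α} {v : V} {x : α} (hx : x ∈ T) :
    extendEnds ends T v x = {some v, none} := if_pos hx

theorem extendEnds_of_notMem {α V : Type*} {ends : α → Set V} {T : Set α} {v : V} {x : α} (hx : x ∉ T) :
    extendEnds ends T v x = some '' ends x := if_neg hx

variable {α V : Type*} [Finite V] {M M' : Matroid α} [M.Finite] {e a b c : α} {ends : α → Set V}

/-! #### From the matroid to the 2-sum -/

/-- A circuit through two elements of the triangle is a circuit through `e` in which the loop at `v`
is replaced by a digon from `v` to `none`; this creates no leaf and no separation. For the count,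
the new vertex pays for one element of the triangle, and a second one can occur only where `e`
itself could be added. -/
theorem isFramework_extendEnds (h : M.IsTriangleSum e a b c M') (hF : M.IsFramework ends) {v : V}
    (he : ends e = {v}) : M'.IsFramework (extendEnds ends {a, b, c} v) := by
  set T : Set α := {a, b, c} with hT
  have hME : ∀ x ∈ M.E, x ∉ T := by
    intro x hx hxT
    obtain ⟨h1, h2, h3⟩ := h.ne_of_mem hx
    rcases hxT with h4 | h4 | h4
    exacts [h1 h4, h2 h4, h3 h4]
  have hM'E : ∀ x ∈ M'.E, x ∉ T → x ∈ M.E ∧ x ≠ e := by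
    intro x hx hxT
    rw [h.ground_eq] at hx
    rcases hx with rfl | rfl | rfl | hx
    · simp [hT] at hxT
    · simp [hT] at hxT
    · simp [hT] at hxT
    · exact hx
  have hsome : ∀ (x : α) (W : Set (Option V)), x ∉ T →
      (extendEnds ends T v x ⊆ W ↔ ends x ⊆ some ⁻¹' W) := by
    intro x W hx
    rw [extendEnds_of_notMem hx, Set.image_subset_iff]
  have hdisj : ∀ (x : α) (W : Set (Option V)), x ∉ T →
      (Disjoint (extendEnds ends T v x) W ↔ Disjoint (ends x) (some ⁻¹' W)) := by
    intro x W hx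
    rw [extendEnds_of_notMem hx, Set.disjoint_image_left]
  have hcirc : ∀ {C}, M'.IsCircuit C → (M.IsCircuit C ∧ e ∉ C) ∨ C = T ∨
      ∃ C₁ p q, M.IsCircuit C₁ ∧ e ∈ C₁ ∧ p ∈ T ∧ q ∈ T ∧ p ≠ q ∧
        C = insert p (insert q (C₁ \ {e})) := by
    intro C hC
    rcases (h.isCircuit_iff C).1 hC with h1 | h1 | ⟨C₁, h1, h2, h3 | h3 | h3⟩
    · exact .inl h1
    · exact .inr (.inl h1)
    · exact .inr (.inr ⟨C₁, a, b, h1, h2, by simp [hT], by simp [hT], h.ab, h3⟩)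
    · exact .inr (.inr ⟨C₁, a, c, h1, h2, by simp [hT], by simp [hT], h.ac, h3⟩)
    · exact .inr (.inr ⟨C₁, b, c, h1, h2, by simp [hT], by simp [hT], h.bc, h3⟩)
  have hTf : T.Finite := by simp [hT]
  refine ⟨fun x hx ↦ ?_, fun A W hA hW ↦ ?_, fun C hC hn x hx w hw ↦ ?_, fun C W hC hW hex ↦ ?_⟩
  · by_cases hxT : x ∈ T
    · rw [extendEnds_of_mem hxT]
      exact (Set.ncard_insert_le _ _).trans (by simp)
    · rw [extendEnds_of_notMem hxT, Set.ncard_image_of_injective _ (Option.some_injective V)]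
      exact hF.ncard_ends_le x (hM'E x hx hxT).1
  · have hAT : A \ T ⊆ M.E := fun x hx ↦ (hM'E x (hA.subset_ground hx.1) hx.2).1
    have heAT : e ∉ A \ T := fun hx ↦ (hM'E e (hA.subset_ground hx.1) hx.2).2 rfl
    have hATi : M.Indep (A \ T) := (h.indep_iff hAT heAT).1 (hA.subset Set.sdiff_subset)
    have hends : ∀ x ∈ A \ T, ends x ⊆ some ⁻¹' W := fun x hx ↦ (hsome x W hx.2).1 (hW x hx.1)
    have h1 := hF.ncard_le hATi hends
    have h2 : (some ⁻¹' W).ncard = (some '' (some ⁻¹' W)).ncard :=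
      (Set.ncard_image_of_injective _ (Option.some_injective V)).symm
    have hAf : A.Finite := (h.finite.ground_finite.subset hA.subset_ground)
    have h3 := Set.ncard_inter_add_ncard_sdiff_eq_ncard A T hAf
    rcases (A ∩ T).eq_empty_or_nonempty with h4 | ⟨t, htA, htT⟩
    · rw [h4, Set.ncard_empty] at h3
      have h5 : (some '' (some ⁻¹' W)).ncard ≤ W.ncard :=
        Set.ncard_le_ncard (Set.image_preimage_subset _ _)
      omega
    · have h6 := hW t htA
      rw [extendEnds_of_mem htT] at h6
      have hvW : v ∈ some ⁻¹' W := h6 (.inl rfl)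
      have hnW : none ∈ W := h6 (.inr rfl)
      have h5 : (some '' (some ⁻¹' W)).ncard + 1 ≤ W.ncard := by
        rw [← Set.ncard_insert_of_notMem (a := none) (by simp)]
        refine Set.ncard_le_ncard (Set.insert_subset hnW (Set.image_preimage_subset _ _))
      have h7 : (A ∩ T).ncard ≤ 2 := by
        by_contra hcon
        have h8 : T.ncard ≤ 3 := by
          rw [hT]
          have := Set.ncard_insert_le a {b, c}
          have := Set.ncard_insert_le b {c}
          simp only [Set.ncard_singleton] at this
          omega
        have h9 := Set.eq_of_subset_of_ncard_le (Set.inter_subset_right (s := A) (t := T))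
          (by omega) hTf
        exact h.isCircuit_triangle.not_indep (hA.subset (Set.inter_eq_right.1 h9))
      -- Either `e` stands in for the second element of the triangle in the count for `M`, or `e` is
      -- spanned by `A \ T` and then `A` contains only one element of the triangle.
      by_cases h8 : M.Indep (insert e (A \ T))
      · have h9 := hF.ncard_le (W := some ⁻¹' W) h8 (by
          rintro x (rfl | hx)
          · rw [he]
            simpa using hvW
          · exact hends x hx)
        rw [Set.ncard_insert_of_notMem heAT (hAf.subset Set.sdiff_subset)] at h9
        omega
      · have h9 : (A ∩ T).ncard ≤ 1 := by
          by_contra hcon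
          obtain ⟨p, q, hp, hq, hpq⟩ := (Set.one_lt_ncard_iff (hAf.subset Set.inter_subset_left)).1
            (by omega : 1 < (A ∩ T).ncard)
          obtain ⟨D, hDA, hD⟩ := ((not_indep_iff (Set.insert_subset h.mem hAT)).1
            h8).exists_isCircuit_subset
          have heD : e ∈ D := by
            by_contra heD
            exact hD.not_indep (hATi.subset ((Set.subset_insert_iff_of_notMem heD).1 hDA))
          have hsub : D \ {e} ⊆ A := fun x hx ↦ ((hDA hx.1).resolve_left hx.2).1
          have key : ∀ {X}, M'.IsCircuit X → X ⊆ A → False := fun hX hXA ↦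
            hX.not_indep (hA.subset hXA)
          have h12 := (h.isCircuit_iff (insert a (insert b (D \ {e})))).2
            (.inr (.inr ⟨D, hD, heD, .inl rfl⟩))
          have h13 := (h.isCircuit_iff (insert a (insert c (D \ {e})))).2
            (.inr (.inr ⟨D, hD, heD, .inr (.inl rfl)⟩))
          have h23 := (h.isCircuit_iff (insert b (insert c (D \ {e})))).2
            (.inr (.inr ⟨D, hD, heD, .inr (.inr rfl)⟩))
          have big : ∀ {x y}, x ∈ A → y ∈ A → insert x (insert y (D \ {e})) ⊆ A :=
            fun hx hy ↦ Set.insert_subset hx (Set.insert_subset hy hsub)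
          obtain ⟨hpA, hpT⟩ := hp
          obtain ⟨hqA, hqT⟩ := hq
          rcases hpT with rfl | rfl | rfl <;> rcases hqT with rfl | rfl | rfl
          · exact hpq rfl
          · exact key h12 (big hpA hqA)
          · exact key h13 (big hpA hqA)
          · exact key h12 (big hqA hpA)
          · exact hpq rfl
          · exact key h23 (big hpA hqA)
          · exact key h13 (big hqA hpA)
          · exact key h23 (big hqA hpA)
          · exact hpq rfl
        omega
  · rcases hcirc hC with ⟨h1, h2⟩ | rfl | ⟨C₁, p, q, h1, h2, hp, hq, hpq, rfl⟩
    · rw [extendEnds_of_notMem (hME x (h1.subset_ground hx))] at hw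
      obtain ⟨u, hu, rfl⟩ := hw
      obtain ⟨y, hy, hyx, huy⟩ := hF.exists_ne h1 hn x hx u hu
      refine ⟨y, hy, hyx, ?_⟩
      rw [extendEnds_of_notMem (hME y (h1.subset_ground hy))]
      exact ⟨u, huy, rfl⟩
    · obtain ⟨y, hy, hyx⟩ := hn.exists_ne x
      rw [extendEnds_of_mem hx] at hw
      exact ⟨y, hy, hyx, by rwa [extendEnds_of_mem hy]⟩
    · have hC₁n := h1.nontrivial_of_indep h2 h.indep_singleton
      by_cases hwv : w = some v ∨ w = none
      · by_cases hxp : x = p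
        · refine ⟨q, by simp, ?_, ?_⟩
          · rw [hxp]
            exact hpq.symm
          · rw [extendEnds_of_mem hq]
            exact hwv
        · refine ⟨p, by simp, Ne.symm hxp, ?_⟩
          rw [extendEnds_of_mem hp]
          exact hwv
      · have hxT : x ∉ T := fun hxT ↦ by
          rw [extendEnds_of_mem hxT] at hw
          exact hwv hw
        have hx₁ : x ∈ C₁ \ {e} := by
          rcases hx with rfl | rfl | hx
          exacts [absurd hp hxT, absurd hq hxT, hx]
        rw [extendEnds_of_notMem hxT] at hw
        obtain ⟨u, hu, rfl⟩ := hw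
        obtain ⟨y, hy, hyx, huy⟩ := hF.exists_ne h1 hC₁n x hx₁.1 u hu
        have hye : y ≠ e := by
          rintro rfl
          rw [he] at huy
          exact hwv (.inl (congrArg some huy))
        refine ⟨y, .inr (.inr ⟨hy, hye⟩), hyx, ?_⟩
        rw [extendEnds_of_notMem (hME y (h1.subset_ground hy))]
        exact ⟨u, huy, rfl⟩
  · rcases hcirc hC with ⟨h1, h2⟩ | rfl | ⟨C₁, p, q, h1, h2, hp, hq, hpq, rfl⟩
    · have hCT : ∀ x ∈ C, x ∉ T := fun x hx ↦ hME x (h1.subset_ground hx)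
      have := hF.connected (W := some ⁻¹' W) h1
        (fun x hx ↦ (hW x hx).imp (hsome x W (hCT x hx)).1 (hdisj x W (hCT x hx)).1)
        (by
          obtain ⟨x, hx, hxW⟩ := hex
          exact ⟨x, hx, (hsome x W (hCT x hx)).1 hxW⟩)
      exact fun x hx ↦ (hsome x W (hCT x hx)).2 (this x hx)
    · obtain ⟨x, hx, hxW⟩ := hex
      intro y hy
      rwa [extendEnds_of_mem hy, ← extendEnds_of_mem hx]
    · have hC₁n := h1.nontrivial_of_indep h2 h.indep_singleton
      have hCT : ∀ x ∈ C₁, x ∉ T := fun x hx ↦ hME x (h1.subset_ground hx)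
      have hpv := extendEnds_of_mem (ends := ends) (v := v) hp
      have hqv := extendEnds_of_mem (ends := ends) (v := v) hq
      have hpW := hW p (by simp)
      rw [hpv] at hpW
      -- The position of the digon relative to `W` determines that of the loop `e` relative to the
      -- trace of `W` on the old vertices.
      have heW : (({some v, none} : Set (Option V)) ⊆ W → ends e ⊆ some ⁻¹' W) ∧
          (Disjoint ({some v, none} : Set (Option V)) W → Disjoint (ends e) (some ⁻¹' W)) := by
        rw [he]
        constructor
        · intro h'
          simpa using h' (.inl rfl)
        · intro h'
          rw [Set.disjoint_singleton_left]
          exact Set.disjoint_left.1 h' (.inl rfl)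
      have hW₁ : ∀ x ∈ C₁, ends x ⊆ some ⁻¹' W ∨ Disjoint (ends x) (some ⁻¹' W) := by
        intro x hx
        by_cases hxe : x = e
        · rw [hxe]
          exact hpW.imp heW.1 heW.2
        · exact (hW x (.inr (.inr ⟨hx, hxe⟩))).imp (hsome x W (hCT x hx)).1
            (hdisj x W (hCT x hx)).1
      have hex₁ : ∃ x ∈ C₁, ends x ⊆ some ⁻¹' W := by
        obtain ⟨x, hx, hxW⟩ := hex
        rcases hx with rfl | rfl | hx
        · rw [hpv] at hxW
          exact ⟨e, h2, heW.1 hxW⟩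
        · rw [hqv] at hxW
          exact ⟨e, h2, heW.1 hxW⟩
        · exact ⟨x, hx.1, (hsome x W (hCT x hx.1)).1 hxW⟩
      have hall := hF.connected h1 hW₁ hex₁
      have hvW : ({some v, none} : Set (Option V)) ⊆ W := by
        refine hpW.resolve_right fun hd ↦ ?_
        have := hall e h2
        rw [he] at this
        exact Set.disjoint_left.1 hd (.inl rfl) (this rfl)
      intro x hx
      rcases hx with rfl | rfl | hx
      · rwa [hpv]
      · rwa [hqv]
      · exact (hsome x W (hCT x hx.1)).2 (hall x hx.1)

theorem hasFramework_right {K : Set α} (h : M.IsTriangleSum e a b c M') (hK : K ⊆ M.E)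
    (heK : e ∉ K) (hM : M.HasFramework (insert e K)) : M'.HasFramework K := by
  obtain ⟨V, hV, ends, hF, hL⟩ := hM
  obtain ⟨v, hv⟩ := (hL e (.inl rfl)).2
  refine ⟨Option V, inferInstance, _, h.isFramework_extendEnds hF hv, fun k hk ↦ ?_⟩
  obtain ⟨hk1, w, hw⟩ := hL k (.inr hk)
  refine ⟨(h.indep_iff (Set.singleton_subset_iff.2 (hK hk)) fun h' ↦ heK (h' ▸ hk)).2 hk1,
    some w, ?_⟩
  obtain ⟨h1, h2, h3⟩ := h.ne_of_mem (hK hk)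
  rw [extendEnds_of_notMem (by simp [h1, h2, h3]), hw, Set.image_singleton]

end IsTriangleSum

end Matroid

namespace Matroid

namespace IsTriangleSum

/-! #### From the 2-sum to the matroid -/

/-- The map that sends `e` to `b` and fixes all other elements. -/
noncomputable def subst {α : Type*} (e b x : α) : α :=
  open Classical in if x = e then b else x

theorem subst_self {α : Type*} {e b : α} : subst e b e = b := if_pos rfl

theorem subst_of_ne {α : Type*} {e b x : α} (h : x ≠ e) : subst e b x = x := if_neg h

section

variable {α : Type*} {M M' : Matroid α} {e a b c : α}

theorem injOn_subst (h : M.IsTriangleSum e a b c M') : Set.InjOn (subst e b) M.E := by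
  intro x hx y hy hxy
  by_cases hxe : x = e <;> by_cases hye : y = e
  · rw [hxe, hye]
  · rw [hxe, subst_self, subst_of_ne hye] at hxy
    exact (h.notMem_b (hxy ▸ hy)).elim
  · rw [hye, subst_self, subst_of_ne hxe] at hxy
    exact (h.notMem_b (hxy ▸ hx)).elim
  · rwa [subst_of_ne hxe, subst_of_ne hye] at hxy

theorem subst_ne (h : M.IsTriangleSum e a b c M') {x : α} (hx : x ∈ M.E) : subst e b x ≠ a := by
  by_cases hxe : x = e
  · rw [hxe, subst_self]
    exact h.ab.symm
  · rw [subst_of_ne hxe]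
    exact (h.ne_of_mem hx).1

theorem subst_mem (h : M.IsTriangleSum e a b c M') {x : α} (hx : x ∈ M.E) :
    subst e b x ∈ M'.E := by
  rw [h.ground_eq]
  by_cases hxe : x = e
  · rw [hxe, subst_self]
    simp
  · rw [subst_of_ne hxe]
    exact .inr (.inr (.inr ⟨hx, hxe⟩))

theorem image_subst {A : Set α} (he : e ∈ A) : subst e b '' A = insert b (A \ {e}) := by
  ext x
  constructor
  · rintro ⟨y, hy, rfl⟩
    by_cases hye : y = e
    · exact .inl (by rw [hye, subst_self])
    · exact .inr (by rw [subst_of_ne hye]; exact ⟨hy, hye⟩)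
  · rintro (rfl | ⟨hx, hxe⟩)
    · exact ⟨e, he, subst_self⟩
    · exact ⟨x, hx, subst_of_ne hxe⟩

theorem image_subst_of_notMem {A : Set α} (he : e ∉ A) : subst e b '' A = A := by
  have : ∀ x ∈ A, subst e b x = x := fun x hx ↦ subst_of_ne fun h ↦ he (h ▸ hx)
  rw [Set.image_congr this, Set.image_id']

/-- `M` is `M'` with `a` contracted and `c` deleted, where `b` plays the part of `e`. This is the
half of that statement needed for counting: `A` lifts to an independent set with one element more.
-/
theorem indep_image (h : M.IsTriangleSum e a b c M') {A : Set α} (hA : M.Indep A) :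
    M'.Indep (insert a (subst e b '' A)) := by
  by_cases he : e ∈ A
  · rw [image_subst he]
    exact h.indep_pair hA he
  · rw [image_subst_of_notMem he]
    exact h.indep_insert hA he

theorem ncard_insert_image [M.Finite] (h : M.IsTriangleSum e a b c M') {A : Set α} (hA : A ⊆ M.E) :
    (insert a (subst e b '' A)).ncard = A.ncard + 1 := by
  rw [Set.ncard_insert_of_notMem _ ((M.set_finite A hA).image _), (h.injOn_subst.mono hA).ncard_image]
  rintro ⟨x, hx, h'⟩
  exact h.subst_ne (hA hx) h'

/-- The lift contains `a` precisely when `e ∈ C`. The conclusion leaves this open, so that later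
arguments treat both cases at once. -/
theorem exists_isCircuit (h : M.IsTriangleSum e a b c M') {C : Set α} (hC : M.IsCircuit C) :
    ∃ C', M'.IsCircuit C' ∧ (∀ x ∈ C, subst e b x ∈ C') ∧
      ∀ y ∈ C', y = a ∨ ∃ x ∈ C, subst e b x = y := by
  by_cases he : e ∈ C
  · refine ⟨_, h.isCircuit_pair hC he, fun x hx ↦ ?_, fun y hy ↦ ?_⟩ <;> rw [← image_subst he] at *
    · exact .inr ⟨x, hx, rfl⟩
    · exact hy
  · refine ⟨_, h.isCircuit_of_notMem hC he, fun x hx ↦ ?_, fun y hy ↦ ?_⟩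
    · have hxe : x ≠ e := fun h' ↦ he (h' ▸ hx)
      rwa [subst_of_ne hxe]
    · have hye : y ≠ e := fun h' ↦ he (h' ▸ hy)
      exact .inr ⟨y, hy, subst_of_ne hye⟩

theorem nontrivial_of_forall_mem (h : M.IsTriangleSum e a b c M') {C C' : Set α} (hC : C ⊆ M.E)
    (hn : C.Nontrivial) (hC' : ∀ x ∈ C, subst e b x ∈ C') : C'.Nontrivial := by
  obtain ⟨x, hx, y, hy, hxy⟩ := hn
  exact ⟨_, hC' x hx, _, hC' y hy, fun h' ↦ hxy (h.injOn_subst (hC hx) (hC hy) h')⟩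

/-- The map that identifies `v` with `u`. -/
noncomputable def identify {V : Type*} (u v w : V) : V :=
  open Classical in if w = v then u else w

theorem identify_of_ne {V : Type*} {u v w : V} (h : w ≠ v) : identify u v w = w := if_neg h

theorem identify_right {V : Type*} {u v : V} : identify u v v = u := if_pos rfl

theorem identify_left {V : Type*} {u v : V} : identify u v u = u := by
  unfold identify
  split_ifs <;> rfl

end

section

variable {α V : Type*} [Finite V] {M M' : Matroid α} [M.Finite] {e a b c : α} {ends : α → Set V}

/-- Contracting the link `a`. -/
theorem isFramework_identify (h : M.IsTriangleSum e a b c M') (hF : M'.IsFramework ends) {u v : V}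
    (huv : u ≠ v) (ha : ends a = {u, v}) :
    M.IsFramework fun x ↦ identify u v '' ends (subst e b x) := by
  have himg : ∀ (x : α) (W : Set V), identify u v '' ends x ⊆ W ↔ ends x ⊆ identify u v ⁻¹' W :=
    fun x W ↦ Set.image_subset_iff
  have hdis : ∀ (x : α) (W : Set V), Disjoint (identify u v '' ends x) W ↔
      Disjoint (ends x) (identify u v ⁻¹' W) := fun x W ↦ Set.disjoint_image_left
  have hM'f := h.finite
  refine ⟨fun x hx ↦ ?_, fun A W hA hW ↦ ?_, fun C hC hn x hx w hw ↦ ?_, fun C W hC hW hex ↦ ?_⟩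
  · exact (Set.ncard_image_le (Set.toFinite _)).trans (hF.ncard_ends_le _ (h.subst_mem hx))
  · have hAE := hA.subset_ground
    have h1 := h.indep_image hA
    have h2 := h.ncard_insert_image hAE
    have h3 : ∀ y ∈ subst e b '' A, ends y ⊆ identify u v ⁻¹' W := by
      rintro _ ⟨x, hx, rfl⟩
      exact (himg _ _).1 (hW x hx)
    -- If `u ∈ W`, the preimage of `W` has at most one further vertex, namely `v`, and the lifted
    -- set has the further element `a`. Otherwise the preimage lies in `W`, and `a` is left out.
    by_cases huW : u ∈ W
    · have h4 := hF.ncard_le (W := identify u v ⁻¹' W) h1 (by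
        rintro y (rfl | hy)
        · rw [ha]
          rintro w (rfl | rfl)
          · simpa [identify_left] using huW
          · simpa [identify_right] using huW
        · exact h3 y hy)
      have h5 : (identify u v ⁻¹' W).ncard ≤ (insert v W).ncard := by
        refine Set.ncard_le_ncard fun w hw ↦ ?_
        by_cases hwv : w = v
        · exact .inl hwv
        · rw [Set.mem_preimage, identify_of_ne hwv] at hw
          exact .inr hw
      have h6 := Set.ncard_insert_le v W
      omega
    · have h4 := hF.ncard_le (h1.subset (Set.subset_insert _ _)) h3
      rw [(h.injOn_subst.mono hAE).ncard_image] at h4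
      refine h4.trans (Set.ncard_le_ncard fun w hw ↦ ?_)
      by_cases hwv : w = v
      · rw [hwv, Set.mem_preimage, identify_right] at hw
        exact (huW hw).elim
      · rwa [Set.mem_preimage, identify_of_ne hwv] at hw
  · obtain ⟨C', hC', hCC', hC'C⟩ := h.exists_isCircuit hC
    have hn' := h.nontrivial_of_forall_mem hC.subset_ground hn hCC'
    -- A new leaf can arise only at the contracted vertex `u`, when `a` is the only other element of
    -- the lifted circuit there. All remaining elements then avoid `u` and `v`, so the lift of `x`
    -- must meet `a` at both ends and is parallel to it. The vertices `u` and `v` then separate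
    -- these two from the lift of a second element of `C`.
    by_contra! hcon
    have key : ∀ w' ∈ ends (subst e b x), identify u v w' = w →
        ∀ y ∈ C', y ≠ subst e b x → y ≠ a → w' ∉ ends y := by
      intro w' _ hw' y hy hyx hya hwy
      obtain ⟨z, hz, rfl⟩ := (hC'C y hy).resolve_left hya
      exact hcon z hz (fun h' ↦ hyx (by rw [h'])) ⟨w', hwy, hw'⟩
    obtain ⟨w', hw', hw'w⟩ := hw
    obtain ⟨y, hy, hyx, hwy⟩ := hF.exists_ne hC' hn' _ (hCC' x hx) w' hw'
    have hya : y = a := by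
      by_contra hya
      exact key w' hw' hw'w y hy hyx hya hwy
    subst hya
    have hwu : w = u := by
      rw [ha] at hwy
      rw [← hw'w]
      rcases hwy with rfl | rfl
      exacts [identify_left, identify_right]
    have hav : ∀ z ∈ C', z ≠ subst e b x → z ≠ y → u ∉ ends z ∧ v ∉ ends z := by
      intro z hz hzx hzy
      obtain ⟨t, ht, rfl⟩ := (hC'C z hz).resolve_left hzy
      have ht' : t ≠ x := fun h' ↦ hzx (by rw [h'])
      refine ⟨fun hu ↦ hcon t ht ht' ⟨u, hu, ?_⟩, fun hv ↦ hcon t ht ht' ⟨v, hv, ?_⟩⟩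
      · rw [identify_left, hwu]
      · rw [identify_right, hwu]
    have hux : {u, v} ⊆ ends (subst e b x) := by
      intro w₁ hw₁
      obtain ⟨z, hz, hzy, hz'⟩ := hF.exists_ne hC' hn' y hy w₁ (ha ▸ hw₁)
      by_contra hcon'
      have hzx : z ≠ subst e b x := by
        rintro rfl
        exact hcon' hz'
      obtain ⟨h1, h2⟩ := hav z hz hzx hzy
      rcases hw₁ with rfl | rfl
      exacts [h1 hz', h2 hz']
    have hxuv : ends (subst e b x) = {u, v} := by
      refine (Set.eq_of_subset_of_ncard_le hux ?_ (Set.toFinite _)).symm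
      rw [Set.ncard_pair huv]
      exact hF.ncard_ends_le _ (hC'.subset_ground (hCC' x hx))
    have hall := hF.connected (W := {u, v}) hC' (by
      intro z hz
      by_cases hzx : z = subst e b x
      · exact .inl (hzx ▸ hxuv.subset)
      · by_cases hzy : z = y
        · exact .inl (hzy ▸ ha.subset)
        · right
          rw [Set.disjoint_right]
          rintro _ (rfl | rfl)
          exacts [(hav z hz hzx hzy).1, (hav z hz hzx hzy).2]) ⟨y, hy, ha.subset⟩
    obtain ⟨t, ht, htx⟩ := hn.exists_ne x
    have htx' : subst e b t ≠ subst e b x := fun h' ↦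
      htx (h.injOn_subst (hC.subset_ground ht) (hC.subset_ground hx) h')
    obtain ⟨h1, h2⟩ := hav _ (hCC' t ht) htx' (h.subst_ne (hC.subset_ground ht))
    obtain ⟨r, hr⟩ := hF.ends_nonempty (hC'.indep_singleton_of_nontrivial hn' (hCC' t ht))
    rcases hall _ (hCC' t ht) hr with rfl | rfl
    exacts [h1 hr, h2 hr]
  · obtain ⟨C', hC', hCC', hC'C⟩ := h.exists_isCircuit hC
    simp only [himg, hdis] at hW hex ⊢
    obtain ⟨x, hx, hxW⟩ := hex
    have hall := hF.connected (W := identify u v ⁻¹' W) hC' (by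
      intro y hy
      rcases hC'C y hy with rfl | ⟨z, hz, rfl⟩
      · rw [ha]
        -- Both ends of `a` go to `u`, so `a` never crosses the boundary of a preimage.
        by_cases huW : u ∈ W
        · left
          rintro w (rfl | rfl)
          · simpa [identify_left] using huW
          · simpa [identify_right] using huW
        · right
          rw [Set.disjoint_left]
          rintro w (rfl | rfl)
          · simpa [identify_left] using huW
          · simpa [identify_right] using huW
      · exact hW z hz) ⟨_, hCC' x hx, hxW⟩
    exact fun z hz ↦ hall _ (hCC' z hz)

end

end IsTriangleSum

end Matroid

namespace Matroid

namespace IsTriangleSum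

variable {α V : Type*} [Finite V] {M M' : Matroid α} [M.Finite] {e a b c : α} {ends : α → Set V}

/-! #### Contracting a joint -/

-- Together with `a` it would give two independent elements on the single vertex `u`. Hence an
-- element that is not a loop of `M` keeps an end when `u` is removed.
omit [Finite V] in
theorem not_subset_of_ends_eq (h : M.IsTriangleSum e a b c M') (hF : M'.IsFramework ends) {u : V}
    (ha : ends a = {u}) {x : α} (hx : M.Indep {x}) : ¬ ends (subst e b x) ⊆ {u} := by
  intro hsub
  have h1 := h.indep_image hx
  have h2 := h.ncard_insert_image hx.subset_ground
  have h3 := hF.ncard_le (W := {u}) h1 (by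
    rintro y (rfl | ⟨z, rfl, rfl⟩)
    exacts [ha.subset, hsub])
  rw [h2] at h3
  simp at h3

/-- Let `X₀` be the part of `C` on the side of `S`, and `U` its set of vertices other than `u`. It
is a proper part of a circuit, so adding `a` to its lift gives an independent set on `U` and `u`,
whence `X₀` has at most as many elements as `U`. But each vertex of `U` is on two elements of `X₀`,
and if `u` were an end of `x`, then `x` would have at most one end in `U`, so that `X₀` would be
larger than `U`. -/
theorem notMem_ends_of_separation (h : M.IsTriangleSum e a b c M') (hF : M'.IsFramework ends)
    {u : V} (ha : ends a = {u}) {C : Set α} (hC : M.IsCircuit C) (hn : C.Nontrivial) {S : Set V}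
    (hS : ∀ x ∈ C, ends (subst e b x) \ {u} ⊆ S ∨ Disjoint (ends (subst e b x) \ {u}) S)
    {y : α} (hy : y ∈ C) (hyS : ¬ ends (subst e b y) \ {u} ⊆ S)
    {x : α} (hx : x ∈ C) (hxS : ends (subst e b x) \ {u} ⊆ S) : u ∉ ends (subst e b x) := by
  intro hux
  have hM'f := h.finite
  have hCE := hC.subset_ground
  obtain ⟨C', hC', hCC', hC'C⟩ := h.exists_isCircuit hC
  have hn' := h.nontrivial_of_forall_mem hCE hn hCC'
  set X₀ := {x | x ∈ C ∧ ends (subst e b x) \ {u} ⊆ S} with hX₀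
  have hX₀C : X₀ ⊆ C := fun z hz ↦ hz.1
  have hX₀i : M.Indep X₀ := hC.ssubset_indep ⟨hX₀C, fun h' ↦ hyS (h' hy).2⟩
  have hcard := h.ncard_insert_image (hX₀C.trans hCE)
  have hXcard := (h.injOn_subst.mono (hX₀C.trans hCE)).ncard_image
  set U : Set V := (⋃ z ∈ X₀, ends (subst e b z)) \ {u} with hU
  have h1 : U.ncard < (subst e b '' X₀).ncard := by
    refine ncard_lt_of_two_edges (ends := ends) (x₀ := subst e b x)
      ((M.set_finite X₀ hX₀i.subset_ground).image _) ?_ ?_ ⟨x, ⟨hx, hxS⟩, rfl⟩ ?_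
    · rintro _ ⟨z, hz, rfl⟩
      exact hF.ncard_ends_le _ (h.subst_mem (hCE hz.1))
    · rintro w ⟨hw, hwu⟩
      simp only [Set.mem_iUnion, exists_prop] at hw
      obtain ⟨z, hz, hwz⟩ := hw
      obtain ⟨t, ht, htz, hwt⟩ := hF.exists_ne hC' hn' _ (hCC' z hz.1) w hwz
      have hta : t ≠ a := by
        rintro rfl
        rw [ha] at hwt
        exact hwu hwt
      obtain ⟨r, hr, rfl⟩ := (hC'C t ht).resolve_left hta
      refine ⟨_, ⟨z, hz, rfl⟩, _, ⟨r, ⟨hr, (hS r hr).resolve_right fun hd ↦ ?_⟩, rfl⟩, htz.symm,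
        hwz, hwt⟩
      exact Set.disjoint_left.1 hd ⟨hwt, hwu⟩ (hz.2 ⟨hwz, hwu⟩)
    · have h2 : (ends (subst e b x) \ {u}).ncard ≤ 1 := by
        rw [Set.ncard_sdiff_singleton_of_mem hux]
        have := hF.ncard_ends_le _ (h.subst_mem (hCE hx))
        omega
      exact (Set.ncard_le_ncard (t := ends (subst e b x) \ {u})
        fun w hw ↦ ⟨hw.1, hw.2.2⟩).trans h2
  have h2 := hF.ncard_le (W := insert u U) (h.indep_image hX₀i) (by
    rintro t (rfl | ⟨z, hz, rfl⟩)
    · rw [ha]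
      simp
    · intro w hw
      by_cases hwu : w = u
      · exact .inl hwu
      · exact .inr ⟨Set.mem_biUnion hz hw, hwu⟩)
  have h3 := Set.ncard_insert_le u U
  omega

/-- Contracting the joint `a`. -/
theorem isFramework_sdiff (h : M.IsTriangleSum e a b c M') (hF : M'.IsFramework ends) {u : V}
    (ha : ends a = {u}) : M.IsFramework fun x ↦ ends (subst e b x) \ {u} := by
  have hM'f := h.finite
  refine ⟨fun x hx ↦ ?_, fun A W hA hW ↦ ?_, fun C hC hn x hx w hw ↦ ?_, fun C W hC hW hex ↦ ?_⟩
  · exact (Set.ncard_le_ncard Set.sdiff_subset).trans (hF.ncard_ends_le _ (h.subst_mem hx))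
  · have h1 := hF.ncard_le (W := insert u W) (h.indep_image hA) (by
      rintro y (rfl | ⟨x, hx, rfl⟩)
      · rw [ha]
        simp
      · rw [← Set.sdiff_singleton_subset_iff]
        exact hW x hx)
    have h2 := h.ncard_insert_image hA.subset_ground
    have h3 := Set.ncard_insert_le u W
    omega
  · obtain ⟨C', hC', hCC', hC'C⟩ := h.exists_isCircuit hC
    have hn' := h.nontrivial_of_forall_mem hC.subset_ground hn hCC'
    obtain ⟨y, hy, hyx, hwy⟩ := hF.exists_ne hC' hn' _ (hCC' x hx) w hw.1
    have hya : y ≠ a := by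
      rintro rfl
      rw [ha] at hwy
      exact hw.2 hwy
    obtain ⟨z, hz, rfl⟩ := (hC'C y hy).resolve_left hya
    exact ⟨z, hz, fun h' ↦ hyx (by rw [h']), hwy, hw.2⟩
  · by_contra! hcon
    obtain ⟨x, hx, hxW⟩ := hex
    obtain ⟨y, hy, hyW⟩ := hcon
    have hn : C.Nontrivial := ⟨x, hx, y, hy, fun h' ↦ hyW (h' ▸ hxW)⟩
    obtain ⟨C', hC', hCC', hC'C⟩ := h.exists_isCircuit hC
    have hxWc : ¬ ends (subst e b x) \ {u} ⊆ Wᶜ := by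
      intro h'
      refine h.not_subset_of_ends_eq hF ha (hC.indep_singleton_of_nontrivial hn hx) ?_
      intro w hw
      by_contra hwu
      exact h' ⟨hw, hwu⟩ (hxW ⟨hw, hwu⟩)
    -- Apply the preceding counting argument to both sides, `W` and its complement. If neither side
    -- meets `u`, then removing `u` has changed nothing, and `W \ {u}` already separates the lifted
    -- circuit.
    have key : ∀ z ∈ C, u ∉ ends (subst e b z) := by
      intro z hz
      rcases hW z hz with hzW | hzW
      · exact h.notMem_ends_of_separation hF ha hC hn hW hy hyW hz hzW
      · refine h.notMem_ends_of_separation hF ha hC hn (S := Wᶜ) (fun t ht ↦ ?_) hx hxWc hz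
          (Set.subset_compl_iff_disjoint_right.2 hzW)
        exact (hW t ht).symm.imp Set.subset_compl_iff_disjoint_right.2
          fun h' ↦ Set.disjoint_compl_right_iff_subset.2 h'
    have hsd : ∀ z ∈ C, ends (subst e b z) \ {u} = ends (subst e b z) := fun z hz ↦
      Set.sdiff_singleton_eq_self (key z hz)
    have hall := hF.connected (W := W \ {u}) hC' (by
      intro t ht
      rcases hC'C t ht with rfl | ⟨z, hz, rfl⟩
      · right
        rw [ha]
        simp
      · have := hW z hz
        rw [hsd z hz] at this
        exact this.imp (fun h' ↦ Set.subset_sdiff_singleton h' (key z hz))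
          (fun h' ↦ h'.mono_right Set.sdiff_subset)) ⟨_, hCC' x hx, by
        refine Set.subset_sdiff_singleton ?_ (key x hx)
        rwa [hsd x hx] at hxW⟩
    refine hyW ?_
    rw [hsd y hy]
    exact (hall _ (hCC' y hy)).trans Set.sdiff_subset

/-! #### Balanced triangles -/

/-- The vertex `x` lies in an unbalanced part of the graph on `M.E \ {e}`. -/
def InTight {α V : Type*} (M : Matroid α) (ends : α → Set V) (e : α) (x : V) : Prop :=
  ∃ A W, M.Indep A ∧ e ∉ A ∧ Tight ends A ∅ W ∧ x ∈ W

omit [Finite V] in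
theorem insideCount_empty_right (A : Set α) (W : Set V) :
    insideCount ends A ∅ W = {x | x ∈ A ∧ ends x ⊆ W}.ncard := by
  simp [insideCount]

/-- Let `Q` be the elements of `C` other than `e` inside `S`, and `U` their vertices. In the lifted
circuit every vertex of `U` is on two members of `Q` and `b`, because `a` has no end in `S`. As `b`
leaves `S` at `y`, there are fewer vertices than elements of `Q` and `b` together, so `U` is tight
for the independent set `Q`. Since `x` is not a leaf, it lies in `U`, contrary to `hx`. -/
theorem not_split (h : M.IsTriangleSum e a b c M') (hF : M'.IsFramework ends) {x y z : V}
    (hxy : x ≠ y) (hxz : x ≠ z) (ha : ends a = {y, z}) (hb : ends b = {x, y})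
    (hx : ¬ InTight M ends e x) {C : Set α} (hC : M.IsCircuit C) (heC : e ∈ C) {S : Set V}
    (hxS : x ∈ S) (hyS : y ∉ S) (hzS : z ∉ S)
    (hS : ∀ q ∈ C, q ≠ e → ends q ⊆ S ∨ Disjoint (ends q) S) : False := by
  have hM'f := h.finite
  have hC' := h.isCircuit_pair hC heC
  have hn' : (insert a (insert b (C \ {e}))).Nontrivial := ⟨a, by simp, b, by simp, h.ab⟩
  have hxa : x ∉ ends a := by
    rw [ha]
    simp [hxy, hxz]
  set Q := {q | q ∈ C \ {e} ∧ ends q ⊆ S} with hQ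
  have hQf : Q.Finite := (M.set_finite C hC.subset_ground).subset fun q hq ↦ hq.1.1
  have hbQ : b ∉ Q := fun h' ↦ h.notMem_b (hC.subset_ground h'.1.1)
  have hQS : ∀ q ∈ C \ {e}, ∀ w ∈ ends q, w ∈ S → q ∈ Q := fun q hq w hw hwS ↦
    ⟨hq, (hS q hq.1 hq.2).resolve_right fun hd ↦ Set.disjoint_left.1 hd hw hwS⟩
  have hother : ∀ r ∈ insert b Q, ∀ w ∈ ends r, w ∈ S → ∃ t ∈ insert b Q, t ≠ r ∧ w ∈ ends t := by
    intro r hr w hw hwS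
    obtain ⟨t, ht, htr, hwt⟩ := hF.exists_ne hC' hn' r (by
      rcases hr with rfl | hr
      · simp
      · exact .inr (.inr hr.1)) w hw
    refine ⟨t, ?_, htr, hwt⟩
    rcases ht with rfl | rfl | ht
    · rw [ha] at hwt
      rcases hwt with rfl | rfl
      exacts [(hyS hwS).elim, (hzS hwS).elim]
    · exact .inl rfl
    · exact .inr (hQS t ht w hwt hwS)
  set U : Set V := ⋃ q ∈ Q, ends q with hU
  have hUS : U ⊆ S := Set.iUnion₂_subset fun q hq ↦ hq.2
  have h1 : U.ncard < (insert b Q).ncard := by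
    refine ncard_lt_of_two_edges (ends := ends) (x₀ := b) (hQf.insert b) ?_ ?_ (by simp) ?_
    · rintro r (rfl | hr)
      · exact hF.ncard_ends_le r (hC'.subset_ground (by simp))
      · exact hF.ncard_ends_le r (hC'.subset_ground (.inr (.inr hr.1)))
    · intro w hw
      have hwS := hUS hw
      simp only [hU, Set.mem_iUnion, exists_prop] at hw
      obtain ⟨q, hq, hwq⟩ := hw
      obtain ⟨t, ht, htq, hwt⟩ := hother q (.inr hq) w hwq hwS
      exact ⟨q, .inr hq, t, ht, htq.symm, hwq, hwt⟩
    · refine (Set.ncard_le_ncard (t := {x}) ?_).trans (by simp)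
      rw [hb]
      rintro w ⟨rfl | rfl, hw⟩
      · rfl
      · exact (hyS (hUS hw)).elim
  rw [Set.ncard_insert_of_notMem hbQ hQf] at h1
  refine hx ⟨Q, U, ?_, fun h' ↦ h'.1.2 rfl, ?_, ?_⟩
  · exact (hC.sdiff_singleton_indep heC).subset fun q hq ↦ hq.1
  · have : {q | q ∈ Q ∧ ends q ⊆ U} = Q :=
      subset_antisymm (fun q hq ↦ hq.1) fun q hq ↦ ⟨hq, Set.subset_biUnion_of_mem hq⟩
    rw [Tight, insideCount_empty_right, this]
    omega
  · obtain ⟨t, ht, htb, hxt⟩ := hother b (by simp) x (by rw [hb]; simp) hxS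
    exact Set.mem_biUnion (ht.resolve_left htb) hxt

/-- The ends of the edges after identifying `y` with `z` and making `e` a loop at `x`. -/
noncomputable def rollEnds {α V : Type*} (ends : α → Set V) (e : α) (x y z : V) (t : α) : Set V :=
  open Classical in if t = e then {x} else identify y z '' ends t

/-- Contracting `a` turns `e` into a link from `x` to `y`, and the result is a framework. Making `e`
a loop at `x` changes only its incidence with `y`. Wherever this could matter, the count is saved
because no tight set contains `x`, and the conditions on circuits are saved by `not_split`. -/
theorem isFramework_rollEnds (h : M.IsTriangleSum e a b c M') (hF : M'.IsFramework ends) {x y z : V}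
    (hxy : x ≠ y) (hxz : x ≠ z) (hyz : y ≠ z) (ha : ends a = {y, z}) (hb : ends b = {x, y})
    (hc : ends c = {x, z}) (hx : ¬ InTight M ends e x) :
    M.IsFramework (rollEnds ends e x y z) := by
  have hM'f := h.finite
  have hF₀ := h.isFramework_identify hF hyz ha
  have re : rollEnds ends e x y z e = {x} := if_pos rfl
  have rne : ∀ {t}, t ≠ e → rollEnds ends e x y z t = identify y z '' ends t := fun ht ↦ if_neg ht
  have r0e : identify y z '' ends (subst e b e) = {x, y} := by
    rw [subst_self, hb, Set.image_pair, identify_of_ne hxz, identify_left]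
  have r0ne : ∀ {t}, t ≠ e → identify y z '' ends (subst e b t) = identify y z '' ends t :=
    fun ht ↦ by rw [subst_of_ne ht]
  refine ⟨fun t ht ↦ ?_, fun A W hA hW ↦ ?_, fun C hC hn t ht w hw ↦ ?_, fun C W hC hW hex ↦ ?_⟩
  · by_cases hte : t = e
    · rw [hte, re]
      simp
    · rw [rne hte, ← r0ne hte]
      exact hF₀.ncard_ends_le t ht
  -- In all other cases the bound is that of the contracted graph. Here no element of `A` other than
  -- `e` meets `y` or `z`, so `A \ {e}` lies inside `W \ {z}`. This set contains `x`, so it is not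
  -- tight, which leaves room for `e`.
  · by_cases hy : e ∈ A ∧ y ∉ W
    · obtain ⟨heA, hyW⟩ := hy
      have hxW : x ∈ W := by simpa [re] using hW e heA
      have h1 : ¬ Tight ends (A \ {e}) ∅ (W \ {z}) := fun hT ↦
        hx ⟨_, _, hA.subset Set.sdiff_subset, by simp, hT, hxW, hxz⟩
      rw [Tight, insideCount_empty_right, not_le] at h1
      have h2 : {t | t ∈ A \ {e} ∧ ends t ⊆ W \ {z}} = A \ {e} := by
        refine subset_antisymm (fun t ht ↦ ht.1) fun t ht ↦ ⟨ht, fun w hw ↦ ?_⟩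
        have h3 := hW t ht.1
        rw [rne ht.2] at h3
        have h4 := h3 ⟨w, hw, rfl⟩
        by_cases hwz : w = z
        · rw [hwz, identify_right] at h4
          exact (hyW h4).elim
        · rw [identify_of_ne hwz] at h4
          exact ⟨h4, hwz⟩
      rw [h2] at h1
      have h3 := Set.ncard_sdiff_singleton_add_one heA (M.set_finite A hA.subset_ground)
      have h4 : (W \ {z}).ncard ≤ W.ncard := Set.ncard_le_ncard Set.sdiff_subset
      omega
    · refine hF₀.ncard_le hA fun t ht ↦ ?_
      have h1 := hW t ht
      by_cases hte : t = e
      · subst hte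
        rw [re] at h1
        rw [r0e]
        have hyW : y ∈ W := by
          by_contra h'
          exact hy ⟨ht, h'⟩
        rintro w (rfl | rfl)
        exacts [h1 rfl, hyW]
      · rw [r0ne hte]
        rwa [rne hte] at h1
  · have hw₀ : w ∈ identify y z '' ends (subst e b t) := by
      by_cases hte : t = e
      · subst hte
        rw [re] at hw
        rw [r0e]
        exact .inl hw
      · rw [rne hte] at hw
        rwa [r0ne hte]
    obtain ⟨r, hr, hrt, hwr⟩ := hF₀.exists_ne hC hn t ht w hw₀
    by_cases hre : r = e
    swap
    · exact ⟨r, hr, hrt, by rw [rne hre]; rwa [r0ne hre] at hwr⟩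
    subst hre
    rw [r0e] at hwr
    rcases hwr with rfl | rfl
    · exact ⟨r, hr, hrt, by rw [re]; rfl⟩
    -- Here `r` is the former `e` and `w` the former `y`. Lifting the circuit with the pair `b`, `c`
    -- instead shows that `t` must meet both `w` and `z`. So `t` is a link between them, and all
    -- other elements of `C` except `r` avoid both: the circuit is split.
    by_contra! hcon
    have hav : ∀ q ∈ C, q ≠ r → q ≠ t → w ∉ ends q ∧ z ∉ ends q := by
      intro q hq hqr hqt
      have h1 := hcon q hq hqt
      rw [rne hqr] at h1
      exact ⟨fun h' ↦ h1 ⟨w, h', identify_left⟩, fun h' ↦ h1 ⟨z, h', identify_right⟩⟩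
    have hC' := h.rotate.isCircuit_pair hC hr
    have hn' : (insert b (insert c (C \ {r}))).Nontrivial := ⟨b, by simp, c, by simp, h.bc⟩
    have hwt : w ∈ ends t := by
      obtain ⟨q, hq, hqb, hwq⟩ := hF.exists_ne hC' hn' b (by simp) w (by rw [hb]; simp)
      rcases hq with rfl | rfl | hq
      · exact (hqb rfl).elim
      · rw [hc] at hwq
        rcases hwq with h' | h'
        exacts [(hxy h'.symm).elim, (hyz h').elim]
      · by_cases hqt : q = t
        · rwa [← hqt]
        · exact ((hav q hq.1 hq.2 hqt).1 hwq).elim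
    have hzt : z ∈ ends t := by
      obtain ⟨q, hq, hqb, hwq⟩ := hF.exists_ne hC' hn' c (by simp) z (by rw [hc]; simp)
      rcases hq with rfl | rfl | hq
      · rw [hb] at hwq
        rcases hwq with h' | h'
        exacts [(hxz h'.symm).elim, (hyz h'.symm).elim]
      · exact (hqb rfl).elim
      · by_cases hqt : q = t
        · rwa [← hqt]
        · exact ((hav q hq.1 hq.2 hqt).2 hwq).elim
    have htE : t ∈ M'.E := by
      have := h.subst_mem (hC.subset_ground ht)
      rwa [subst_of_ne hrt.symm] at this
    have hte : ends t = {w, z} := by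
      refine (Set.eq_of_subset_of_ncard_le ?_ ?_ (Set.toFinite _)).symm
      · rintro _ (rfl | rfl)
        exacts [hwt, hzt]
      · rw [Set.ncard_pair hyz]
        exact hF.ncard_ends_le t htE
    refine h.not_split hF hxy hxz ha hb hx hC hr (S := {w, z}ᶜ) ?_ (by simp) (by simp) ?_
    · simp [hxy, hxz]
    · intro q hq hqr
      by_cases hqt : q = t
      · right
        rw [hqt, hte]
        exact disjoint_compl_right
      · left
        obtain ⟨h1, h2⟩ := hav q hq hqr hqt
        rintro v hv (rfl | rfl)
        exacts [h1 hv, h2 hv]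
  · by_cases heC : e ∈ C
    swap
    · have hne : ∀ t ∈ C, t ≠ e := fun t ht h' ↦ heC (h' ▸ ht)
      have := hF₀.connected (W := W) hC (fun t ht ↦ by
        have := hW t ht
        rwa [rne (hne t ht), ← r0ne (hne t ht)] at this) (by
        obtain ⟨t, ht, htW⟩ := hex
        rw [rne (hne t ht), ← r0ne (hne t ht)] at htW
        exact ⟨t, ht, htW⟩)
      intro t ht
      rw [rne (hne t ht), ← r0ne (hne t ht)]
      exact this t ht
    -- If `W` does not distinguish `x` from `y`, then the link and the loop have the same position
    -- relative to `W`. Otherwise the preimage of `W` or its complement splits the circuit.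
    by_cases hxyW : x ∈ W ↔ y ∈ W
    · have hiff : ∀ t, (identify y z '' ends (subst e b t) ⊆ W ↔ rollEnds ends e x y z t ⊆ W) ∧
          (Disjoint (identify y z '' ends (subst e b t)) W ↔
            Disjoint (rollEnds ends e x y z t) W) := by
        intro t
        by_cases hte : t = e
        · rw [hte, r0e, re]
          simp only [Set.insert_subset_iff, Set.singleton_subset_iff, Set.disjoint_insert_left,
            Set.disjoint_singleton_left]
          tauto
        · rw [r0ne hte, rne hte]
          exact ⟨Iff.rfl, Iff.rfl⟩
      have := hF₀.connected (W := W) hC (fun t ht ↦ by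
        rw [(hiff t).1, (hiff t).2]
        exact hW t ht) (by
        obtain ⟨t, ht, htW⟩ := hex
        exact ⟨t, ht, (hiff t).1.2 htW⟩)
      exact fun t ht ↦ (hiff t).1.1 (this t ht)
    · exfalso
      have hQ : ∀ q ∈ C, q ≠ e → ends q ⊆ identify y z ⁻¹' W ∨
          Disjoint (ends q) (identify y z ⁻¹' W) := by
        intro q hq hqe
        have := hW q hq
        rwa [rne hqe, Set.image_subset_iff, Set.disjoint_image_left] at this
      by_cases hxW : x ∈ W
      · have hyW : y ∉ W := fun h' ↦ hxyW ⟨fun _ ↦ h', fun _ ↦ hxW⟩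
        exact h.not_split hF hxy hxz ha hb hx hC heC (S := identify y z ⁻¹' W)
          (by rwa [Set.mem_preimage, identify_of_ne hxz])
          (by rwa [Set.mem_preimage, identify_left])
          (by rwa [Set.mem_preimage, identify_right]) hQ
      · have hyW : y ∈ W := by
          by_contra h'
          exact hxyW ⟨fun h'' ↦ (hxW h'').elim, fun h'' ↦ (h' h'').elim⟩
        refine h.not_split hF hxy hxz ha hb hx hC heC (S := (identify y z ⁻¹' W)ᶜ)
          (by rwa [Set.mem_compl_iff, Set.mem_preimage, identify_of_ne hxz])
          (by rwa [Set.notMem_compl_iff, Set.mem_preimage, identify_left])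
          (by rwa [Set.notMem_compl_iff, Set.mem_preimage, identify_right])
          fun q hq hqe ↦ (hQ q hq hqe).symm.imp Set.subset_compl_iff_disjoint_right.2
            fun h' ↦ Set.disjoint_compl_right_iff_subset.2 h'

end IsTriangleSum

end Matroid

/-! ### The choice of the vertex to roll up to, and the induction over `L`. -/

namespace Matroid

theorem IsFramework.insideCount_le {α V : Type*} {M : Matroid α} {ends : α → Set V}
    (hF : M.IsFramework ends) {A : Set α} (hA : M.Indep A) (W : Set V) :
    insideCount ends A ∅ W ≤ W.ncard := by
  rw [IsTriangleSum.insideCount_empty_right]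
  exact hF.ncard_le (hA.subset fun x hx ↦ hx.1) fun x hx ↦ hx.2

/-- All bases of a set have the same largest tight set. -/
theorem IsFramework.tight_of_isBasis {α V : Type*} [Finite V] {M : Matroid α} [M.Finite]
    {ends : α → Set V} (hF : M.IsFramework ends) {R I I' : Set α} (hI : M.IsBasis I R)
    (hI' : M.IsBasis I' R) {W : Set V} (hW : Tight ends I ∅ W)
    (hmax : ∀ W', Tight ends I ∅ W' → W' ⊆ W) : Tight ends I' ∅ W := by
  -- Each element of `I` inside `W` is spanned by elements of `I'` inside `W`: the members of its
  -- fundamental circuit are spanned by `I`, so by maximality of `W` none crosses its boundary, and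
  -- as the circuit is not separated, all are inside.
  have hle : {x | x ∈ I ∧ ends x ⊆ W}.ncard ≤ {x | x ∈ I' ∧ ends x ⊆ W}.ncard := by
    refine Indep.ncard_le_of_subset_closure (hI.indep.subset fun x hx ↦ hx.1)
      (fun x hx ↦ hI'.indep.subset_ground hx.1) ?_
    rintro t ⟨htI, htW⟩
    have htI' : t ∈ M.closure I' := hI'.subset_closure (hI.subset htI)
    by_cases htm : t ∈ I'
    · exact M.mem_closure_of_mem' ⟨htm, htW⟩ (hI.indep.subset_ground htI)
    have hC := hI'.indep.fundCircuit_isCircuit htI' htm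
    have htC := M.mem_fundCircuit t I'
    have hCI := M.fundCircuit_subset_insert t I'
    set C := M.fundCircuit t I'
    have hind : ∀ x ∈ C, M.Indep {x} ∧ x ∈ M.closure I := by
      intro x hx
      rcases hCI hx with rfl | hx
      · exact ⟨hI.indep.subset (Set.singleton_subset_iff.2 htI), M.mem_closure_of_mem htI⟩
      · exact ⟨hI'.indep.subset (Set.singleton_subset_iff.2 hx), hI.subset_closure (hI'.subset hx)⟩
    have hall := hF.connected hC (W := W) (fun x hx ↦ by
      by_contra! hcon
      refine hcon.1 (hF.ends_subset hI.indep hW hmax (hind x hx).2 (hind x hx).1 ?_)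
      have h1 := Set.ncard_inter_add_ncard_sdiff_eq_ncard (ends x) W
      have h2 := hF.ncard_ends_le x (hC.subset_ground hx)
      have h3 : 0 < (ends x ∩ W).ncard := by
        rw [Set.ncard_pos]
        exact Set.not_disjoint_iff_nonempty_inter.1 hcon.2
      omega) ⟨t, htC, htW⟩
    refine M.closure_subset_closure ?_ (hC.mem_closure_sdiff_singleton_of_mem htC)
    rintro x ⟨hx, hxt⟩
    exact ⟨(hCI hx).resolve_left hxt, hall x hx⟩
  unfold Tight at *
  rw [IsTriangleSum.insideCount_empty_right] at *
  exact hW.trans hle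

namespace IsTriangleSum

variable {α V : Type*} [Finite V] {M M' : Matroid α} [M.Finite] {e a b c : α} {ends : α → Set V}

/-- Extend the two independent sets to bases of `M.E \ {e}`. Both bases have the same largest tight
set, so `x` and `y` would lie in one tight set. But `a` is independent of these bases and has its
ends there, which overfills the set. -/
theorem not_inTight_or (h : M.IsTriangleSum e a b c M') (hF : M'.IsFramework ends) {x y : V}
    (ha : ends a = {x, y}) : ¬ InTight M ends e x ∨ ¬ InTight M ends e y := by
  by_contra! hcon
  obtain ⟨⟨A, W, hA, heA, hW, hxW⟩, A', W', hA', heA', hW', hyW'⟩ := hcon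
  have hM'f := h.finite
  have hR : M.E \ {e} ⊆ M'.E := by
    rw [h.ground_eq]
    exact fun x hx ↦ .inr (.inr (.inr hx))
  have hbasis : ∀ {A W}, M.Indep A → e ∉ A → Tight ends A ∅ W →
      ∃ I, M'.IsBasis I (M.E \ {e}) ∧ Tight ends I ∅ W := by
    intro A W hA heA hW
    obtain ⟨I, hI, hAI⟩ := ((h.indep_iff hA.subset_ground heA).2 hA).subset_isBasis_of_subset
      (X := M.E \ {e}) (Set.subset_sdiff_singleton hA.subset_ground heA) hR
    exact ⟨I, hI, hW.trans (insideCount_mono (M'.set_finite I hI.indep.subset_ground) hAI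
      subset_rfl)⟩
  obtain ⟨I, hI, hIW⟩ := hbasis hA heA hW
  obtain ⟨I', hI', hIW'⟩ := hbasis hA' heA' hW'
  have hIf := M'.set_finite I hI.indep.subset_ground
  have hIf' := M'.set_finite I' hI'.indep.subset_ground
  obtain ⟨X, hX, hXmax⟩ := exists_largest_tight hIf (hF.insideCount_le hI.indep)
  obtain ⟨X', hX', hXmax'⟩ := exists_largest_tight hIf' (hF.insideCount_le hI'.indep)
  have h1 := hF.tight_of_isBasis hI hI' hX hXmax
  have hxX' : x ∈ X' := hXmax' _ h1 (hXmax _ hIW hxW)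
  have hyX' : y ∈ X' := hXmax' _ hIW' hyW'
  have hIi : M.Indep I' := (h.indep_iff (hI'.subset.trans Set.sdiff_subset)
    fun h' ↦ (hI'.subset h').2 rfl).1 hI'.indep
  have haI : a ∉ I' := fun h' ↦ h.notMem_a (hI'.subset h').1
  have h2 := hF.ncard_le (W := X') (A := insert a {t | t ∈ I' ∧ ends t ⊆ X'})
    ((h.indep_insert hIi fun h' ↦ (hI'.subset h').2 rfl).subset
      (Set.insert_subset_insert fun t ht ↦ ht.1)) (by
    rintro t (rfl | ht)
    · rw [ha]
      rintro _ (rfl | rfl)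
      exacts [hxX', hyX']
    · exact ht.2)
  rw [Set.ncard_insert_of_notMem (fun h' ↦ haI h'.1) (hIf'.subset fun t ht ↦ ht.1)] at h2
  unfold Tight at hX'
  rw [insideCount_empty_right] at hX'
  omega

omit [M.Finite] in
theorem indep_singleton_iff (h : M.IsTriangleSum e a b c M') {k : α} (hk : k ∈ M.E) (hke : k ≠ e) :
    M'.Indep {k} ↔ M.Indep {k} :=
  h.indep_iff (Set.singleton_subset_iff.2 hk) hke.symm

omit [M.Finite] in
theorem nontrivial_triangle (h : M.IsTriangleSum e a b c M') : ({a, b, c} : Set α).Nontrivial :=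
  ⟨a, by simp, b, by simp, h.ab⟩

variable {V : Type} [Finite V] {ends : α → Set V} {K : Set α}

/-- After removal of `u`, the element `e` has the ends of `b` other than `u`, and the point is that
there is exactly one. -/
theorem hasFramework_of_joint (h : M.IsTriangleSum e a b c M') (hF : M'.IsFramework ends)
    (hK : K ⊆ M.E) (heK : e ∉ K) (hL : ∀ k ∈ K, M'.Indep {k} ∧ ∃ v, ends k = {v})
    {u : V} (ha : ends a = {u}) : M.HasFramework (insert e K) := by
  have hM'f := h.finite
  refine ⟨V, inferInstance, _, h.isFramework_sdiff hF ha, ?_⟩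
  rintro k (rfl | hk)
  · refine ⟨h.indep_singleton, ?_⟩
    have hns := h.not_subset_of_ends_eq hF ha h.indep_singleton
    rw [subst_self] at hns ⊢
    have hbE : b ∈ M'.E := h.isCircuit_triangle.subset_ground (by simp)
    have h2 := hF.ncard_ends_le b hbE
    rw [← Set.ncard_eq_one]
    have hne : 0 < (ends b \ {u}).ncard := by
      rw [Set.ncard_pos, Set.sdiff_nonempty]
      exact hns
    by_contra hcon
    have h3 : (ends b \ {u}).ncard ≤ (ends b).ncard := Set.ncard_le_ncard Set.sdiff_subset
    -- If `b` kept two ends, neither would be `u`. Since the triangle has no leaf, `c` would then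
    -- have these two ends and `u` as well.
    have hub : u ∉ ends b := fun hub ↦ by
      rw [Set.ncard_sdiff_singleton_of_mem hub] at hcon hne
      omega
    have hT := h.isCircuit_triangle
    have hn := h.nontrivial_triangle
    have huc : u ∈ ends c := by
      obtain ⟨y, hy, hya, huy⟩ := hF.exists_ne hT hn a (by simp) u (by rw [ha]; rfl)
      rcases hy with rfl | rfl | rfl
      exacts [(hya rfl).elim, (hub huy).elim, huy]
    have hbc : ends b ⊆ ends c \ {u} := by
      intro w hw
      obtain ⟨y, hy, hya, hwy⟩ := hF.exists_ne hT hn b (by simp) w hw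
      have hwu : w ≠ u := fun h' ↦ hub (h' ▸ hw)
      rcases hy with rfl | rfl | rfl
      · rw [ha] at hwy
        exact (hwu hwy).elim
      · exact (hya rfl).elim
      · exact ⟨hwy, hwu⟩
    have h4 := Set.ncard_le_ncard hbc
    rw [Set.ncard_sdiff_singleton_of_mem huc] at h4
    have h5 := hF.ncard_ends_le c (h.isCircuit_triangle.subset_ground (by simp))
    omega
  · have hke : k ≠ e := fun h' ↦ heK (h' ▸ hk)
    obtain ⟨hki, v, hv⟩ := hL k hk
    have hki' := (h.indep_singleton_iff (hK hk) hke).1 hki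
    have hns := h.not_subset_of_ends_eq hF ha hki'
    rw [subst_of_ne hke, hv] at hns ⊢
    refine ⟨hki', v, Set.sdiff_singleton_eq_self fun h' ↦ hns ?_⟩
    rw [Set.mem_singleton_iff.1 h']

theorem hasFramework_of_parallel (h : M.IsTriangleSum e a b c M') (hF : M'.IsFramework ends)
    (hK : K ⊆ M.E) (heK : e ∉ K) (hL : ∀ k ∈ K, M'.Indep {k} ∧ ∃ v, ends k = {v})
    {u v : V} (huv : u ≠ v) (ha : ends a = {u, v}) (hb : ends b = {u, v}) :
    M.HasFramework (insert e K) := by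
  refine ⟨V, inferInstance, _, h.isFramework_identify hF huv ha, ?_⟩
  rintro k (rfl | hk)
  · refine ⟨h.indep_singleton, u, ?_⟩
    rw [subst_self, hb, Set.image_pair, identify_left, identify_right, Set.pair_eq_singleton]
  · have hke : k ≠ e := fun h' ↦ heK (h' ▸ hk)
    obtain ⟨hki, w, hw⟩ := hL k hk
    refine ⟨(h.indep_singleton_iff (hK hk) hke).1 hki, identify u v w, ?_⟩
    rw [subst_of_ne hke, hw, Set.image_singleton]

theorem hasFramework_of_triangle (h : M.IsTriangleSum e a b c M') (hF : M'.IsFramework ends)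
    (hK : K ⊆ M.E) (heK : e ∉ K) (hL : ∀ k ∈ K, M'.Indep {k} ∧ ∃ v, ends k = {v})
    {x y z : V} (hxy : x ≠ y) (hxz : x ≠ z) (hyz : y ≠ z) (ha : ends a = {y, z})
    (hb : ends b = {x, y}) (hc : ends c = {x, z}) (hx : ¬ InTight M ends e x) :
    M.HasFramework (insert e K) := by
  refine ⟨V, inferInstance, _, h.isFramework_rollEnds hF hxy hxz hyz ha hb hc hx, ?_⟩
  rintro k (rfl | hk)
  · exact ⟨h.indep_singleton, x, if_pos rfl⟩
  · have hke : k ≠ e := fun h' ↦ heK (h' ▸ hk)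
    obtain ⟨hki, w, hw⟩ := hL k hk
    refine ⟨(h.indep_singleton_iff (hK hk) hke).1 hki, identify y z w, ?_⟩
    rw [rollEnds, if_neg hke, hw, Set.image_singleton]

/-- If one of `a`, `b`, `c` has a single end, contract it as a joint. If two of them are parallel
links, contract one, and the other becomes a loop. Otherwise the absence of leaves in the circuit
`{a, b, c}` makes it a triangle of the graph, and `e` can be rolled up. -/
theorem hasFramework_left (h : M.IsTriangleSum e a b c M') (hK : K ⊆ M.E) (heK : e ∉ K)
    (hM' : M'.HasFramework K) : M.HasFramework (insert e K) := by
  have hM'f := h.finite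
  obtain ⟨V, hV, ends, hF, hL⟩ := hM'
  have hT := h.isCircuit_triangle
  have hn := h.nontrivial_triangle
  have hcard : ∀ t ∈ ({a, b, c} : Set α), (∃ u, ends t = {u}) ∨
      ∃ u v, u ≠ v ∧ ends t = {u, v} := by
    intro t ht
    have h1 := hF.ncard_ends_le t (hT.subset_ground ht)
    have h2 : 0 < (ends t).ncard := by
      rw [Set.ncard_pos]
      exact hF.ends_nonempty (hT.indep_singleton_of_nontrivial hn ht)
    rcases (by omega : (ends t).ncard = 1 ∨ (ends t).ncard = 2) with h3 | h3
    · exact .inl (Set.ncard_eq_one.1 h3)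
    · exact .inr (Set.ncard_eq_two.1 h3)
  rcases hcard a (by simp) with ⟨u, ha⟩ | ⟨x, y, hxy, ha⟩
  · exact h.hasFramework_of_joint hF hK heK hL ha
  rcases hcard b (by simp) with ⟨u, hb⟩ | ⟨x', y', hxy', hb⟩
  · exact h.rotate.hasFramework_of_joint hF hK heK hL hb
  rcases hcard c (by simp) with ⟨u, hc⟩ | ⟨x'', y'', hxy'', hc⟩
  · exact h.rotate.rotate.hasFramework_of_joint hF hK heK hL hc
  by_cases hab : ends a = ends b
  · exact h.hasFramework_of_parallel hF hK heK hL hxy ha (hab ▸ ha)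
  -- the edges form a triangle
  have key : ∀ {x y}, x ≠ y → ends a = {x, y} → x ∈ ends b → M.HasFramework (insert e K) := by
    intro x y hxy ha hxb
    have hyb : y ∉ ends b := by
      intro hyb
      refine hab ?_
      rw [ha]
      refine Set.eq_of_subset_of_ncard_le ?_ ?_ (Set.toFinite _)
      · rintro _ (rfl | rfl)
        exacts [hxb, hyb]
      · rw [Set.ncard_pair hxy, hb, Set.ncard_pair hxy']
    obtain ⟨z, hzx, hbz⟩ : ∃ z, z ≠ x ∧ ends b = {x, z} := by
      rw [hb] at hxb
      rcases hxb with rfl | rfl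
      · exact ⟨y', hxy'.symm, hb⟩
      · exact ⟨x', hxy', by rw [hb, Set.pair_comm]⟩
    have hzy : z ≠ y := by
      rintro rfl
      exact hyb (by rw [hbz]; simp)
    have hyc : y ∈ ends c := by
      obtain ⟨t, ht, hta, hyt⟩ := hF.exists_ne hT hn a (by simp) y (by rw [ha]; simp)
      rcases ht with rfl | rfl | rfl
      exacts [(hta rfl).elim, (hyb hyt).elim, hyt]
    have hzc : z ∈ ends c := by
      obtain ⟨t, ht, htb, hzt⟩ := hF.exists_ne hT hn b (by simp) z (by rw [hbz]; simp)
      rcases ht with rfl | rfl | rfl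
      · rw [ha] at hzt
        rcases hzt with h' | h'
        exacts [(hzx h').elim, (hzy h').elim]
      · exact (htb rfl).elim
      · exact hzt
    have hcz : ends c = {y, z} := by
      refine (Set.eq_of_subset_of_ncard_le ?_ ?_ (Set.toFinite _)).symm
      · rintro _ (rfl | rfl)
        exacts [hyc, hzc]
      · rw [Set.ncard_pair hzy.symm, hc, Set.ncard_pair hxy'']
    -- The loop goes to the end of `a` that lies in no tight set, and the edge opposite to that
    -- vertex is contracted.
    rcases h.not_inTight_or hF ha with hx | hy
    · exact h.rotate.rotate.hasFramework_of_triangle hF hK heK hL hxy hzx.symm hzy.symm hcz ha hbz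
        hx
    · exact h.swap.hasFramework_of_triangle hF hK heK hL hxy.symm hzy.symm hzx.symm hbz
        (by rw [ha, Set.pair_comm]) hcz hy
  obtain ⟨t, ht, hta, hxt⟩ := hF.exists_ne hT hn a (by simp) x (by rw [ha]; simp)
  rcases ht with rfl | rfl | rfl
  · exact (hta rfl).elim
  · exact key hxy ha hxt
  · by_cases hyb : y ∈ ends b
    · exact key hxy.symm (by rw [ha, Set.pair_comm]) hyb
    · obtain ⟨s, hs, hsa, hys⟩ := hF.exists_ne hT hn a (by simp) y (by rw [ha]; simp)
      have hyt : y ∈ ends t := by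
        rcases hs with rfl | rfl | rfl
        exacts [(hsa rfl).elim, (hyb hys).elim, hys]
      have hct : ends t = {x, y} := by
        refine (Set.eq_of_subset_of_ncard_le ?_ ?_ (Set.toFinite _)).symm
        · rintro _ (rfl | rfl)
          exacts [hxt, hyt]
        · rw [Set.ncard_pair hxy, hc, Set.ncard_pair hxy'']
      exact h.rotate.rotate.hasFramework_of_parallel hF hK heK hL hxy hct ha

end IsTriangleSum

/-- A matroid obtained by 2-sums with copies of `U_{2,4}` has a framework if and only if the
original matroid has a framework in which the elements in question are loops. -/
theorem IsU24Sum.hasFramework_iff {α : Type*} {N M : Matroid α} [N.Finite] {L : Set α}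
    (h : N.IsU24Sum L M) : M.Finite ∧ N.E \ L ⊆ M.E ∧ ∀ K ⊆ N.E, Disjoint K L →
      (M.HasFramework K ↔ N.HasFramework (K ∪ L)) := by
  induction h with
  | empty => exact ⟨inferInstance, by simp, fun K _ _ ↦ by rw [Set.union_empty]⟩
  | @step L M U M' e f hM he heL hU hM' ih =>
    obtain ⟨hMf, hNM, ih⟩ := ih
    obtain ⟨a, b, c, hUE, hT⟩ := isTriangleSum_of_isTwoSum hU hM'
    refine ⟨hT.finite, ?_, fun K hK hKL ↦ ?_⟩
    · rintro x ⟨hx, hxL⟩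
      rw [hT.ground_eq]
      exact .inr (.inr (.inr ⟨hNM ⟨hx, fun h' ↦ hxL (.inr h')⟩, fun h' ↦ hxL (.inl h')⟩))
    · rw [Set.disjoint_insert_right] at hKL
      have hKM : K ⊆ M.E := fun x hx ↦ hNM ⟨hK hx, Set.disjoint_left.1 hKL.2 hx⟩
      -- The newest element `e` moves from `L` to the set `K` of prescribed loops; this is why the
      -- induction is over all `K`.
      rw [Set.union_insert, ← Set.insert_union, ← ih (insert e K) (Set.insert_subset he hK)
        (Set.disjoint_insert_left.2 ⟨heL, hKL.2⟩)]
      exact ⟨hT.hasFramework_left hKM hKL.1, hT.hasFramework_right hKM hKL.1⟩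

end Matroid

namespace Graph

/-! ### Paths and cycles -/

namespace PathOn

variable {V E : Type*} {G : Graph V E} {x y z v : V} {W W₁ W₂ : Set V} {P P₁ P₂ : Set E} {e f : E}

theorem left_mem (h : G.PathOn x y W P) : x ∈ W := by
  cases h with
  | nil => rfl
  | cons => exact .inl rfl

theorem right_mem (h : G.PathOn x y W P) : y ∈ W := by
  induction h with
  | nil => rfl
  | cons _ _ _ ih => exact .inr ih

theorem subset_edgeSet (h : G.PathOn x y W P) : P ⊆ G.edgeSet := by
  induction h with
  | nil => simp
  | cons he _ _ ih => exact Set.insert_subset he.edge_mem ih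

theorem mem_of_inc (h : G.PathOn x y W P) (he : e ∈ P) (hv : G.Inc e v) : v ∈ W := by
  induction h with
  | nil => simp at he
  | cons hl hP hx ih =>
    rcases he with rfl | he
    · rcases hv.eq_or_eq_of_isLink hl with rfl | rfl
      · exact .inl rfl
      · exact .inr hP.left_mem
    · exact .inr (ih he)

theorem not_isLoopAt (h : G.PathOn x y W P) (he : e ∈ P) : ¬ G.IsLink e v v := by
  induction h with
  | nil => simp at he
  | cons hl hP hx ih =>
    rcases he with rfl | he
    · intro hv
      rcases hl.eq_and_eq_or_eq_and_eq hv with ⟨rfl, rfl⟩ | ⟨rfl, rfl⟩ <;> exact hx hP.left_mem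
    · exact ih he

theorem finite (h : G.PathOn x y W P) : W.Finite ∧ P.Finite := by
  induction h with
  | nil => simp
  | cons _ _ _ ih => exact ⟨ih.1.insert _, ih.2.insert _⟩

theorem ncard_add_one (h : G.PathOn x y W P) : P.ncard + 1 = W.ncard := by
  induction h with
  | nil => simp
  | cons hl hP hx ih =>
    rw [Set.ncard_insert_of_notMem hx hP.finite.1, Set.ncard_insert_of_notMem _ hP.finite.2, ih]
    exact fun he ↦ hx (hP.mem_of_inc he hl.inc_left)

theorem eq_of_inc_left (h : G.PathOn x y W P) (he : e ∈ P) (hf : f ∈ P) (hex : G.Inc e x)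
    (hfx : G.Inc f x) : e = f := by
  cases h with
  | nil => simp at he
  | cons hl hP hx =>
    rcases he with rfl | he
    · rcases hf with rfl | hf
      · rfl
      · exact (hx (hP.mem_of_inc hf hfx)).elim
    · exact (hx (hP.mem_of_inc he hex)).elim

theorem exists_cons (h : G.PathOn x y W P) (hxy : x ≠ y) : ∃ z e W' P', G.IsLink e x z ∧
    G.PathOn z y W' P' ∧ x ∉ W' ∧ W = insert x W' ∧ P = insert e P' := by
  cases h with
  | nil => exact (hxy rfl).elim
  | cons hl hP hx => exact ⟨_, _, _, _, hl, hP, hx, rfl, rfl⟩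

theorem exists_inc_left (h : G.PathOn x y W P) (hxy : x ≠ y) : ∃ e ∈ P, G.Inc e x := by
  obtain ⟨z, e, W', P', hl, -, -, -, rfl⟩ := h.exists_cons hxy
  exact ⟨e, .inl rfl, hl.inc_left⟩

theorem eq_empty (h : G.PathOn x x W P) : W = {x} ∧ P = ∅ := by
  cases h with
  | nil => exact ⟨rfl, rfl⟩
  | cons hl hP hx => exact (hx hP.right_mem).elim

theorem single (he : G.IsLink e x y) (hxy : x ≠ y) : G.PathOn x y {x, y} {e} := by
  have := cons he (nil he.right_mem) (by simpa using hxy)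
  simpa using this

theorem append (h₁ : G.PathOn x y W₁ P₁) (h₂ : G.PathOn y z W₂ P₂) (h : W₁ ∩ W₂ ⊆ {y}) :
    G.PathOn x z (W₁ ∪ W₂) (P₁ ∪ P₂) := by
  induction h₁ with
  | nil =>
    rw [Set.singleton_union, Set.insert_eq_of_mem h₂.left_mem, Set.empty_union]
    exact h₂
  | cons hl hP hx ih =>
    rw [Set.insert_union, Set.insert_union]
    refine cons hl (ih h₂ fun v hv ↦ h ⟨.inr hv.1, hv.2⟩) ?_
    rintro (h' | h')
    · exact hx h'
    · have := h ⟨.inl rfl, h'⟩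
      rw [Set.mem_singleton_iff] at this
      exact hx (this ▸ hP.right_mem)

theorem reverse (h : G.PathOn x y W P) : G.PathOn y x W P := by
  induction h with
  | nil hx => exact nil hx
  | @cons x y z e W P hl hP hx ih =>
    have hxy : y ≠ x := fun h' ↦ hx (h' ▸ hP.left_mem)
    have := ih.append (single hl.symm hxy) (by
      rintro v ⟨hv, rfl | rfl⟩
      · rfl
      · exact (hx hv).elim)
    have e1 : W ∪ {y, x} = insert x W := by
      ext v
      simp only [Set.mem_union, Set.mem_insert_iff, Set.mem_singleton_iff]
      constructor
      · rintro (h1 | rfl | rfl)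
        exacts [.inr h1, .inr hP.left_mem, .inl rfl]
      · rintro (rfl | h1)
        exacts [.inr (.inr rfl), .inl h1]
    rwa [e1, Set.union_singleton] at this

theorem exists_inc_right (h : G.PathOn x y W P) (hxy : x ≠ y) : ∃ e ∈ P, G.Inc e y :=
  h.reverse.exists_inc_left hxy.symm

/-- A common edge would have both ends at `v`, and paths contain no loops. -/
theorem disjoint_of_inter_subset (h₁ : G.PathOn x y W₁ P₁) {Q : Set E} {U : Set V}
    (hQ : ∀ e ∈ Q, ∀ v, G.Inc e v → v ∈ U) (h : W₁ ∩ U ⊆ {v}) : Disjoint P₁ Q := by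
  rw [Set.disjoint_left]
  intro e he heQ
  obtain ⟨a, b, hab⟩ := Graph.exists_isLink_of_mem_edgeSet (h₁.subset_edgeSet he)
  have ha : a = v := h ⟨h₁.mem_of_inc he hab.inc_left, hQ e heQ a hab.inc_left⟩
  have hb : b = v := h ⟨h₁.mem_of_inc he hab.inc_right, hQ e heQ b hab.inc_right⟩
  exact h₁.not_isLoopAt he (ha ▸ hb ▸ hab)

theorem exists_split (h : G.PathOn x y W P) (hv : v ∈ W) : ∃ W₁ P₁ W₂ P₂,
    G.PathOn x v W₁ P₁ ∧ G.PathOn v y W₂ P₂ ∧ W₁ ∩ W₂ = {v} ∧ W₁ ∪ W₂ = W ∧ P₁ ∪ P₂ = P ∧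
      Disjoint P₁ P₂ := by
  induction h with
  | @nil x hx =>
    obtain rfl : v = x := hv
    exact ⟨{v}, ∅, {v}, ∅, nil hx, nil hx, by simp, by simp, by simp, by simp⟩
  | @cons x y z e W P hl hP hx ih =>
    by_cases hvx : v = x
    · subst hvx
      exact ⟨{v}, ∅, _, _, nil hl.left_mem, cons hl hP hx, by simp, by simp, by simp, by simp⟩
    · have hvW : v ∈ W := hv.resolve_left hvx
      obtain ⟨W₁, P₁, W₂, P₂, h1, h2, h3, h4, h5, h6⟩ := ih hvW
      have hx1 : x ∉ W₁ := fun h' ↦ hx (h4 ▸ .inl h')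
      have hx2 : x ∉ W₂ := fun h' ↦ hx (h4 ▸ .inr h')
      refine ⟨_, _, W₂, P₂, cons hl h1 hx1, h2, ?_, ?_, ?_, ?_⟩
      · rw [Set.insert_inter_of_notMem hx2, h3]
      · rw [Set.insert_union, h4]
      · rw [Set.insert_union, h5]
      · rw [Set.disjoint_insert_left]
        exact ⟨fun he ↦ hx2 (h2.mem_of_inc he hl.inc_left), h6⟩

/-- At each inner vertex of a path there are two edges of the path. -/
theorem exists_ne (h : G.PathOn x y W P) (he : e ∈ P) (hv : G.Inc e v) (hx : v ≠ x) (hy : v ≠ y) :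
    ∃ f ∈ P, f ≠ e ∧ G.Inc f v := by
  obtain ⟨W₁, P₁, W₂, P₂, h1, h2, -, -, h5, h6⟩ := h.exists_split (h.mem_of_inc he hv)
  obtain ⟨f₁, hf₁, hi₁⟩ := h1.exists_inc_right hx.symm
  obtain ⟨f₂, hf₂, hi₂⟩ := h2.exists_inc_left hy
  have hne : f₁ ≠ f₂ := fun h' ↦ Set.disjoint_left.1 h6 hf₁ (h' ▸ hf₂)
  by_cases hf : f₁ = e
  · exact ⟨f₂, h5 ▸ .inr hf₂, fun h' ↦ hne (hf.trans h'.symm), hi₂⟩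
  · exact ⟨f₁, h5 ▸ .inl hf₁, hf, hi₁⟩

/-- A set with no leaf at an inner vertex of a path contains all or none of the edges. -/
theorem subset_or_disjoint (h : G.PathOn x y W P) {C : Set E}
    (hC : ∀ c ∈ C, c ∈ P → ∀ v, v ≠ x → v ≠ y → G.Inc c v → ∃ d ∈ C, d ∈ P ∧ d ≠ c ∧ G.Inc d v) :
    P ⊆ C ∨ Disjoint P C := by
  induction h with
  | nil => simp
  | @cons x y z e W P hl hP hx ih =>
    have hnx : ∀ c ∈ P, ¬ G.Inc c x := fun c hc hcx ↦ hx (hP.mem_of_inc hc hcx)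
    have heP : e ∉ P := fun he ↦ hnx e he hl.inc_left
    have ih' := ih fun c hcC hcP v hvy hvz hcv ↦ by
      have hvx : v ≠ x := fun h' ↦ hnx c hcP (h' ▸ hcv)
      obtain ⟨d, hdC, hdP, hdc, hdv⟩ := hC c hcC (.inr hcP) v hvx hvz hcv
      refine ⟨d, hdC, hdP.resolve_left ?_, hdc, hdv⟩
      rintro rfl
      exact (hdv.eq_or_eq_of_isLink hl).elim hvx hvy
    by_cases hyz : y = z
    · subst hyz
      rw [hP.eq_empty.2, insert_empty_eq, Set.singleton_subset_iff, Set.disjoint_singleton_left]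
      exact em _
    have hyx : y ≠ x := fun h' ↦ hx (h' ▸ hP.left_mem)
    rcases ih' with ih' | ih'
    · left
      obtain ⟨f, hf, hfy⟩ := hP.exists_inc_left hyz
      obtain ⟨d, hdC, hdP, hdf, hdy⟩ := hC f (ih' hf) (.inr hf) y hyx hyz hfy
      rcases hdP with rfl | hdP
      · exact Set.insert_subset hdC ih'
      · exact (hdf (hP.eq_of_inc_left hdP hf hdy hfy)).elim
    · right
      rw [Set.disjoint_insert_left]
      refine ⟨fun heC ↦ ?_, ih'⟩
      obtain ⟨d, hdC, hdP, hde, hdy⟩ := hC e heC (.inl rfl) y hyx hyz hl.inc_right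
      exact Set.disjoint_left.1 ih' (hdP.resolve_left hde) hdC

/-- The vertex set of a path is not separated by a set. -/
theorem mem_of_mem (h : G.PathOn x y W P) {S : Set V}
    (hS : ∀ e ∈ P, (∀ v, G.Inc e v → v ∈ S) ∨ ∀ v, G.Inc e v → v ∉ S) {u w : V} (hu : u ∈ W)
    (hw : w ∈ W) (huS : u ∈ S) : w ∈ S := by
  have key : ∀ v ∈ W, v ∈ S ↔ x ∈ S := by
    clear hu hw huS
    induction h with
    | nil =>
      rintro v rfl
      rfl
    | cons hl hP hx ih =>
      rintro v (rfl | hv)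
      · rfl
      · rw [ih (fun e he ↦ hS e (.inr he)) v hv]
        rcases hS _ (.inl rfl) with h' | h'
        · exact iff_of_true (h' _ hl.inc_right) (h' _ hl.inc_left)
        · exact iff_of_false (h' _ hl.inc_right) (h' _ hl.inc_left)
  exact (key w hw).2 ((key u hu).1 huS)

end PathOn

namespace CycleOn

variable {V E : Type*} {G : Graph V E} {t u v w : V} {W : Set V} {C : Set E} {e f : E}

theorem of_loop (he : G.IsLink e v v) : G.CycleOn {v} {e} :=
  ⟨v, v, e, ∅, .nil he.left_mem, he, by simp, by simp⟩

theorem subset_edgeSet (h : G.CycleOn W C) : C ⊆ G.edgeSet := by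
  obtain ⟨x, y, e, P, hP, he, -, rfl⟩ := h
  exact Set.insert_subset he.edge_mem hP.subset_edgeSet

theorem mem_of_inc (h : G.CycleOn W C) (he : e ∈ C) (hv : G.Inc e v) : v ∈ W := by
  obtain ⟨x, y, f, P, hP, hf, -, rfl⟩ := h
  rcases he with rfl | he
  · rcases hv.eq_or_eq_of_isLink hf with rfl | rfl
    exacts [hP.left_mem, hP.right_mem]
  · exact hP.mem_of_inc he hv

theorem finite (h : G.CycleOn W C) : W.Finite ∧ C.Finite := by
  obtain ⟨x, y, f, P, hP, hf, -, rfl⟩ := h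
  exact ⟨hP.finite.1, hP.finite.2.insert _⟩

theorem ncard_eq (h : G.CycleOn W C) : C.ncard = W.ncard := by
  obtain ⟨x, y, f, P, hP, hf, hfP, rfl⟩ := h
  rw [Set.ncard_insert_of_notMem hfP hP.finite.2, hP.ncard_add_one]

theorem nonempty (h : G.CycleOn W C) : C.Nonempty := by
  obtain ⟨x, y, f, P, hP, hf, hfP, rfl⟩ := h
  exact ⟨f, .inl rfl⟩

/-- A cycle can be started at each of its vertices. -/
theorem exists_pathOn (h : G.CycleOn W C) (ht : t ∈ W) : ∃ y e P, G.PathOn t y W P ∧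
    G.IsLink e t y ∧ e ∉ P ∧ C = insert e P := by
  obtain ⟨x, y, e, P, hP, he, heP, rfl⟩ := h
  by_cases hty : t = y
  · subst hty
    exact ⟨x, e, P, hP.reverse, he.symm, heP, rfl⟩
  -- Cut the path at `t`. The edge `f` that leaves `t` towards `y` becomes the closing edge, and `e`
  -- joins the two remaining pieces.
  obtain ⟨W₁, P₁, W₂, P₂, h1, h2, h3, rfl, rfl, h6⟩ := hP.exists_split ht
  obtain ⟨z, f, W', P', hf, hP', htW, rfl, rfl⟩ := h2.exists_cons hty
  have hd : ∀ v ∈ W₁, v ∉ W' := by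
    intro v hv hv'
    have : v ∈ ({t} : Set V) := h3 ▸ ⟨hv, .inr hv'⟩
    exact htW (this ▸ hv')
  have h4 := h1.reverse.append (.cons he hP'.reverse (hd x h1.left_mem)) (by
    rintro v ⟨hv, rfl | hv'⟩
    · rfl
    · exact (hd v hv hv').elim)
  refine ⟨z, f, P₁ ∪ insert e P', ?_, hf, ?_, ?_⟩
  · convert h4 using 1
    ext v
    have := h1.left_mem
    have := h1.right_mem
    simp only [Set.mem_union, Set.mem_insert_iff]
    constructor
    · rintro (h' | rfl | h') <;> tauto
    · rintro (h' | rfl | h') <;> tauto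
  · rintro (h' | rfl | h')
    · exact Set.disjoint_left.1 h6 h' (.inl rfl)
    · exact heP (.inr (.inl rfl))
    · exact htW (hP'.mem_of_inc h' hf.inc_left)
  · ext x
    simp only [Set.mem_union, Set.mem_insert_iff]
    tauto

/-- Two vertices split a cycle into two paths. -/
theorem exists_pathOn_pathOn (h : G.CycleOn W C) (ht : t ∈ W) (hu : u ∈ W) (htu : t ≠ u) :
    ∃ W₁ P₁ W₂ P₂, G.PathOn t u W₁ P₁ ∧ G.PathOn t u W₂ P₂ ∧ W₁ ∩ W₂ = {t, u} ∧ W₁ ∪ W₂ = W ∧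
      P₁ ∪ P₂ = C ∧ Disjoint P₁ P₂ := by
  obtain ⟨y, e, P, hP, he, heP, rfl⟩ := h.exists_pathOn ht
  obtain ⟨W₁, P₁, W₂, P₂, h1, h2, h3, rfl, rfl, h6⟩ := hP.exists_split hu
  have htW : t ∉ W₂ := by
    intro h'
    have : t ∈ ({u} : Set V) := h3 ▸ ⟨h1.left_mem, h'⟩
    exact htu this
  refine ⟨W₁, P₁, _, _, h1, .cons he h2.reverse htW, ?_, ?_, ?_, ?_⟩
  · rw [Set.inter_insert_of_mem h1.left_mem, h3]
  · rw [Set.union_insert, Set.insert_eq_of_mem (.inl h1.left_mem)]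
  · rw [Set.union_insert]
  · rw [Set.disjoint_insert_right]
    exact ⟨fun h' ↦ heP (.inl h'), h6⟩

theorem exists_inc (h : G.CycleOn W C) (hv : v ∈ W) : ∃ e ∈ C, G.Inc e v := by
  obtain ⟨y, e, P, hP, he, heP, rfl⟩ := h.exists_pathOn hv
  exact ⟨e, .inl rfl, he.inc_left⟩

/-- At each vertex of a cycle with at least two edges there are two edges of the cycle. -/
theorem exists_ne (h : G.CycleOn W C) (hn : C.Nontrivial) (he : e ∈ C) (hv : G.Inc e v) :
    ∃ f ∈ C, f ≠ e ∧ G.Inc f v := by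
  obtain ⟨y, f, P, hP, hf, hfP, rfl⟩ := h.exists_pathOn (h.mem_of_inc he hv)
  have hvy : v ≠ y := by
    rintro rfl
    rw [hP.eq_empty.2] at hn
    simp at hn
  obtain ⟨g, hg, hgv⟩ := hP.exists_inc_left hvy
  have hfg : f ≠ g := fun h' ↦ hfP (h' ▸ hg)
  by_cases hef : f = e
  · exact ⟨g, .inr hg, fun h' ↦ hfg (hef.trans h'.symm), hgv⟩
  · exact ⟨f, .inl rfl, hef, hf.inc_left⟩

theorem eq_singleton_of_isLink (h : G.CycleOn W C) (he : e ∈ C) (hv : G.IsLink e v v) :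
    C = {e} := by
  obtain ⟨x, y, f, P, hP, hf, hfP, rfl⟩ := h
  rcases he with rfl | he
  · have hxy : x = y := by
      rcases hf.eq_and_eq_or_eq_and_eq hv with ⟨rfl, rfl⟩ | ⟨rfl, rfl⟩ <;> rfl
    subst hxy
    simp [hP.eq_empty.2]
  · exact (hP.not_isLoopAt he hv).elim

/-- A set with no leaf at a vertex of a cycle other than `v` contains all or none of the edges. -/
theorem subset_or_disjoint (h : G.CycleOn W C) (hv : v ∈ W) {D : Set E}
    (hD : ∀ c ∈ D, c ∈ C → ∀ w, w ≠ v → G.Inc c w → ∃ d ∈ D, d ∈ C ∧ d ≠ c ∧ G.Inc d w) :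
    C ⊆ D ∨ Disjoint C D := by
  obtain ⟨y, e, P, hP, he, heP, rfl⟩ := h.exists_pathOn hv
  by_cases hvy : v = y
  · subst hvy
    rw [hP.eq_empty.2, insert_empty_eq, Set.singleton_subset_iff, Set.disjoint_singleton_left]
    exact em _
  have hPD := hP.subset_or_disjoint (C := D) fun c hcD hcP w hwv hwy hcw ↦ by
    obtain ⟨d, hdD, hdC, hdc, hdw⟩ := hD c hcD (.inr hcP) w hwv hcw
    refine ⟨d, hdD, hdC.resolve_left ?_, hdc, hdw⟩
    rintro rfl
    exact (hdw.eq_or_eq_of_isLink he).elim hwv hwy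
  rcases hPD with hPD | hPD
  · left
    obtain ⟨f, hf, hfy⟩ := hP.exists_inc_right hvy
    obtain ⟨d, hdD, hdC, hdf, hdy⟩ := hD f (hPD hf) (.inr hf) y (Ne.symm hvy) hfy
    rcases hdC with rfl | hdC
    · exact Set.insert_subset hdD hPD
    · exact (hdf (hP.reverse.eq_of_inc_left hdC hf hdy hfy)).elim
  · right
    rw [Set.disjoint_insert_left]
    refine ⟨fun heD ↦ ?_, hPD⟩
    obtain ⟨d, hdD, hdC, hde, hdy⟩ := hD e heD (.inl rfl) y (Ne.symm hvy) he.inc_right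
    exact Set.disjoint_left.1 hPD (hdC.resolve_left hde) hdD

theorem mem_of_mem (h : G.CycleOn W C) {S : Set V}
    (hS : ∀ e ∈ C, (∀ v, G.Inc e v → v ∈ S) ∨ ∀ v, G.Inc e v → v ∉ S) {u w : V} (hu : u ∈ W)
    (hw : w ∈ W) (huS : u ∈ S) : w ∈ S := by
  obtain ⟨x, y, f, P, hP, hf, hfP, rfl⟩ := h
  exact hP.mem_of_mem (fun e he ↦ hS e (.inr he)) hu hw huS

end CycleOn

end Graph

namespace Graph

/-! ### Thetas and handcuffs -/

/-- No vertex is an end of exactly one edge of `X`. -/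
def NoLeaf {V E : Type*} (G : Graph V E) (X : Set E) : Prop :=
  ∀ x ∈ X, ∀ v, G.Inc x v → ∃ y ∈ X, y ≠ x ∧ G.Inc y v

/-- The edges in `X` are not separated by a set of vertices. -/
def IsConn {V E : Type*} (G : Graph V E) (X : Set E) : Prop :=
  ∀ S : Set V, (∀ x ∈ X, (∀ v, G.Inc x v → v ∈ S) ∨ ∀ v, G.Inc x v → v ∉ S) →
    (∃ x ∈ X, ∃ v ∈ S, G.Inc x v) → ∀ x ∈ X, ∀ v, G.Inc x v → v ∈ S

/-- `D` is the edge set of a theta subgraph or of tight or loose handcuffs, and `𝒞` consists of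
the edge sets of its cycles. -/
inductive IsBicycle {V E : Type*} (G : Graph V E) : Set (Set E) → Set E → Prop
  | theta {P₁ P₂ P₃ : Set E} (h : G.IsTheta P₁ P₂ P₃) :
      G.IsBicycle {P₁ ∪ P₂, P₁ ∪ P₃, P₂ ∪ P₃} (P₁ ∪ P₂ ∪ P₃)
  | tight {W₁ W₂ : Set V} {C₁ C₂ : Set E} {v : V} (h₁ : G.CycleOn W₁ C₁) (h₂ : G.CycleOn W₂ C₂)
      (hd : Disjoint C₁ C₂) (hv : W₁ ∩ W₂ = {v}) : G.IsBicycle {C₁, C₂} (C₁ ∪ C₂)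
  | loose {W₁ W₂ W : Set V} {C₁ C₂ P : Set E} {x y : V} (h₁ : G.CycleOn W₁ C₁)
      (h₂ : G.CycleOn W₂ C₂) (hd : Disjoint W₁ W₂) (hP : G.PathOn x y W P) (hx : W ∩ W₁ = {x})
      (hy : W ∩ W₂ = {y}) : G.IsBicycle {C₁, C₂} (C₁ ∪ C₂ ∪ P)

variable {V E : Type*} {G : Graph V E} {X : Set E} {T : Set V} {t : V}

/-- A path of `X` that joins `t` to another vertex of `T`, or a cycle of `X` that is attached
to `t` directly or by a path. -/
def HasAttachment (G : Graph V E) (X : Set E) (T : Set V) (t : V) : Prop :=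
  (∃ y W P, G.PathOn y t W P ∧ P ⊆ X ∧ y ≠ t ∧ W ∩ T = {y, t}) ∨
  (∃ W C, G.CycleOn W C ∧ C ⊆ X ∧ W ∩ T = {t}) ∨
  ∃ y W P W' C, G.PathOn y t W P ∧ P ⊆ X ∧ W ∩ T = {t} ∧ G.CycleOn W' C ∧ C ⊆ X ∧
    Disjoint W' T ∧ W ∩ W' = {y}

/-- Extend the path at its end `y` by a second edge there. Its other end is on the path, which
closes a cycle, or it is in `T`, or it is a new vertex outside `T`. The last case can recur only
finitely often, whence the induction on the number of vertices off the path. -/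
theorem hasAttachment_of_pathOn (hV : G.vertexSet.Finite)
    (hX : ∀ x ∈ X, ∀ v, G.Inc x v → v ∉ T → ∃ y ∈ X, y ≠ x ∧ G.Inc y v) {n : ℕ} :
    ∀ {y : V} {W : Set V} {P : Set E}, G.PathOn y t W P → P ⊆ X → y ∉ T → W ∩ T = {t} →
      (G.vertexSet \ W).ncard = n → G.HasAttachment X T t := by
  induction n using Nat.strong_induction_on with
  | _ n ih =>
  intro y W P hP hPX hyT hWT hn
  have htT : t ∈ W ∩ T := hWT ▸ rfl
  have hyt : y ≠ t := fun h ↦ hyT (h ▸ htT.2)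
  obtain ⟨e, he, hey⟩ := hP.exists_inc_left hyt
  obtain ⟨f, hf, hfe, z, hfz⟩ := hX e (hPX he) y hey hyT
  have hfP : f ∉ P := fun h ↦ hfe (hP.eq_of_inc_left h he hfz.inc_left hey)
  by_cases hzy : z = y
  · subst hzy
    refine .inr (.inr ⟨z, W, P, {z}, {f}, hP, hPX, hWT, .of_loop hfz, by simpa using hf,
      by simpa using hyT, ?_⟩)
    rw [Set.inter_singleton_of_mem hP.left_mem]
  by_cases hzW : z ∈ W
  · obtain ⟨W₁, P₁, W₂, P₂, h1, h2, h3, rfl, rfl, h6⟩ := hP.exists_split hzW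
    have hcyc : G.CycleOn W₁ (insert f P₁) :=
      ⟨y, z, f, P₁, h1, hfz, fun h ↦ hfP (.inl h), rfl⟩
    have hcX : insert f P₁ ⊆ X := Set.insert_subset hf (Set.subset_union_left.trans hPX)
    by_cases hzt : z = t
    · subst hzt
      refine .inr (.inl ⟨W₁, _, hcyc, hcX, subset_antisymm ?_ ?_⟩)
      · rw [← hWT]
        exact Set.inter_subset_inter_left _ Set.subset_union_left
      · rintro _ rfl
        exact ⟨h1.right_mem, htT.2⟩
    · refine .inr (.inr ⟨z, W₂, P₂, W₁, _, h2, Set.subset_union_right.trans hPX, ?_, hcyc, hcX, ?_,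
        by rw [Set.inter_comm, h3]⟩)
      · refine subset_antisymm ?_ ?_
        · rw [← hWT]
          exact Set.inter_subset_inter_left _ Set.subset_union_right
        · rintro _ rfl
          exact ⟨h2.right_mem, htT.2⟩
      · rw [Set.disjoint_left]
        intro v hv hvT
        obtain rfl : v = t := by
          have : v ∈ ({t} : Set V) := hWT ▸ ⟨.inl hv, hvT⟩
          exact this
        have : v ∈ ({z} : Set V) := h3 ▸ ⟨hv, h2.right_mem⟩
        exact hzt this.symm
  have hP' : G.PathOn z t (insert z W) (insert f P) := .cons hfz.symm hP hzW
  by_cases hzT : z ∈ T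
  · refine .inl ⟨z, _, _, hP', Set.insert_subset hf hPX, fun h ↦ hzW (h ▸ htT.1), ?_⟩
    rw [Set.insert_inter_of_mem hzT, hWT]
  · refine ih _ ?_ hP' (Set.insert_subset hf hPX) hzT ?_ rfl
    · rw [← hn]
      refine Set.ncard_lt_ncard ⟨Set.sdiff_subset_sdiff_right (Set.subset_insert _ _), fun h ↦ ?_⟩
        (hV.subset Set.sdiff_subset)
      exact (h ⟨hfz.right_mem, hzW⟩).2 (.inl rfl)
    · rw [Set.insert_inter_of_notMem hzT, hWT]

theorem hasAttachment (hV : G.vertexSet.Finite)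
    (hX : ∀ x ∈ X, ∀ v, G.Inc x v → v ∉ T → ∃ y ∈ X, y ≠ x ∧ G.Inc y v) (ht : t ∈ T)
    {f : E} (hf : f ∈ X) (hft : G.Inc f t) : G.HasAttachment X T t := by
  obtain ⟨y, hfy⟩ := hft
  by_cases hyt : y = t
  · subst hyt
    exact .inr (.inl ⟨{y}, {f}, .of_loop hfy, by simpa using hf, by simpa using ht⟩)
  have hP := PathOn.single hfy.symm hyt
  by_cases hyT : y ∈ T
  · refine .inl ⟨y, _, _, hP, by simpa using hf, hyt, Set.inter_eq_left.2 ?_⟩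
    rintro _ (rfl | rfl) <;> assumption
  · refine hasAttachment_of_pathOn hV hX hP (by simpa using hf) hyT ?_ rfl
    rw [Set.insert_inter_of_notMem hyT]
    simpa using ht

theorem exists_cycleOn (hV : G.vertexSet.Finite) (hX : G.NoLeaf X) {f : E} (hf : f ∈ X)
    {v : V} (hfv : G.Inc f v) : ∃ W C, G.CycleOn W C ∧ C ⊆ X := by
  -- With only one vertex in `T`, no path can join `v` to another vertex of `T`, so an attachment
  -- supplies a cycle.
  rcases hasAttachment (T := {v}) hV (fun x hx u hu _ ↦ hX x hx u hu) rfl hf hfv with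
    ⟨y, W, P, hP, -, hyt, hWT⟩ | ⟨W, C, hC, hCX, -⟩ | ⟨_, _, _, W, C, -, -, -, hC, hCX, -⟩
  · have : y ∈ W ∩ {v} := hWT ▸ .inl rfl
    exact (hyt this.2).elim
  · exact ⟨W, C, hC, hCX⟩
  · exact ⟨W, C, hC, hCX⟩

/-- A connected set of edges without leaves is a cycle or contains a theta or handcuffs. -/
theorem exists_isBicycle (hV : G.vertexSet.Finite) (hXE : X ⊆ G.edgeSet) (hne : X.Nonempty)
    (hX : G.NoLeaf X) (hc : G.IsConn X) :
    (∃ W, G.CycleOn W X) ∨ ∃ 𝒞 D, G.IsBicycle 𝒞 D ∧ D ⊆ X := by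
  obtain ⟨f₀, hf₀⟩ := hne
  obtain ⟨a, b, hab⟩ := exists_isLink_of_mem_edgeSet (hXE hf₀)
  obtain ⟨T, Z, hZ, hZX⟩ := exists_cycleOn hV hX hf₀ hab.inc_left
  by_cases hZX' : X ⊆ Z
  · exact .inl ⟨T, hZX.antisymm hZX' ▸ hZ⟩
  right
  obtain ⟨g, hg, hgZ⟩ := Set.not_subset.1 hZX'
  -- If no edge off the cycle `Z` met its vertex set `T`, then `T` would separate `Z` from `g`.
  obtain ⟨f, hf, hfZ, t, htT, hft⟩ : ∃ f ∈ X, f ∉ Z ∧ ∃ t ∈ T, G.Inc f t := by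
    by_contra! hcon
    have hall := hc T (fun x hx ↦ by
      by_cases hxZ : x ∈ Z
      · exact .inl fun v hv ↦ hZ.mem_of_inc hxZ hv
      · exact .inr fun v hv hvT ↦ hcon x hx hxZ v hvT hv) (by
      obtain ⟨z, hz⟩ := hZ.nonempty
      obtain ⟨a, b, hab⟩ := exists_isLink_of_mem_edgeSet (hXE (hZX hz))
      exact ⟨z, hZX hz, a, hZ.mem_of_inc hz hab.inc_left, hab.inc_left⟩) g hg
    obtain ⟨a, b, hab⟩ := exists_isLink_of_mem_edgeSet (hXE hg)
    exact hcon g hg hgZ a (hall a hab.inc_left) hab.inc_left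
  have hX' : ∀ x ∈ X \ Z, ∀ v, G.Inc x v → v ∉ T → ∃ y ∈ X \ Z, y ≠ x ∧ G.Inc y v := by
    intro x hx v hxv hvT
    obtain ⟨y, hy, hyx, hyv⟩ := hX x hx.1 v hxv
    exact ⟨y, ⟨hy, fun hyZ ↦ hvT (hZ.mem_of_inc hyZ hyv)⟩, hyx, hyv⟩
  -- The three kinds of attachment to the cycle give a theta, tight handcuffs and loose handcuffs.
  rcases hasAttachment hV hX' htT ⟨hf, hfZ⟩ hft with
    ⟨y, W, P, hP, hPX, hyt, hWT⟩ | ⟨W, C, hC, hCX, hWT⟩ |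
    ⟨y, W, P, W', C, hP, hPX, hWT, hC, hCX, hd, hWW⟩
  · have hyT : y ∈ W ∩ T := hWT ▸ .inl rfl
    obtain ⟨W₁, P₁, W₂, P₂, h1, h2, h3, rfl, rfl, h6⟩ := hZ.exists_pathOn_pathOn hyT.2 htT hyt
    refine ⟨_, _, .theta ⟨y, t, W₁, W₂, W, hyt, h1, h2, hP, h3, ?_, ?_, h6, ?_, ?_⟩,
      Set.union_subset hZX (hPX.trans Set.sdiff_subset)⟩
    · refine subset_antisymm ?_ ?_
      · rw [← hWT, Set.inter_comm]
        exact Set.inter_subset_inter_right _ Set.subset_union_left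
      · rintro _ (rfl | rfl)
        exacts [⟨h1.left_mem, hP.left_mem⟩, ⟨h1.right_mem, hP.right_mem⟩]
    · refine subset_antisymm ?_ ?_
      · rw [← hWT, Set.inter_comm]
        exact Set.inter_subset_inter_right _ Set.subset_union_right
      · rintro _ (rfl | rfl)
        exacts [⟨h2.left_mem, hP.left_mem⟩, ⟨h2.right_mem, hP.right_mem⟩]
    · exact Set.disjoint_left.2 fun e he heP ↦ (hPX heP).2 (.inl he)
    · exact Set.disjoint_left.2 fun e he heP ↦ (hPX heP).2 (.inr he)
  · exact ⟨_, _, .tight hZ hC (Set.disjoint_left.2 fun e he heC ↦ (hCX heC).2 he)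
      (by rw [Set.inter_comm, hWT]), Set.union_subset hZX (hCX.trans Set.sdiff_subset)⟩
  · exact ⟨_, _, .loose hC hZ hd hP hWW hWT, Set.union_subset (Set.union_subset
      (hCX.trans Set.sdiff_subset) hZX) (hPX.trans Set.sdiff_subset)⟩

theorem CycleOn.noLeaf {W : Set V} {C : Set E} (h : G.CycleOn W C) (hn : C.Nontrivial) :
    G.NoLeaf C := fun _ he _ hv ↦ h.exists_ne hn he hv

theorem CycleOn.isConn {W : Set V} {C : Set E} (h : G.CycleOn W C) : G.IsConn C := by
  rintro S hS ⟨e, he, v, hv, hev⟩ f hf w hw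
  exact h.mem_of_mem hS (h.mem_of_inc he hev) (h.mem_of_inc hf hw) hv

theorem CycleOn.exists_ne_or {W : Set V} {C : Set E} (h : G.CycleOn W C) {e : E} (he : e ∈ C)
    {v : V} (hv : G.Inc e v) : (∃ f ∈ C, f ≠ e ∧ G.Inc f v) ∨ W = {v} := by
  by_cases hn : C.Nontrivial
  · exact .inl (h.exists_ne hn he hv)
  · right
    rw [Set.not_nontrivial_iff] at hn
    have h1 : C = {e} := hn.eq_singleton_of_mem he
    have h2 := h.ncard_eq
    rw [h1, Set.ncard_singleton] at h2
    obtain ⟨w, rfl⟩ := Set.ncard_eq_one.1 h2.symm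
    rw [h.mem_of_inc he hv]

/-- Two internally disjoint paths between two vertices form a cycle. -/
theorem PathOn.cycleOn_union {x y : V} {W₁ W₂ : Set V} {P₁ P₂ : Set E} (h₁ : G.PathOn x y W₁ P₁)
    (h₂ : G.PathOn x y W₂ P₂) (hxy : x ≠ y) (hW : W₁ ∩ W₂ = {x, y}) (hd : Disjoint P₁ P₂) :
    G.CycleOn (W₁ ∪ W₂) (P₁ ∪ P₂) := by
  obtain ⟨z, e, W', P', he, hP', hx, rfl, rfl⟩ := h₂.exists_cons hxy
  rw [Set.disjoint_insert_right] at hd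
  have h3 := hP'.append h₁.reverse (by
    rintro v ⟨hv, hv'⟩
    have : v ∈ ({x, y} : Set V) := hW ▸ ⟨hv', .inr hv⟩
    rcases this with rfl | h'
    exacts [(hx hv).elim, h'])
  refine ⟨z, x, e, P' ∪ P₁, ?_, he.symm, ?_, ?_⟩
  · convert h3 using 1
    rw [Set.union_insert, Set.insert_eq_of_mem (.inl h₁.left_mem), Set.union_comm]
  · rintro (h | h)
    exacts [hx (hP'.mem_of_inc h he.inc_left), hd.1 h]
  · rw [Set.union_insert, Set.union_comm]

end Graph

/-! ### Connected and leafless subsets of thetas and handcuffs. -/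

namespace Graph

variable {V E : Type*} {G : Graph V E} {X Y D P₁ P₂ P₃ : Set E} {𝒞 : Set (Set E)}

theorem NoLeaf.union (hX : G.NoLeaf X) (hY : G.NoLeaf Y) : G.NoLeaf (X ∪ Y) := by
  rintro x (hx | hx) v hv
  · obtain ⟨y, hy, h⟩ := hX x hx v hv
    exact ⟨y, .inl hy, h⟩
  · obtain ⟨y, hy, h⟩ := hY x hx v hv
    exact ⟨y, .inr hy, h⟩

theorem IsConn.union (hX : G.IsConn X) (hY : G.IsConn Y) {v : V} (hvX : ∃ x ∈ X, G.Inc x v)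
    (hvY : ∃ y ∈ Y, G.Inc y v) : G.IsConn (X ∪ Y) := by
  rintro S hS ⟨e, he, u, hu, heu⟩
  have hX' := hX S fun x hx ↦ hS x (.inl hx)
  have hY' := hY S fun x hx ↦ hS x (.inr hx)
  obtain ⟨a, ha, hav⟩ := hvX
  obtain ⟨b, hb, hbv⟩ := hvY
  have hvS : v ∈ S := by
    rcases he with he | he
    · exact hX' ⟨e, he, u, hu, heu⟩ a ha v hav
    · exact hY' ⟨e, he, u, hu, heu⟩ b hb v hbv
  rintro x (hx | hx)
  · exact hX' ⟨a, ha, v, hvS, hav⟩ x hx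
  · exact hY' ⟨b, hb, v, hvS, hbv⟩ x hx

theorem PathOn.isConn {x y : V} {W : Set V} {P : Set E} (h : G.PathOn x y W P) : G.IsConn P := by
  rintro S hS ⟨e, he, v, hv, hev⟩ f hf w hw
  exact h.mem_of_mem hS (h.mem_of_inc he hev) (h.mem_of_inc hf hw) hv

namespace IsTheta

theorem swap (h : G.IsTheta P₁ P₂ P₃) : G.IsTheta P₂ P₁ P₃ := by
  obtain ⟨x, y, W₁, W₂, W₃, hxy, h1, h2, h3, h12, h13, h23, d12, d13, d23⟩ := h
  exact ⟨x, y, W₂, W₁, W₃, hxy, h2, h1, h3, Set.inter_comm W₁ W₂ ▸ h12, h23, h13, d12.symm, d23, d13⟩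

theorem rotate (h : G.IsTheta P₁ P₂ P₃) : G.IsTheta P₂ P₃ P₁ := by
  obtain ⟨x, y, W₁, W₂, W₃, hxy, h1, h2, h3, h12, h13, h23, d12, d13, d23⟩ := h
  exact ⟨x, y, W₂, W₃, W₁, hxy, h2, h3, h1, h23, Set.inter_comm W₁ W₂ ▸ h12,
    Set.inter_comm W₁ W₃ ▸ h13, d23, d12.symm, d13.symm⟩

theorem exists_cycleOn (h : G.IsTheta P₁ P₂ P₃) : ∃ W, G.CycleOn W (P₁ ∪ P₂) := by
  obtain ⟨x, y, W₁, W₂, W₃, hxy, h1, h2, h3, h12, h13, h23, d12, d13, d23⟩ := h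
  exact ⟨_, h1.cycleOn_union h2 hxy h12 d12⟩

theorem nonempty (h : G.IsTheta P₁ P₂ P₃) : P₁.Nonempty := by
  obtain ⟨x, y, W₁, W₂, W₃, hxy, h1, -⟩ := h
  obtain ⟨e, he, -⟩ := h1.exists_inc_left hxy
  exact ⟨e, he⟩

theorem disjoint (h : G.IsTheta P₁ P₂ P₃) : Disjoint P₁ P₂ := by
  obtain ⟨x, y, W₁, W₂, W₃, hxy, h1, h2, h3, h12, h13, h23, d12, d13, d23⟩ := h
  exact d12

theorem nontrivial (h : G.IsTheta P₁ P₂ P₃) : (P₁ ∪ P₂).Nontrivial := by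
  obtain ⟨e, he⟩ := h.nonempty
  obtain ⟨f, hf⟩ := h.rotate.nonempty
  exact ⟨e, .inl he, f, .inr hf, fun h' ↦ Set.disjoint_left.1 h.disjoint he (h' ▸ hf)⟩

/-- A set of edges of a theta without leaves contains all or none of the edges of each path. -/
theorem subset_or_disjoint (h : G.IsTheta P₁ P₂ P₃) (hX : G.NoLeaf X) (hXD : X ⊆ P₁ ∪ P₂ ∪ P₃) :
    P₁ ⊆ X ∨ Disjoint P₁ X := by
  obtain ⟨x, y, W₁, W₂, W₃, hxy, h1, h2, h3, h12, h13, h23, d12, d13, d23⟩ := h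
  refine h1.subset_or_disjoint fun c hcX hcP v hvx hvy hcv ↦ ?_
  obtain ⟨d, hd, hdc, hdv⟩ := hX c hcX v hcv
  have hv := h1.mem_of_inc hcP hcv
  refine ⟨d, hd, ?_, hdc, hdv⟩
  rcases hXD hd with (h' | h') | h'
  · exact h'
  · have : v ∈ ({x, y} : Set V) := h12 ▸ ⟨hv, h2.mem_of_inc h' hdv⟩
    exact (this.elim hvx hvy).elim
  · have : v ∈ ({x, y} : Set V) := h13 ▸ ⟨hv, h3.mem_of_inc h' hdv⟩
    exact (this.elim hvx hvy).elim

/-- A subset of the edges of one path without leaves would be the whole path or empty, and the end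
of a path is a leaf. -/
theorem not_subset (h : G.IsTheta P₁ P₂ P₃) (hX : G.NoLeaf X) (hne : X.Nonempty) : ¬ X ⊆ P₁ := by
  intro hXP
  have hXD : X ⊆ P₁ ∪ P₂ ∪ P₃ := fun x hx ↦ .inl (.inl (hXP hx))
  rcases h.subset_or_disjoint hX hXD with h' | h'
  · obtain ⟨x, y, W₁, W₂, W₃, hxy, h1, -⟩ := h
    obtain ⟨e, he, hex⟩ := h1.exists_inc_left hxy
    obtain ⟨f, hf, hfe, hfx⟩ := hX e (h' he) x hex
    exact hfe (h1.eq_of_inc_left (hXP hf) he hfx hex)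
  · obtain ⟨e, he⟩ := hne
    exact Set.disjoint_right.1 h' he (hXP he)

theorem eq_union (h : G.IsTheta P₁ P₂ P₃) (hX : G.NoLeaf X) (hne : X.Nonempty)
    (hXP : X ⊆ P₁ ∪ P₂) : X = P₁ ∪ P₂ := by
  have hXD : X ⊆ P₁ ∪ P₂ ∪ P₃ := fun x hx ↦ .inl (hXP hx)
  rcases h.subset_or_disjoint hX hXD with h1 | h1
  · rcases h.swap.subset_or_disjoint hX (Set.union_comm P₁ P₂ ▸ hXD) with h2 | h2
    · exact hXP.antisymm (Set.union_subset h1 h2)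
    · exact (h.not_subset hX hne (h2.symm.subset_left_of_subset_union hXP)).elim
  · exact (h.swap.not_subset hX hne (h1.symm.subset_right_of_subset_union hXP)).elim

end IsTheta

namespace IsBicycle

theorem exists_cycleOn (h : G.IsBicycle 𝒞 D) {C : Set E} (hC : C ∈ 𝒞) :
    (∃ W, G.CycleOn W C) ∧ C ⊆ D := by
  cases h with
  | @theta P₁ P₂ P₃ h =>
    rcases hC with rfl | rfl | rfl
    · exact ⟨h.exists_cycleOn, Set.subset_union_left⟩
    · exact ⟨h.swap.rotate.exists_cycleOn,
        Set.union_subset_union_left _ Set.subset_union_left⟩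
    · exact ⟨h.rotate.exists_cycleOn, Set.union_subset_union_left _ Set.subset_union_right⟩
  | tight h₁ h₂ hd hv =>
    rcases hC with rfl | rfl
    exacts [⟨⟨_, h₁⟩, Set.subset_union_left⟩, ⟨⟨_, h₂⟩, Set.subset_union_right⟩]
  | loose h₁ h₂ hd hP hx hy =>
    rcases hC with rfl | rfl
    · exact ⟨⟨_, h₁⟩, fun e he ↦ .inl (.inl he)⟩
    · exact ⟨⟨_, h₂⟩, fun e he ↦ .inl (.inr he)⟩

/-- A theta and handcuffs have more edges than vertices. -/
theorem exists_ncard_lt (h : G.IsBicycle 𝒞 D) :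
    D ⊆ G.edgeSet ∧ ∃ W : Set V, (∀ e ∈ D, ∀ v, G.Inc e v → v ∈ W) ∧ W.ncard < D.ncard := by
  cases h with
  | theta h =>
    obtain ⟨x, y, W₁, W₂, W₃, hxy, h1, h2, h3, h12, h13, h23, d12, d13, d23⟩ := h
    have hC := h1.cycleOn_union h2 hxy h12 d12
    refine ⟨Set.union_subset hC.subset_edgeSet h3.subset_edgeSet, W₁ ∪ W₂ ∪ W₃, ?_, ?_⟩
    · rintro e (he | he) v hv
      exacts [.inl (hC.mem_of_inc he hv), .inr (h3.mem_of_inc he hv)]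
    · rw [Set.ncard_union_eq (Set.disjoint_union_left.2 ⟨d13, d23⟩) hC.finite.2 h3.finite.2]
      have e1 := hC.ncard_eq
      have e2 := h3.ncard_add_one
      have e3 := Set.ncard_union_add_ncard_inter _ _ hC.finite.1 h3.finite.1
      rw [Set.union_inter_distrib_right, h13, h23, Set.union_self, Set.ncard_pair hxy] at e3
      omega
  | @tight W₁ W₂ C₁ C₂ v h₁ h₂ hd hv =>
    refine ⟨Set.union_subset h₁.subset_edgeSet h₂.subset_edgeSet, W₁ ∪ W₂, ?_, ?_⟩
    · rintro e (he | he) v hv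
      exacts [.inl (h₁.mem_of_inc he hv), .inr (h₂.mem_of_inc he hv)]
    · rw [Set.ncard_union_eq hd h₁.finite.2 h₂.finite.2]
      have e1 := h₁.ncard_eq
      have e2 := h₂.ncard_eq
      have e3 := Set.ncard_union_add_ncard_inter _ _ h₁.finite.1 h₂.finite.1
      rw [hv, Set.ncard_singleton] at e3
      omega
  | @loose W₁ W₂ W C₁ C₂ P x y h₁ h₂ hd hP hx hy =>
    have d1 := hP.disjoint_of_inter_subset (fun e he v hv ↦ h₁.mem_of_inc he hv) hx.subset
    have d2 := hP.disjoint_of_inter_subset (fun e he v hv ↦ h₂.mem_of_inc he hv) hy.subset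
    have hd' : Disjoint C₁ C₂ := by
      rw [Set.disjoint_left]
      intro e he he'
      obtain ⟨a, b, hab⟩ := exists_isLink_of_mem_edgeSet (h₁.subset_edgeSet he)
      exact Set.disjoint_left.1 hd (h₁.mem_of_inc he hab.inc_left) (h₂.mem_of_inc he' hab.inc_left)
    have hxy : x ≠ y := by
      rintro rfl
      have m1 : x ∈ W ∩ W₁ := hx ▸ rfl
      have m2 : x ∈ W ∩ W₂ := hy ▸ rfl
      exact Set.disjoint_left.1 hd m1.2 m2.2
    refine ⟨Set.union_subset (Set.union_subset h₁.subset_edgeSet h₂.subset_edgeSet)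
      hP.subset_edgeSet, W₁ ∪ W₂ ∪ W, ?_, ?_⟩
    · rintro e ((he | he) | he) v hv
      exacts [.inl (.inl (h₁.mem_of_inc he hv)), .inl (.inr (h₂.mem_of_inc he hv)),
        .inr (hP.mem_of_inc he hv)]
    · rw [Set.ncard_union_eq (Set.disjoint_union_left.2 ⟨d1.symm, d2.symm⟩)
        (h₁.finite.2.union h₂.finite.2) hP.finite.2, Set.ncard_union_eq hd' h₁.finite.2 h₂.finite.2]
      have e1 := h₁.ncard_eq
      have e2 := h₂.ncard_eq
      have e3 := hP.ncard_add_one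
      have e4 := Set.ncard_union_add_ncard_inter _ _ (h₁.finite.1.union h₂.finite.1) hP.finite.1
      rw [Set.inter_comm, Set.inter_union_distrib_left, hx, hy, Set.singleton_union,
        Set.ncard_pair hxy, Set.ncard_union_eq hd h₁.finite.1 h₂.finite.1] at e4
      omega

theorem noLeaf_and_isConn (h : G.IsBicycle 𝒞 D) : G.NoLeaf D ∧ G.IsConn D := by
  cases h with
  | @theta P₁ P₂ P₃ h =>
    obtain ⟨W, hW⟩ := h.exists_cycleOn
    obtain ⟨W', hW'⟩ := h.rotate.exists_cycleOn
    obtain ⟨e, he⟩ := h.rotate.nonempty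
    obtain ⟨a, b, hab⟩ := exists_isLink_of_mem_edgeSet (hW.subset_edgeSet (.inr he))
    have hD : P₁ ∪ P₂ ∪ P₃ = (P₁ ∪ P₂) ∪ (P₂ ∪ P₃) := by
      ext e
      simp only [Set.mem_union]
      tauto
    rw [hD]
    exact ⟨(hW.noLeaf h.nontrivial).union (hW'.noLeaf h.rotate.nontrivial),
      hW.isConn.union hW'.isConn ⟨e, .inr he, hab.inc_left⟩ ⟨e, .inl he, hab.inc_left⟩⟩
  | @tight W₁ W₂ C₁ C₂ v h₁ h₂ hd hv =>
    have hvW : v ∈ W₁ ∩ W₂ := hv ▸ rfl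
    obtain ⟨e₁, he₁, hev₁⟩ := h₁.exists_inc hvW.1
    obtain ⟨e₂, he₂, hev₂⟩ := h₂.exists_inc hvW.2
    refine ⟨?_, h₁.isConn.union h₂.isConn ⟨e₁, he₁, hev₁⟩ ⟨e₂, he₂, hev₂⟩⟩
    rintro e (he | he) w hw
    · rcases h₁.exists_ne_or he hw with ⟨f, hf, h⟩ | rfl
      · exact ⟨f, .inl hf, h⟩
      · obtain rfl : v = w := hvW.1
        exact ⟨e₂, .inr he₂, fun h ↦ Set.disjoint_right.1 hd he₂ (h ▸ he), hev₂⟩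
    · rcases h₂.exists_ne_or he hw with ⟨f, hf, h⟩ | rfl
      · exact ⟨f, .inr hf, h⟩
      · obtain rfl : v = w := hvW.2
        exact ⟨e₁, .inl he₁, fun h ↦ Set.disjoint_left.1 hd he₁ (h ▸ he), hev₁⟩
  | @loose W₁ W₂ W C₁ C₂ P x y h₁ h₂ hd hP hx hy =>
    have d1 := hP.disjoint_of_inter_subset (fun e he v hv ↦ h₁.mem_of_inc he hv) hx.subset
    have d2 := hP.disjoint_of_inter_subset (fun e he v hv ↦ h₂.mem_of_inc he hv) hy.subset
    have m1 : x ∈ W ∩ W₁ := hx ▸ rfl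
    have m2 : y ∈ W ∩ W₂ := hy ▸ rfl
    have hxy : x ≠ y := by
      rintro rfl
      exact Set.disjoint_left.1 hd m1.2 m2.2
    obtain ⟨a₁, ha₁, hax₁⟩ := h₁.exists_inc m1.2
    obtain ⟨a₂, ha₂, hay₂⟩ := h₂.exists_inc m2.2
    obtain ⟨b₁, hb₁, hbx₁⟩ := hP.exists_inc_left hxy
    obtain ⟨b₂, hb₂, hby₂⟩ := hP.exists_inc_right hxy
    constructor
    · rintro e ((he | he) | he) w hw
      · rcases h₁.exists_ne_or he hw with ⟨f, hf, h⟩ | rfl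
        · exact ⟨f, .inl (.inl hf), h⟩
        · obtain rfl : x = w := m1.2
          exact ⟨b₁, .inr hb₁, fun h ↦ Set.disjoint_left.1 d1 hb₁ (h ▸ he), hbx₁⟩
      · rcases h₂.exists_ne_or he hw with ⟨f, hf, h⟩ | rfl
        · exact ⟨f, .inl (.inr hf), h⟩
        · obtain rfl : y = w := m2.2
          exact ⟨b₂, .inr hb₂, fun h ↦ Set.disjoint_left.1 d2 hb₂ (h ▸ he), hby₂⟩
      · by_cases hwx : w = x
        · subst hwx
          exact ⟨a₁, .inl (.inl ha₁), fun h ↦ Set.disjoint_left.1 d1 he (h ▸ ha₁), hax₁⟩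
        by_cases hwy : w = y
        · subst hwy
          exact ⟨a₂, .inl (.inr ha₂), fun h ↦ Set.disjoint_left.1 d2 he (h ▸ ha₂), hay₂⟩
        obtain ⟨f, hf, h⟩ := hP.exists_ne he hw hwx hwy
        exact ⟨f, .inr hf, h⟩
    · rw [Set.union_assoc, Set.union_comm C₂]
      exact h₁.isConn.union (hP.isConn.union h₂.isConn ⟨b₂, hb₂, hby₂⟩ ⟨a₂, ha₂, hay₂⟩)
        ⟨a₁, ha₁, hax₁⟩ ⟨b₁, .inl hb₁, hbx₁⟩

/-- The cycles of a theta or of handcuffs are the only proper subsets of the edges which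
are connected and have no leaves. -/
theorem eq_or_mem (h : G.IsBicycle 𝒞 D) (hXD : X ⊆ D) (hne : X.Nonempty) (hX : G.NoLeaf X)
    (hc : G.IsConn X) : X = D ∨ X ∈ 𝒞 := by
  cases h with
  | @theta P₁ P₂ P₃ h =>
    have r1 : P₁ ∪ P₂ ∪ P₃ = P₂ ∪ P₃ ∪ P₁ := by rw [Set.union_assoc, Set.union_comm]
    have r2 : P₁ ∪ P₂ ∪ P₃ = P₃ ∪ P₁ ∪ P₂ := by rw [Set.union_comm, ← Set.union_assoc]
    rcases h.subset_or_disjoint hX hXD with h1 | h1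
    swap
    · exact .inr (.inr (.inr (h.rotate.eq_union hX hne
        (h1.symm.subset_left_of_subset_union (r1 ▸ hXD)))))
    rcases h.rotate.subset_or_disjoint hX (r1 ▸ hXD) with h2 | h2
    swap
    · have := h.rotate.rotate.eq_union hX hne (h2.symm.subset_left_of_subset_union (r2 ▸ hXD))
      exact .inr (.inr (.inl (Set.union_comm P₃ P₁ ▸ this)))
    rcases h.rotate.rotate.subset_or_disjoint hX (r2 ▸ hXD) with h3 | h3
    swap
    · exact .inr (.inl (h.eq_union hX hne (h3.symm.subset_left_of_subset_union hXD)))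
    exact .inl (hXD.antisymm (Set.union_subset (Set.union_subset h1 h2) h3))
  | @tight W₁ W₂ C₁ C₂ v h₁ h₂ hd hv =>
    have hvW : v ∈ W₁ ∩ W₂ := hv ▸ rfl
    have s1 : C₁ ⊆ X ∨ Disjoint C₁ X := h₁.subset_or_disjoint hvW.1 fun c hcX hc w hwv hcw ↦ by
      obtain ⟨d, hd, hdc, hdw⟩ := hX c hcX w hcw
      refine ⟨d, hd, (hXD hd).resolve_right fun h ↦ hwv ?_, hdc, hdw⟩
      exact hv.subset ⟨h₁.mem_of_inc hc hcw, h₂.mem_of_inc h hdw⟩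
    have s2 : C₂ ⊆ X ∨ Disjoint C₂ X := h₂.subset_or_disjoint hvW.2 fun c hcX hc w hwv hcw ↦ by
      obtain ⟨d, hd, hdc, hdw⟩ := hX c hcX w hcw
      refine ⟨d, hd, (hXD hd).resolve_left fun h ↦ hwv ?_, hdc, hdw⟩
      exact hv.subset ⟨h₁.mem_of_inc h hdw, h₂.mem_of_inc hc hcw⟩
    rcases s1 with s1 | s1
    · rcases s2 with s2 | s2
      · exact .inl (hXD.antisymm (Set.union_subset s1 s2))
      · exact .inr (.inl ((s2.symm.subset_left_of_subset_union hXD).antisymm s1))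
    · have hX2 := s1.symm.subset_right_of_subset_union hXD
      rcases s2 with s2 | s2
      · exact .inr (.inr (hX2.antisymm s2))
      · obtain ⟨e, he⟩ := hne
        exact (Set.disjoint_right.1 s2 he (hX2 he)).elim
  | @loose W₁ W₂ W C₁ C₂ P x y h₁ h₂ hd hP hx hy =>
    have m1 : x ∈ W ∩ W₁ := hx ▸ rfl
    have m2 : y ∈ W ∩ W₂ := hy ▸ rfl
    have hxy : x ≠ y := by
      rintro rfl
      exact Set.disjoint_left.1 hd m1.2 m2.2
    have s1 : C₁ ⊆ X ∨ Disjoint C₁ X := h₁.subset_or_disjoint m1.2 fun c hcX hc w hwx hcw ↦ by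
      obtain ⟨d, hd', hdc, hdw⟩ := hX c hcX w hcw
      have hw := h₁.mem_of_inc hc hcw
      refine ⟨d, hd', ?_, hdc, hdw⟩
      rcases hXD hd' with (h | h) | h
      · exact h
      · exact (Set.disjoint_left.1 hd hw (h₂.mem_of_inc h hdw)).elim
      · exact (hwx (hx.subset ⟨hP.mem_of_inc h hdw, hw⟩)).elim
    have s2 : C₂ ⊆ X ∨ Disjoint C₂ X := h₂.subset_or_disjoint m2.2 fun c hcX hc w hwy hcw ↦ by
      obtain ⟨d, hd', hdc, hdw⟩ := hX c hcX w hcw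
      have hw := h₂.mem_of_inc hc hcw
      refine ⟨d, hd', ?_, hdc, hdw⟩
      rcases hXD hd' with (h | h) | h
      · exact (Set.disjoint_left.1 hd (h₁.mem_of_inc h hdw) hw).elim
      · exact h
      · exact (hwy (hy.subset ⟨hP.mem_of_inc h hdw, hw⟩)).elim
    have s3 : P ⊆ X ∨ Disjoint P X := hP.subset_or_disjoint fun c hcX hc w hwx hwy hcw ↦ by
      obtain ⟨d, hd', hdc, hdw⟩ := hX c hcX w hcw
      have hw := hP.mem_of_inc hc hcw
      refine ⟨d, hd', ?_, hdc, hdw⟩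
      rcases hXD hd' with (h | h) | h
      · exact (hwx (hx.subset ⟨hw, h₁.mem_of_inc h hdw⟩)).elim
      · exact (hwy (hy.subset ⟨hw, h₂.mem_of_inc h hdw⟩)).elim
      · exact h
    rcases s3 with s3 | s3
    · left
      obtain ⟨b₁, hb₁, hbx₁⟩ := hP.exists_inc_left hxy
      obtain ⟨b₂, hb₂, hby₂⟩ := hP.exists_inc_right hxy
      refine hXD.antisymm (Set.union_subset (Set.union_subset (s1.resolve_right fun h ↦ ?_)
        (s2.resolve_right fun h ↦ ?_)) s3)
      · obtain ⟨d, hd', hdb, hdx⟩ := hX b₁ (s3 hb₁) x hbx₁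
        rcases hXD hd' with (h' | h') | h'
        · exact Set.disjoint_left.1 h h' hd'
        · exact Set.disjoint_left.1 hd m1.2 (h₂.mem_of_inc h' hdx)
        · exact hdb (hP.eq_of_inc_left h' hb₁ hdx hbx₁)
      · obtain ⟨d, hd', hdb, hdx⟩ := hX b₂ (s3 hb₂) y hby₂
        rcases hXD hd' with (h' | h') | h'
        · exact Set.disjoint_left.1 hd (h₁.mem_of_inc h' hdx) m2.2
        · exact Set.disjoint_left.1 h h' hd'
        · exact hdb (hP.reverse.eq_of_inc_left h' hb₂ hdx hby₂)
    · have hX12 := s3.symm.subset_left_of_subset_union hXD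
      rcases s1 with s1 | s1
      · rcases s2 with s2 | s2
        · exfalso
          obtain ⟨a₁, ha₁, hax₁⟩ := h₁.exists_inc m1.2
          obtain ⟨a₂, ha₂, hay₂⟩ := h₂.exists_inc m2.2
          refine Set.disjoint_right.1 hd m2.2 (hc W₁ (fun e he ↦ ?_)
            ⟨a₁, s1 ha₁, x, m1.2, hax₁⟩ a₂ (s2 ha₂) y hay₂)
          rcases hX12 he with h | h
          · exact .inl fun v hv ↦ h₁.mem_of_inc h hv
          · exact .inr fun v hv ↦ Set.disjoint_right.1 hd (h₂.mem_of_inc h hv)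
        · exact .inr (.inl ((s2.symm.subset_left_of_subset_union hX12).antisymm s1))
      · have hX2 := s1.symm.subset_right_of_subset_union hX12
        rcases s2 with s2 | s2
        · exact .inr (.inr (hX2.antisymm s2))
        · obtain ⟨e, he⟩ := hne
          exact (Set.disjoint_right.1 s2 he (hX2 he)).elim

theorem singleton_mem (h : G.IsBicycle 𝒞 D) {d : E} (hd : d ∈ D) {v : V} (hv : G.IsLink d v v) :
    {d} ∈ 𝒞 := by
  cases h with
  | theta h =>
    obtain ⟨x, y, W₁, W₂, W₃, hxy, h1, h2, h3, -⟩ := h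
    rcases hd with (hd | hd) | hd
    exacts [(h1.not_isLoopAt hd hv).elim, (h2.not_isLoopAt hd hv).elim, (h3.not_isLoopAt hd hv).elim]
  | tight h₁ h₂ =>
    rcases hd with hd | hd
    exacts [.inl (h₁.eq_singleton_of_isLink hd hv).symm, .inr (h₂.eq_singleton_of_isLink hd hv).symm]
  | loose h₁ h₂ hd' hP =>
    rcases hd with (hd | hd) | hd
    exacts [.inl (h₁.eq_singleton_of_isLink hd hv).symm,
      .inr (h₂.eq_singleton_of_isLink hd hv).symm, (hP.not_isLoopAt hd hv).elim]

end IsBicycle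

end Graph

/-- The three kinds of circuits that are not balanced cycles share one description, which lets the
arguments about circuits avoid a case distinction. -/
theorem BiasedGraph.isFrameCircuit_iff {V E : Type*} (Ω : BiasedGraph V E) {D : Set E} :
    Ω.IsFrameCircuit D ↔
      D ∈ Ω.balanced ∨ ∃ 𝒞, Ω.graph.IsBicycle 𝒞 D ∧ ∀ C ∈ 𝒞, C ∉ Ω.balanced := by
  refine or_congr_right ⟨?_, ?_⟩
  · rintro (⟨W₁, W₂, C₁, C₂, v, h1, h2, hd, hv, rfl⟩ |
      ⟨W₁, W₂, W, C₁, C₂, P, x, y, h1, h2, hd, hP, hx, hy, rfl⟩ | ⟨P₁, P₂, P₃, h, h1, h2, h3, rfl⟩)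
    · refine ⟨_, .tight h1.1 h2.1 hd hv, ?_⟩
      rintro C (rfl | rfl)
      exacts [h1.2, h2.2]
    · refine ⟨_, .loose h1.1 h2.1 hd hP hx hy, ?_⟩
      rintro C (rfl | rfl)
      exacts [h1.2, h2.2]
    · refine ⟨_, .theta h, ?_⟩
      rintro C (rfl | rfl | rfl)
      exacts [h1, h2, h3]
  · rintro ⟨𝒞, h, hb⟩
    cases h with
    | theta h =>
      exact .inr (.inr ⟨_, _, _, h, hb _ (.inl rfl), hb _ (.inr (.inl rfl)),
        hb _ (.inr (.inr rfl)), rfl⟩)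
    | tight h1 h2 hd hv =>
      exact .inl ⟨_, _, _, _, _, ⟨h1, hb _ (.inl rfl)⟩, ⟨h2, hb _ (.inr rfl)⟩, hd, hv, rfl⟩
    | loose h1 h2 hd hP hx hy =>
      exact .inr (.inl ⟨_, _, _, _, _, _, _, _, ⟨h1, hb _ (.inl rfl)⟩, ⟨h2, hb _ (.inr rfl)⟩,
        hd, hP, hx, hy, rfl⟩)

/-! ### From frameworks to biased graphs -/

/-- The graph with vertex set `V` and edge set `X` in which `e` has the ends `ends e`. -/
def Graph.ofEnds {V E : Type*} (X : Set E) (ends : E → Set V) : Graph V E where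
  vertexSet := Set.univ
  -- A single end gives `x = y`, that is, a loop of the graph.
  IsLink e x y := e ∈ X ∧ ends e = {x, y}
  isLink_symm := fun _ _ ↦ ⟨fun x y h ↦ ⟨h.1, Set.pair_comm x y ▸ h.2⟩⟩
  eq_or_eq_of_isLink_of_isLink := fun e x y v w h h' ↦ by
    have : x ∈ ({v, w} : Set V) := h'.2 ▸ h.2 ▸ .inl rfl
    exact this
  left_mem_of_isLink := fun _ _ _ _ ↦ trivial

theorem Graph.ofEnds_inc_iff {V E : Type*} {X : Set E} {ends : E → Set V} {e : E} (he : e ∈ X)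
    (hne : (ends e).Nonempty) (hfin : (ends e).Finite) (hle : (ends e).ncard ≤ 2) {v : V} :
    (Graph.ofEnds X ends).Inc e v ↔ v ∈ ends e := by
  constructor
  · rintro ⟨w, -, hw⟩
    exact hw ▸ .inl rfl
  · intro hv
    have h1 := (Set.ncard_pos hfin).2 hne
    rcases (by omega : (ends e).ncard = 1 ∨ (ends e).ncard = 2) with h | h
    · obtain ⟨a, ha⟩ := Set.ncard_eq_one.1 h
      obtain rfl : v = a := by
        rw [ha] at hv
        exact hv
      exact ⟨v, he, by simp [ha]⟩
    · obtain ⟨a, b, -, hab⟩ := Set.ncard_eq_two.1 h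
      rw [hab] at hv
      rcases hv with rfl | rfl
      · exact ⟨b, he, hab⟩
      · exact ⟨a, he, by rw [hab, Set.pair_comm]⟩

namespace Matroid

variable {α V : Type*} {M : Matroid α} {ends : α → Set V}

open scoped Classical in
/-- The graph of a framework, with the loops of the matroid attached to a new vertex. -/
noncomputable def frameworkGraph (M : Matroid α) (ends : α → Set V) : Graph (Option V) α :=
  .ofEnds M.E fun e ↦ if M.Indep {e} then some '' ends e else {none}

theorem frameworkGraph_isLink_some {e : α} (he : M.Indep {e}) {v : V} (hv : ends e = {v}) :
    (M.frameworkGraph ends).IsLink e (some v) (some v) := by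
  refine ⟨he.subset_ground rfl, ?_⟩
  simp [he, hv]

theorem frameworkGraph_isLink_none {e : α} (heE : e ∈ M.E) (he : ¬ M.Indep {e}) :
    (M.frameworkGraph ends).IsLink e none none := by
  refine ⟨heE, ?_⟩
  simp [he]

namespace IsFramework

variable [Finite V] (h : M.IsFramework ends)

include h

theorem frameworkGraph_inc {e : α} (he : e ∈ M.E) {v : Option V} :
    (M.frameworkGraph ends).Inc e v ↔
      (M.Indep {e} ∧ ∃ w ∈ ends e, some w = v) ∨ ¬ M.Indep {e} ∧ v = none := by
  classical
  rw [frameworkGraph, Graph.ofEnds_inc_iff he _ (Set.toFinite _)]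
  · split_ifs with hi <;> simp [hi]
  · split_ifs with hi
    · rw [Set.ncard_image_of_injective _ (Option.some_injective V)]
      exact h.ncard_ends_le e he
    · simp
  · split_ifs with hi
    · exact (h.ends_nonempty hi).image _
    · simp

theorem frameworkGraph_edgeSet : (M.frameworkGraph ends).edgeSet = M.E := by
  ext e
  rw [Graph.edge_mem_iff_exists_isLink]
  constructor
  · rintro ⟨x, y, he, -⟩
    exact he
  · intro he
    have : ∃ v, (M.frameworkGraph ends).Inc e v := by
      by_cases hi : M.Indep {e}
      · obtain ⟨w, hw⟩ := h.ends_nonempty hi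
        exact ⟨some w, (h.frameworkGraph_inc he).2 (.inl ⟨hi, w, hw, rfl⟩)⟩
      · exact ⟨none, (h.frameworkGraph_inc he).2 (.inr ⟨hi, rfl⟩)⟩
    exact this

theorem frameworkGraph_inc_some {e : α} (he : M.Indep {e}) {v : V} :
    (M.frameworkGraph ends).Inc e (some v) ↔ v ∈ ends e := by
  rw [h.frameworkGraph_inc (he.subset_ground rfl)]
  simp [he]

theorem frameworkGraph_inc_none {e : α} (he : M.Indep {e}) :
    ¬ (M.frameworkGraph ends).Inc e none := by
  rw [h.frameworkGraph_inc (he.subset_ground rfl)]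
  simp [he]

theorem noLeaf {C : Set α} (hC : M.IsCircuit C) (hn : C.Nontrivial) :
    (M.frameworkGraph ends).NoLeaf C := by
  intro x hx v hv
  have hi := fun {y} (hy : y ∈ C) ↦ hC.indep_singleton_of_nontrivial hn hy
  cases v with
  | none => exact (h.frameworkGraph_inc_none (hi hx) hv).elim
  | some v =>
    obtain ⟨y, hy, hyx, hyv⟩ := h.exists_ne hC hn x hx v ((h.frameworkGraph_inc_some (hi hx)).1 hv)
    exact ⟨y, hy, hyx, (h.frameworkGraph_inc_some (hi hy)).2 hyv⟩

theorem isConn {C : Set α} (hC : M.IsCircuit C) (hn : C.Nontrivial) :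
    (M.frameworkGraph ends).IsConn C := by
  have hi := fun {y} (hy : y ∈ C) ↦ hC.indep_singleton_of_nontrivial hn hy
  rintro S hS ⟨x, hx, v, hvS, hv⟩ y hy w hw
  cases w with
  | none => exact (h.frameworkGraph_inc_none (hi hy) hw).elim
  | some w =>
    refine h.connected (W := some ⁻¹' S) hC (fun z hz ↦ ?_) ⟨x, hx, fun u hu ↦ ?_⟩ y hy
      ((h.frameworkGraph_inc_some (hi hy)).1 hw)
    · refine (hS z hz).imp (fun h' u hu ↦ ?_) fun h' ↦ Set.disjoint_left.2 fun u hu ↦ ?_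
      all_goals exact h' _ ((h.frameworkGraph_inc_some (hi hz)).2 hu)
    · exact ((hS x hx).resolve_right fun h' ↦ h' v hv hvS) _
        ((h.frameworkGraph_inc_some (hi hx)).2 hu)

theorem dep_of_isBicycle {𝒞 : Set (Set α)} {D : Set α}
    (hD : (M.frameworkGraph ends).IsBicycle 𝒞 D) : M.Dep D := by
  obtain ⟨hDE, W, hW, hlt⟩ := hD.exists_ncard_lt
  rw [h.frameworkGraph_edgeSet] at hDE
  refine (M.not_indep_iff hDE).1 fun hi ↦ ?_
  have h1 := h.ncard_le (W := some ⁻¹' W) hi fun x hx v hv ↦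
    hW x hx _ ((h.frameworkGraph_inc_some (hi.subset (by simpa using hx))).2 hv)
  have h2 : (some ⁻¹' W : Set V).ncard ≤ W.ncard := by
    rw [← Set.ncard_image_of_injective _ (Option.some_injective V)]
    exact Set.ncard_le_ncard (Set.image_preimage_subset _ _) (Set.toFinite _)
  omega

/-- In a framework, circuits with at least two elements are connected and have no leaves. A loop of
`M` is a loop of the graph at `none`, hence by itself a cycle of the theta or handcuffs containing
it. -/
theorem eq_or_mem_of_isBicycle {𝒞 : Set (Set α)} {C D : Set α}
    (hD : (M.frameworkGraph ends).IsBicycle 𝒞 D) (hC : M.IsCircuit C) (hCD : C ⊆ D) :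
    C = D ∨ C ∈ 𝒞 := by
  by_cases hn : C.Nontrivial
  · exact hD.eq_or_mem hCD hC.nonempty (h.noLeaf hC hn) (h.isConn hC hn)
  · rw [Set.not_nontrivial_iff] at hn
    obtain ⟨d, hd⟩ := hC.nonempty
    obtain rfl := hn.eq_singleton_of_mem hd
    exact .inr (hD.singleton_mem (hCD hd)
      (frameworkGraph_isLink_none (hC.subset_ground hd) hC.not_indep))

/-- The biased graph of a framework. -/
noncomputable def biasedGraph [M.Finite] : BiasedGraph (Option V) α where
  graph := M.frameworkGraph ends
  finite_vertexSet := Set.toFinite _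
  finite_edgeSet := h.frameworkGraph_edgeSet ▸ M.ground_finite
  balanced := {C | M.IsCircuit C ∧ ∃ W, (M.frameworkGraph ends).CycleOn W C}
  cycle_of_balanced := fun _ hC ↦ hC.2
  theta_property := by
    rintro P₁ P₂ P₃ hP ⟨h12, -⟩ ⟨h23, -⟩
    refine ⟨?_, hP.swap.rotate.exists_cycleOn⟩
    -- Eliminate an edge `e` of the common path `P₂` from the two circuits. The circuit obtained
    -- lies in the theta and avoids `e`, so it can only be `P₁ ∪ P₃`.
    obtain ⟨e, he⟩ := hP.rotate.nonempty
    have hne : P₁ ∪ P₂ ≠ P₂ ∪ P₃ := by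
      intro heq
      obtain ⟨f, hf⟩ := hP.nonempty
      rcases heq.subset (.inl hf) with hf' | hf'
      · exact Set.disjoint_left.1 hP.disjoint hf hf'
      · exact Set.disjoint_left.1 hP.swap.rotate.disjoint hf hf'
    obtain ⟨C, hCs, hC⟩ := h12.elimination h23 hne e
    rcases h.eq_or_mem_of_isBicycle (.theta hP) hC (fun x hx ↦ by
      rcases (hCs hx).1 with h' | h' | h'
      exacts [.inl h', .inl (.inr h'), .inr h']) with rfl | rfl | rfl | rfl
    · exact ((hCs (.inl (.inr he))).2 rfl).elim
    · exact ((hCs (.inr he)).2 rfl).elim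
    · exact hC
    · exact ((hCs (.inl he)).2 rfl).elim

/-- A circuit is a cycle, and then balanced by definition, or contains a theta or handcuffs. These
are dependent, having more edges than vertices, so they are the whole circuit. Conversely, a circuit
contained in a theta or handcuffs is everything or one of the cycles, and the latter would then be
balanced. -/
theorem biasedGraph_represents [M.Finite] : h.biasedGraph.Represents M := by
  have hb : ∀ C, C ∈ h.biasedGraph.balanced ↔
    M.IsCircuit C ∧ ∃ W, (M.frameworkGraph ends).CycleOn W C := fun _ ↦ Iff.rfl
  refine ⟨h.frameworkGraph_edgeSet.symm, fun D ↦ ?_⟩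
  rw [BiasedGraph.isFrameCircuit_iff, hb]
  change _ ↔ _ ∨ ∃ 𝒞, (M.frameworkGraph ends).IsBicycle 𝒞 D ∧ _
  constructor
  · intro hD
    by_cases hn : D.Nontrivial
    · rcases Graph.exists_isBicycle (Set.toFinite _)
        (h.frameworkGraph_edgeSet ▸ hD.subset_ground) hD.nonempty (h.noLeaf hD hn)
        (h.isConn hD hn) with hW | ⟨𝒞, D', hD', hDD⟩
      · exact .inl ⟨hD, hW⟩
      by_cases hbal : ∃ C ∈ 𝒞, C ∈ h.biasedGraph.balanced
      · obtain ⟨C, hC𝒞, hC⟩ := hbal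
        obtain rfl := hC.1.eq_of_subset_isCircuit hD ((hD'.exists_cycleOn hC𝒞).2.trans hDD)
        exact .inl hC
      · push Not at hbal
        obtain rfl := hD.eq_of_dep_subset (h.dep_of_isBicycle hD') hDD
        exact .inr ⟨𝒞, hD', hbal⟩
    · rw [Set.not_nontrivial_iff] at hn
      obtain ⟨d, hd⟩ := hD.nonempty
      obtain rfl := hn.eq_singleton_of_mem hd
      exact .inl ⟨hD, _, .of_loop
        (frameworkGraph_isLink_none (hD.subset_ground hd) hD.not_indep)⟩
  · rintro (hD | ⟨𝒞, hD, hbal⟩)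
    · exact hD.1
    · obtain ⟨C, hCD, hC⟩ := (h.dep_of_isBicycle hD).exists_isCircuit_subset
      rcases h.eq_or_mem_of_isBicycle hD hC hCD with rfl | hC𝒞
      · exact hC
      · exact (hbal C hC𝒞 ⟨hC, (hD.exists_cycleOn hC𝒞).1⟩).elim

end IsFramework

theorem HasFramework.isFrameMatroidal [M.Finite] {K : Set α} (h : M.HasFramework K) :
    M.IsFrameMatroidal K := by
  obtain ⟨V, _, ends, hF, hK⟩ := h
  refine ⟨Option V, hF.biasedGraph, hF.biasedGraph_represents, fun e he ↦ ?_⟩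
  obtain ⟨hi, v, hv⟩ := hK e he
  exact ⟨⟨some v, frameworkGraph_isLink_some hi hv⟩, fun h ↦ h.1.not_indep hi⟩

end Matroid

/-! ### From biased graphs to frameworks -/

namespace BiasedGraph

variable {V E : Type*} (Ω : BiasedGraph V E) {X D : Set E}

theorem IsFrameCircuit.isConn {Ω : BiasedGraph V E} (h : Ω.IsFrameCircuit D) :
    Ω.graph.IsConn D := by
  rcases Ω.isFrameCircuit_iff.1 h with h | ⟨𝒞, h, -⟩
  · obtain ⟨W, hW⟩ := Ω.cycle_of_balanced D h
    exact hW.isConn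
  · exact h.noLeaf_and_isConn.2

theorem IsFrameCircuit.noLeaf {Ω : BiasedGraph V E} (h : Ω.IsFrameCircuit D)
    (hn : D.Nontrivial) : Ω.graph.NoLeaf D := by
  rcases Ω.isFrameCircuit_iff.1 h with h | ⟨𝒞, h, -⟩
  · obtain ⟨W, hW⟩ := Ω.cycle_of_balanced D h
    exact hW.noLeaf hn
  · exact h.noLeaf_and_isConn.1

/-- A set of edges without frame circuits has at most as many edges as vertices. -/
theorem ncard_le_of_forall_not_isFrameCircuit {n : ℕ} :
    ∀ {X : Set E} {W : Set V}, X.ncard = n → X ⊆ Ω.graph.edgeSet → W.Finite →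
      (∀ e ∈ X, ∀ v, Ω.graph.Inc e v → v ∈ W) → (∀ D ⊆ X, ¬ Ω.IsFrameCircuit D) →
      X.ncard ≤ W.ncard := by
  induction n using Nat.strong_induction_on with
  | _ n ih =>
  intro X W hn hXE hW hXW hX
  have hXf := Ω.finite_edgeSet.subset hXE
  obtain rfl | hne := X.eq_empty_or_nonempty
  · simp
  by_cases hleaf : Ω.graph.NoLeaf X
  swap
  -- Delete a leaf together with its only edge.
  · simp only [Graph.NoLeaf, not_forall, not_exists, not_and] at hleaf
    obtain ⟨x, hx, v, hxv, hno⟩ := hleaf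
    have h1 := Set.ncard_sdiff_singleton_add_one hx hXf
    have h2 := Set.ncard_sdiff_singleton_add_one (hXW x hx v hxv) hW
    have := ih _ (by omega) (X := X \ {x}) (W := W \ {v}) rfl (Set.sdiff_subset.trans hXE)
      (hW.subset Set.sdiff_subset) (fun e he u hu ↦ ⟨hXW e he.1 u hu, by
        rintro rfl
        exact hno e he.1 he.2 hu⟩) fun D hD ↦ hX D (hD.trans Set.sdiff_subset)
    omega
  by_cases hconn : Ω.graph.IsConn X
  swap
  -- Divide the edges and the vertices along a separating set `S`.
  · simp only [Graph.IsConn, not_forall] at hconn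
    obtain ⟨S, hS, ⟨x, hx, u, huS, hxu⟩, y, hy, w, hyw, hwS⟩ := hconn
    let A := {e ∈ X | ∀ v, Ω.graph.Inc e v → v ∈ S}
    have hA : A ⊆ X := fun e he ↦ he.1
    have hxA : x ∈ A := ⟨hx, (hS x hx).resolve_right fun h ↦ h u hxu huS⟩
    have hyA : y ∉ A := fun h ↦ hwS (h.2 w hyw)
    have l1 : A.ncard < X.ncard := Set.ncard_lt_ncard ⟨hA, fun h ↦ hyA (h hy)⟩ hXf
    have l2 : (X \ A).ncard < X.ncard :=
      Set.ncard_lt_ncard ⟨Set.sdiff_subset, fun h ↦ (h hx).2 hxA⟩ hXf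
    have h1 := ih _ (hn ▸ l1) (X := A) (W := W ∩ S) rfl (hA.trans hXE)
      (hW.subset Set.inter_subset_left) (fun e he v hv ↦ ⟨hXW e he.1 v hv, he.2 v hv⟩)
      fun D hD ↦ hX D (hD.trans hA)
    have h2 := ih _ (hn ▸ l2) (X := X \ A) (W := W \ S) rfl (Set.sdiff_subset.trans hXE)
      (hW.subset Set.sdiff_subset) (fun e he v hv ↦ ⟨hXW e he.1 v hv,
        (hS e he.1).resolve_left (fun h ↦ he.2 ⟨he.1, h⟩) v hv⟩)
      fun D hD ↦ hX D (hD.trans Set.sdiff_subset)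
    have h3 := Set.ncard_sdiff_add_ncard_of_subset hA hXf
    have h4 := Set.ncard_inter_add_ncard_sdiff_eq_ncard W S hW
    omega
  -- There remains a cycle, which has as many edges as vertices, or a set containing a theta or
  -- handcuffs. The latter are a frame circuit, or contain a balanced cycle, which is one.
  rcases Graph.exists_isBicycle Ω.finite_vertexSet hXE hne hleaf hconn with
    ⟨W', hC⟩ | ⟨𝒞, D, hD, hDX⟩
  · rw [hC.ncard_eq]
    refine Set.ncard_le_ncard (fun v hv ↦ ?_) hW
    obtain ⟨e, he, hev⟩ := hC.exists_inc hv
    exact hXW e he v hev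
  · exfalso
    by_cases hbal : ∃ C ∈ 𝒞, C ∈ Ω.balanced
    · obtain ⟨C, hC, hCb⟩ := hbal
      exact hX C ((hD.exists_cycleOn hC).2.trans hDX) (.inl hCb)
    · push Not at hbal
      exact hX D hDX (Ω.isFrameCircuit_iff.2 (.inr ⟨𝒞, hD, hbal⟩))

/-- The ends of an edge of a biased graph. -/
def ends (e : E) : Set Ω.graph.vertexSet := {v | Ω.graph.Inc e v}

variable {Ω} {M : Matroid E}

theorem Represents.isFramework (h : Ω.Represents M) : M.IsFramework Ω.ends where
  ncard_ends_le e he := by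
    obtain ⟨a, b, hab⟩ := Graph.exists_isLink_of_mem_edgeSet (h.1 ▸ he)
    refine (Set.ncard_le_ncard (t := {⟨a, hab.left_mem⟩, ⟨b, hab.right_mem⟩})
      (fun v hv ↦ ?_) (Set.toFinite _)).trans ((Set.ncard_insert_le _ _).trans (by simp))
    exact (hv.eq_or_eq_of_isLink hab).imp Subtype.ext Subtype.ext
  ncard_le A W hA hAW := by
    have : Finite Ω.graph.vertexSet := Ω.finite_vertexSet
    have hf : W.Finite := W.toFinite
    rw [← Set.ncard_image_of_injective W Subtype.val_injective]
    refine Ω.ncard_le_of_forall_not_isFrameCircuit rfl (h.1 ▸ hA.subset_ground) (hf.image _)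
      (fun e he v hv ↦ ⟨⟨v, hv.vertex_mem⟩, hAW e he hv, rfl⟩) fun D hD hDc ↦ ?_
    exact ((h.2 D).2 hDc).not_indep (hA.subset hD)
  exists_ne C hC hn x hx v hv := ((h.2 C).1 hC).noLeaf hn x hx v hv
  connected C W hC hW := by
    rintro ⟨x, hx, hxW⟩ y hy v hv
    obtain ⟨a, b, hab⟩ := Graph.exists_isLink_of_mem_edgeSet (h.1 ▸ hC.subset_ground hx)
    have := ((h.2 C).1 hC).isConn (Subtype.val '' W) (fun e he ↦ ?_)
      ⟨x, hx, a, ⟨⟨a, hab.left_mem⟩, hxW hab.inc_left, rfl⟩, hab.inc_left⟩ y hy v hv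
    · obtain ⟨w, hw, hwv⟩ := this
      rwa [← Subtype.ext hwv]
    · refine (hW e he).imp (fun h' u hu ↦ ⟨⟨u, hu.vertex_mem⟩, h' hu, rfl⟩) fun h' u hu ↦ ?_
      rintro ⟨w, hw, rfl⟩
      exact Set.disjoint_left.1 h' hu hw

/-- A theta or handcuffs cannot consist of a single edge, since they have no leaf. So the set of a
single loop is a circuit only if it is balanced. -/
theorem IsUnbalancedLoop.indep (h : Ω.Represents M) {e : E} (he : Ω.IsUnbalancedLoop e) :
    M.Indep {e} ∧ ∃ v, Ω.ends e = {v} := by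
  obtain ⟨⟨x, hx⟩, heb⟩ := he
  constructor
  · by_contra hcon
    obtain ⟨C, hCe, hC⟩ := ((M.not_indep_iff
      (Set.singleton_subset_iff.2 (h.1 ▸ hx.edge_mem))).1 hcon).exists_isCircuit_subset
    obtain rfl := (Set.subset_singleton_iff_eq.1 hCe).resolve_left hC.nonempty.ne_empty
    rcases Ω.isFrameCircuit_iff.1 ((h.2 _).1 hC) with h' | ⟨𝒞, h', -⟩
    · exact heb h'
    · obtain ⟨y, hy, hye, -⟩ := h'.noLeaf_and_isConn.1 e rfl x hx.inc
      exact hye hy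
  · refine ⟨⟨x, hx.vertex_mem⟩, ?_⟩
    ext v
    constructor
    · intro hv
      exact Subtype.ext ((hv.eq_or_eq_of_isLink hx).elim id id)
    · rintro rfl
      exact hx.inc

end BiasedGraph

namespace Matroid

theorem IsFrameMatroidal.hasFramework {α : Type*} {M : Matroid α} {L : Set α}
    (h : M.IsFrameMatroidal L) : M.HasFramework L := by
  obtain ⟨V, Ω, hΩ, hL⟩ := h
  exact ⟨Ω.graph.vertexSet, Ω.finite_vertexSet, Ω.ends, hΩ.isFramework,
    fun e he ↦ (hL e he).indep hΩ⟩

end Matroid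

/-! ### The theorem. -/

theorem mainTheorem6 {α : Type*} (N : Matroid α) [N.Finite] (L : Set α) (hL : L ⊆ N.E)
    (M : Matroid α) (hM : N.IsU24Sum L M) :
    M.IsFrame ↔ N.IsFrameMatroidal L := by
  obtain ⟨_, -, h⟩ := hM.hasFramework_iff
  -- No loops are prescribed in the 2-sum, so precisely the elements of `L` are prescribed in `N`.
  have h0 := h ∅ (Set.empty_subset _) (Set.empty_disjoint _)
  rw [Set.empty_union] at h0
  exact ⟨fun hF ↦ (h0.1 hF.hasFramework).isFrameMatroidal, fun hF ↦ (h0.2 hF.hasFramework).isFrame⟩
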